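/- Notation. Let $\langle x\rangle=\sqrt{1+x^2}$ and let $X=H^2(\mathbb R)\cap H^{1,1}(\mathbb R)$, where $H^{1,1}(\mathbb R)=\{q:\ q,\partial_xq,\langle x\rangle q,\langle x\rangle\partial_xq\in L^2(\mathbb R)\}$, for complex-valued functions, with norm $\|q\|_X=\|q\|_{H^2}+\|q\|_{H^{1,1}}$. Let $C_I=\{\lambda:\operatorname{Re}\lambda>0,\ \operatorname{Im}\lambda>0\}$. For $q\in X$ consider the spectral problem $$\partial_x\Psi=\Big(-i\lambda^2+\tfrac i4|q|^2\Big)\sigma_3\Psi+\lambda\begin{pmatrix}0&q\\-\bar q&0\end{pmatrix}\Psi .$$ For $\lambda\in C_I$ let $\varphi_-(x;\lambda)$ and $\phi_+(x;\lambda)$ be the Jost functions of $q$, i.e. the bounded $\mathbb C^2$-valued functions such that $\varphi_-e^{-i\lambda^2x}$ and $\phi_+e^{i\lambda^2x}$ solve the spectral problem, with $\varphi_-\to e_1$ as $x\to-\infty$ and $\phi_+\to e_2$ as $x\to+\infty$ (equivalently, the bounded solutions of the corresponding Volterra equations). Put $a(\lambda)=\det\big(\varphi_-e^{-i\lambda^2x},\phi_+e^{i\lambda^2x}\big)$,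 which does not depend on $x$, and let $Z_1$ be the set of $q\in X$ for which $a$ has exactly one zero in $C_I$ and this zero is simple. For $\Phi=(f,g)^T:\mathbb R\to\mathbb C^2$ and $\lambda\in C_I$ put $m_\lambda(\Phi)=\lambda|f|^2+\bar\lambda|g|^2$ and $$B(\Phi,\lambda)q=\frac{m_{\bar\lambda}(\Phi)}{m_\lambda(\Phi)}\,q-2i\,\frac{(\lambda^2-\bar\lambda^2)f\bar g}{m_\lambda(\Phi)} .$$ Proposition 4.4. Let $\lambda_1\in C_I$, $c\in\mathbb C\setminus\{0\}$ and $M>0$. There is a constant $C_M>0$, depending only on $M$, $\lambda_1$ and $c$, with the following property. Let $q\in Z_1$ with $a(\lambda_1)=0$, let $\Phi_1(x)=\varphi_-(x;\lambda_1)e^{-i\lambda_1^2x}$ and $q^{(1)}=B(\Phi_1,\lambda_1)q$, and suppose that $q^{(1)}\in X$ and $\|q^{(1)}\|_X\le M$. Then $$B(\tilde\Phi_1,\lambda_1)q^{(1)}\in X\qquad\text{and}\qquad \|B(\tilde\Phi_1,\lambda_1)q^{(1)}\|_X\le C_M$$ in each of the following two cases: (i) $\tilde\Phi_1(x)=e^{-i\lambda_1^2x}\varphi^{(1)}_-(x;\lambda_1)+c\,e^{i\lambda_1^2x}\phi^{(1)}_+(x;\lambda_1)$,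 where $\varphi_-^{(1)},\phi_+^{(1)}$ are the Jost functions of $q^{(1)}$; (ii) $\tilde\Phi_1=|m_{\lambda_1}(\Phi_1)|^{-1}(\bar g_1,-\bar f_1)^T$ with $\Phi_1=(f_1,g_1)^T$, the vector for which $B(\tilde\Phi_1,\lambda_1)$ is the left inverse of $B(\Phi_1,\lambda_1)$, provided that $c$ is the norming constant of $q$, i.e. $\varphi_-(x;\lambda_1)e^{-i\lambda_1^2x}=c\,\phi_+(x;\lambda_1)e^{i\lambda_1^2x}$ for all $x$. -/

import Mathlib

open MeasureTheory ComplexConjugate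

namespace DNLSII

/-! ### Sobolev spaces on the line (complex valued functions, weak derivatives) -/

/-- `g` is a weak derivative of `f` on `ℝ`: both are locally integrable and
`∫ φ' f = - ∫ φ g` for every smooth compactly supported test function `φ`. -/
def IsWeakDeriv (f g : ℝ → ℂ) : Prop :=
  LocallyIntegrable f volume ∧ LocallyIntegrable g volume ∧
    ∀ φ : ℝ → ℝ, ContDiff ℝ (⊤ : ℕ∞) φ → HasCompactSupport φ →
      ∫ x, deriv φ x • f x = - ∫ x, φ x • g x

/-- `f` has a weak derivative. -/
def HasWeakDeriv (f : ℝ → ℂ) : Prop := ∃ g, IsWeakDeriv f g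

open Classical in
/-- A weak derivative of `f` (it is unique up to a null set), and `0` if there is none. -/
noncomputable def weakDeriv (f : ℝ → ℂ) : ℝ → ℂ :=
  if h : HasWeakDeriv f then h.choose else 0

/-- The function `⟨x⟩ f(x)` with `⟨x⟩ = √(1 + x²)`. -/
noncomputable def weighted (f : ℝ → ℂ) : ℝ → ℂ := fun x => (Real.sqrt (1 + x ^ 2) : ℂ) * f x

/-- The weighted space `L^{2,1}(ℝ)`. -/
def MemL21 (f : ℝ → ℂ) : Prop := MemLp f 2 volume ∧ MemLp (weighted f) 2 volume

/-- The Sobolev space `H²(ℝ)`. -/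
def MemH2 (f : ℝ → ℂ) : Prop :=
  MemLp f 2 volume ∧
    HasWeakDeriv f ∧ MemLp (weakDeriv f) 2 volume ∧
    HasWeakDeriv (weakDeriv f) ∧ MemLp (weakDeriv (weakDeriv f)) 2 volume

/-- The weighted Sobolev space `H^{1,1}(ℝ)`. -/
def MemH11 (f : ℝ → ℂ) : Prop :=
  MemL21 f ∧ HasWeakDeriv f ∧ MemL21 (weakDeriv f)

/-- The space `H²(ℝ) ∩ H^{1,1}(ℝ)`. -/
def MemX (f : ℝ → ℂ) : Prop := MemH2 f ∧ MemH11 f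

/-- The `L²(ℝ)` norm. -/
noncomputable def normL2 (f : ℝ → ℂ) : ℝ := (eLpNorm f 2 volume).toReal

/-- The norm of `H²(ℝ)`. -/
noncomputable def normH2 (f : ℝ → ℂ) : ℝ :=
  Real.sqrt (normL2 f ^ 2 + normL2 (weakDeriv f) ^ 2 + normL2 (weakDeriv (weakDeriv f)) ^ 2)

/-- The norm of `H^{1,1}(ℝ)`; as `⟨x⟩ ≥ 1`, the weighted `L²` norms dominate the unweighted. -/
noncomputable def normH11 (f : ℝ → ℂ) : ℝ :=
  Real.sqrt (normL2 (weighted f) ^ 2 + normL2 (weighted (weakDeriv f)) ^ 2)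

/-- The norm of `H²(ℝ) ∩ H^{1,1}(ℝ)`. -/
noncomputable def normX (f : ℝ → ℂ) : ℝ := normH2 f + normH11 f

/-! ### Jost functions and scattering data

The spectral problem is `Ψ' = (-iλ² + (i/4)|q|²) σ₃ Ψ + λ Q Ψ`, `Q = ((0, q), (-q̄, 0))`. Vectors of
`ℂ²` are pairs. -/

/-- The open first quadrant. -/
def quadrantI : Set ℂ := {z | 0 < z.re ∧ 0 < z.im}

/-- `φ` is the Jost function `φ₋(·; l)`: the bounded solution of the Volterra equation
`φ(x) = e₁ + ∫_{-∞}^x diag(1, e^{2il²(x-y)}) ((i/4)|q|² σ₃ + l Q)(y) φ(y) dy`. -/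
def IsJostMinus (q : ℝ → ℂ) (l : ℂ) (φ : ℝ → ℂ × ℂ) : Prop :=
  Continuous φ ∧ (∃ K : ℝ, ∀ x, ‖φ x‖ ≤ K) ∧
    ∀ x, φ x =
      (1 + ∫ y in Set.Iic x,
          (Complex.I / 4 * (q y * conj (q y)) * (φ y).1 + l * q y * (φ y).2),
        ∫ y in Set.Iic x, Complex.exp (2 * Complex.I * l ^ 2 * ((x : ℂ) - (y : ℂ))) *
          (-(l * conj (q y)) * (φ y).1 - Complex.I / 4 * (q y * conj (q y)) * (φ y).2))

/-- `φ` is the Jost function `ϕ₊(·; l)`: the bounded solution of the Volterra equation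
`φ(x) = e₂ - ∫_x^∞ diag(e^{-2il²(x-y)}, 1) ((i/4)|q|² σ₃ + l Q)(y) φ(y) dy`. -/
def IsJostPlus (q : ℝ → ℂ) (l : ℂ) (φ : ℝ → ℂ × ℂ) : Prop :=
  Continuous φ ∧ (∃ K : ℝ, ∀ x, ‖φ x‖ ≤ K) ∧
    ∀ x, φ x =
      (- ∫ y in Set.Ioi x, Complex.exp (-(2 * Complex.I * l ^ 2 * ((x : ℂ) - (y : ℂ)))) *
          (Complex.I / 4 * (q y * conj (q y)) * (φ y).1 + l * q y * (φ y).2),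
        1 - ∫ y in Set.Ioi x,
          (-(l * conj (q y)) * (φ y).1 - Complex.I / 4 * (q y * conj (q y)) * (φ y).2))

open Classical in
/-- The Jost function `φ₋(x; l)` of the potential `q`. -/
noncomputable def jostMinus (q : ℝ → ℂ) (l : ℂ) : ℝ → ℂ × ℂ :=
  if h : ∃ φ, IsJostMinus q l φ then h.choose else 0

open Classical in
/-- The Jost function `ϕ₊(x; l)` of the potential `q`. -/
noncomputable def jostPlus (q : ℝ → ℂ) (l : ℂ) : ℝ → ℂ × ℂ :=
  if h : ∃ φ, IsJostPlus q l φ then h.choose else 0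

/-- The solution `φ₋(x; l) e^{-i l² x}` of the spectral problem. -/
noncomputable def solMinus (q : ℝ → ℂ) (l : ℂ) (x : ℝ) : ℂ × ℂ :=
  Complex.exp (-(Complex.I * l ^ 2 * (x : ℂ))) • jostMinus q l x

/-- The solution `ϕ₊(x; l) e^{i l² x}` of the spectral problem. -/
noncomputable def solPlus (q : ℝ → ℂ) (l : ℂ) (x : ℝ) : ℂ × ℂ :=
  Complex.exp (Complex.I * l ^ 2 * (x : ℂ)) • jostPlus q l x

/-- The scattering coefficient `a(l) = det (φ₋ e^{-i l² x}, ϕ₊ e^{i l² x})`. The determinant of two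
solutions does not depend on `x`, because the system is trace free; it is taken at `x = 0`. -/
noncomputable def scatA (q : ℝ → ℂ) (l : ℂ) : ℂ :=
  (solMinus q l 0).1 * (solPlus q l 0).2 - (solMinus q l 0).2 * (solPlus q l 0).1

/-- `Z_N`: the potentials in `H² ∩ H^{1,1}` for which `a` has exactly `N` zeros in the open first
quadrant, all of them simple. -/
def Z (N : ℕ) : Set (ℝ → ℂ) :=
  {q | MemX q ∧ {l | l ∈ quadrantI ∧ scatA q l = 0}.encard = N ∧
    ∀ l ∈ quadrantI, scatA q l = 0 → deriv (scatA q) l ≠ 0}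

/-! ### The Darboux transformation -/

/-- `m_l(u, v) = l u₁ v̄₁ + l̄ u₂ v̄₂`. -/
noncomputable def m (l : ℂ) (u v : ℂ × ℂ) : ℂ := l * u.1 * conj v.1 + conj l * u.2 * conj v.2

/-- `C_l(u) = m_{l̄}(u, u) / m_l(u, u)`. -/
noncomputable def coeffC (l : ℂ) (u : ℂ × ℂ) : ℂ := m (conj l) u u / m l u u

/-- `D_l(u) = (l² - l̄²) u₁ ū₂ / m_l(u, u)`. -/
noncomputable def coeffD (l : ℂ) (u : ℂ × ℂ) : ℂ :=
  (l ^ 2 - (conj l) ^ 2) * u.1 * conj u.2 / m l u u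

/-- The Darboux transformation `B(Φ, l) q = C_l(Φ) q - 2i D_l(Φ)`. -/
noncomputable def darboux (Φ : ℝ → ℂ × ℂ) (l : ℂ) (q : ℝ → ℂ) : ℝ → ℂ :=
  fun x => coeffC l (Φ x) * q x - 2 * Complex.I * coeffD l (Φ x)

/-- The vector `Φ̃ = φ₋ e^{-i l² x} + α ϕ₊ e^{i l² x}` built from the Jost functions of `q`. -/
noncomputable def jostCombination (q : ℝ → ℂ) (l α : ℂ) : ℝ → ℂ × ℂ :=
  fun x => solMinus q l x + α • solPlus q l x

/-- The vector `Φ̃ = (ḡ, -f̄) / |m_l(Φ, Φ)|`, for `Φ = (f, g)`, for which `B(Φ̃, l)` is the left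
inverse of `B(Φ, l)`. -/
noncomputable def inverseVector (Φ : ℝ → ℂ × ℂ) (l : ℂ) : ℝ → ℂ × ℂ :=
  fun x => (((‖m l (Φ x) (Φ x)‖ : ℝ) : ℂ)⁻¹) • (conj (Φ x).2, -conj (Φ x).1)

end DNLSII

namespace DNLSII

open Filter Topology Set


/-! ### Primitives of locally integrable functions and integration by parts -/

section Primitives

/-! Write k for the distinguished eigenvalue and q₁ for the transformed potential. A bound depending
only on the norm of q₁ needs one piece of spectral information: |a(k)| for q₁ must stay away from
zero, uniformly over the ball of radius M.

Removal of the zero. The Darboux matrix sends solutions for q to solutions for q₁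
(`IsSol.darbouxMat`), and it sends each Jost solution to a fixed multiple of a Jost solution.
Comparing Wronskians gives k̄(λ² - k²) a₁(λ) = k(λ² - k̄²) a(λ) (`scatA_darboux`). Since k is the
only zero of a in the quadrant and is simple, a₁ has no zero there (`scatA_darboux_ne_zero`).

Quantitative lower bound. The Neumann series bounds a₁ from above on bounded sets of λ in terms of
M. For small λ the off-diagonal coupling is O(λ) and the diagonal term only rotates the phase, so
|a₁| ≥ 1/2 near the origin. A holomorphic function without zeros that is bounded above satisfies a
Harnack inequality, obtained from Borel-Carathéodory applied to its logarithm. A finite chain of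
discs along the segment from 0 to k carries the lower bound from the origin to k, with constants
depending only on k and M (`exists_lower_bound`, `exists_le_norm_scatA`). No compactness argument is
used.

From the lower bound to the estimate. Let Φ = (f, g) be the combination of Jost solutions with
constant c. Its Wronskian with the Jost solution at +∞ is a₁(k), so e^{ik²x}Φ is bounded below, and
for x ≥ 0 it is also bounded above. Its second component solves a damped linear equation forced by
q̄₁, so a weighted energy estimate puts ⟨x⟩ f ḡ/m in L² on the right half line. The reflection x ↦
-x with exchange of components treats the left half line; this is where c ≠ 0 is needed
(`exists_crossRatio_bound`). The ratios |f|²/m, f ḡ/m and f̄ g/m obey a closed polynomial system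
with coefficients in q₁ and q̄₁, in which every term contains f ḡ/m, f̄ g/m, q₁ or q̄₁. Hence their
first two derivatives are dominated by |f ḡ/m| + |q₁| + |q₁'|. As the transform is an affine
function of |f|²/m times q₁ plus a multiple of f ḡ/m, its norm is controlled
(`exists_darboux_bound`).

The inverse vector. In case (ii) the vector solves the problem for q₁ at k. Its Wronskians with both
Jost solutions follow from limits at ±∞, and they show that it is a multiple of the combination with
constant -c (`inverseVector_eq`). The transform ignores scalar factors, so case (i) with -c applies.
-/

theorem intervalIntegrable_of_locallyIntegrable {G : ℝ → ℂ} (hG : LocallyIntegrable G volume)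
    (a b : ℝ) : IntervalIntegrable G volume a b :=
  ⟨(hG.integrableOn_isCompact isCompact_Icc).mono_set Ioc_subset_Icc_self,
    (hG.integrableOn_isCompact isCompact_Icc).mono_set Ioc_subset_Icc_self⟩

/-- The primitive of a locally integrable complex function is absolutely continuous. -/
theorem absolutelyContinuous_primitive {G : ℝ → ℂ} (hG : LocallyIntegrable G volume) (a b : ℝ) :
    AbsolutelyContinuousOnInterval (fun x => ∫ t in a..x, G t) a b := by
  have hi := intervalIntegrable_of_locallyIntegrable hG
  have hre : IntervalIntegrable (fun t => (G t).re) volume a b :=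
    ⟨(hi a b).1.re, (hi a b).2.re⟩
  have him : IntervalIntegrable (fun t => (G t).im) volume a b :=
    ⟨(hi a b).1.im, (hi a b).2.im⟩
  have h1 := hre.absolutelyContinuousOnInterval_intervalIntegral (c := a) (by simp)
  have h2 := him.absolutelyContinuousOnInterval_intervalIntegral (c := a) (by simp)
  have c1 : AbsolutelyContinuousOnInterval (fun _ : ℝ => (1 : ℂ)) a b :=
    (contDiff_const.contDiffOn).absolutelyContinuousOnInterval
  have c2 : AbsolutelyContinuousOnInterval (fun _ : ℝ => Complex.I) a b :=
    (contDiff_const.contDiffOn).absolutelyContinuousOnInterval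
  have h := (h1.smul c1).add (h2.smul c2)
  refine (congrArg (fun F => AbsolutelyContinuousOnInterval F a b) (funext fun x => ?_)).mpr h
  have e1 : (∫ t in a..x, (G t).re) = (∫ t in a..x, G t).re := by
    simpa using (Complex.reCLM.intervalIntegral_comp_comm (hi a x))
  have e2 : (∫ t in a..x, (G t).im) = (∫ t in a..x, G t).im := by
    simpa using (Complex.imCLM.intervalIntegral_comp_comm (hi a x))
  simp only [Pi.add_apply, Pi.smul_apply', e1, e2, Complex.real_smul, mul_one]
  exact (Complex.re_add_im _).symm

/-- Product rule in integrated form for a `C¹` function and a primitive. -/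
theorem integral_product_rule {S S' F G : ℝ → ℂ} (hS : ∀ x, HasDerivAt S (S' x) x)
    (hS' : Continuous S') (hG : LocallyIntegrable G volume)
    (hF : ∀ x, F x = F 0 + ∫ t in (0 : ℝ)..x, G t) (a b : ℝ) :
    ∫ x in a..b, (S' x * F x + S x * G x) = S b * F b - S a * F a := by
  have hi := intervalIntegrable_of_locallyIntegrable hG
  have hSc : Continuous S := continuous_iff_continuousAt.2 fun x => (hS x).continuousAt
  have hFa : F = fun x => F a + ∫ t in a..x, G t := by
    funext x
    rw [hF x, hF a, add_assoc, intervalIntegral.integral_add_adjacent_intervals (hi _ _) (hi _ _)]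
  have hFc : Continuous F := by
    rw [hFa]
    exact continuous_const.add (intervalIntegral.continuous_primitive (fun x y => hi x y) a)
  have hloc : LocallyIntegrable (fun x => S' x * F x + S x * G x) volume := by
    refine (hS'.mul hFc).locallyIntegrable.add ?_
    have := hG.smul_continuous (g := S) hSc
    simpa only [smul_eq_mul] using hG.continuous_smul hSc
  have hSac : AbsolutelyContinuousOnInterval S a b := by
    refine ContDiffOn.absolutelyContinuousOnInterval (ContDiff.contDiffOn ?_)
    rw [contDiff_one_iff_deriv]
    refine ⟨fun x => (hS x).differentiableAt, ?_⟩
    have : deriv S = S' := funext fun x => (hS x).deriv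
    rwa [this]
  have hFac : AbsolutelyContinuousOnInterval F a b := by
    rw [hFa]
    exact AbsolutelyContinuousOnInterval.add
      ((contDiff_const.contDiffOn).absolutelyContinuousOnInterval)
      (absolutelyContinuous_primitive hG a b)
  -- The difference of S F and the primitive of S'F + SG is absolutely continuous with derivative
  -- zero almost everywhere, hence constant; comparing its values at a and b gives the rule.
  have hac := (hSac.smul hFac).sub (absolutelyContinuous_primitive hloc a b)
  have hz : ∀ᵐ x, x ∈ uIcc a b → HasDerivAt (S • F - fun x => ∫ t in a..x,
      (S' t * F t + S t * G t)) 0 x := by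
    filter_upwards [_root_.LocallyIntegrable.ae_hasDerivAt_integral hG,
      _root_.LocallyIntegrable.ae_hasDerivAt_integral hloc] with x h1 h2 _
    have hFx : HasDerivAt F (G x) x := by
      rw [hFa]; simpa using (h1 a).const_add (F a)
    have := ((hS x).mul hFx).sub (h2 a)
    simpa using this
  obtain ⟨C, hC⟩ := hac.const_of_ae_hasDerivAt_zero hz
  have ha := hC a (by simp)
  have hb := hC b (by simp)
  simp only [Pi.sub_apply, Pi.mul_apply, smul_eq_mul, intervalIntegral.integral_same,
    sub_zero] at ha hb
  rw [ha, ← hb]; ring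

theorem continuous_of_primitive {F G : ℝ → ℂ} (hG : LocallyIntegrable G volume)
    (hF : ∀ x, F x = F 0 + ∫ t in (0 : ℝ)..x, G t) : Continuous F := by
  have : F = fun x => F 0 + ∫ t in (0 : ℝ)..x, G t := funext hF
  rw [this]
  exact continuous_const.add (intervalIntegral.continuous_primitive
    (fun x y => intervalIntegrable_of_locallyIntegrable hG x y) 0)

/-- Primitives have the integrand as weak derivative. -/
theorem isWeakDeriv_of_primitive {F G : ℝ → ℂ} (hG : LocallyIntegrable G volume)
    (hF : ∀ x, F x = F 0 + ∫ t in (0 : ℝ)..x, G t) : IsWeakDeriv F G := by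
  have hFc := continuous_of_primitive hG hF
  refine ⟨hFc.locallyIntegrable, hG, fun φ hφ hc => ?_⟩
  have hφ1 : ContDiff ℝ 1 φ := hφ.of_le (by exact_mod_cast le_top)
  have hd : ∀ x, HasDerivAt (fun x => (φ x : ℂ)) ((deriv φ x : ℝ) : ℂ) x := fun x =>
    ((hφ1.differentiable (by simp)) x).hasDerivAt.ofReal_comp
  have hdc : Continuous (fun x => ((deriv φ x : ℝ) : ℂ)) :=
    Complex.continuous_ofReal.comp (hφ1.continuous_deriv (by simp))
  obtain ⟨R, hR⟩ := hc.isBounded.subset_closedBall (0 : ℝ)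
  -- The margin 1 beyond |R| keeps both endpoints off the support, so that the boundary terms
  -- vanish.
  have hR' : tsupport φ ⊆ Ioc (-(|R| + 1)) (|R| + 1) := by
    intro x hx
    have := hR hx
    rw [Metric.mem_closedBall, dist_zero_right, Real.norm_eq_abs] at this
    have h2 := abs_le.1 (this.trans (le_abs_self R))
    exact ⟨by linarith [h2.1], by linarith [h2.2]⟩
  have key := integral_product_rule hd hdc hG hF (-(|R| + 1)) (|R| + 1)
  have z : ∀ x, x ∉ tsupport φ → φ x = 0 := fun x hx => image_eq_zero_of_notMem_tsupport hx
  rw [z (|R| + 1), z (-(|R| + 1))] at key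
  rotate_left
  · intro h; have := (hR' h).1; linarith
  · intro h
    have h0 := hR h
    rw [Metric.mem_closedBall, dist_zero_right, Real.norm_eq_abs, abs_of_nonneg (by positivity)]
      at h0
    linarith [le_abs_self R]
  have i1 : IntervalIntegrable (fun x => ((deriv φ x : ℝ) : ℂ) * F x) volume (-(|R| + 1)) (|R| + 1) :=
    (hdc.mul hFc).intervalIntegrable _ _
  have hφc : Continuous (fun x => (φ x : ℂ)) := Complex.continuous_ofReal.comp hφ1.continuous
  have i2 : IntervalIntegrable (fun x => (φ x : ℂ) * G x) volume (-(|R| + 1)) (|R| + 1) :=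
    intervalIntegrable_of_locallyIntegrable
      (by simpa only [smul_eq_mul] using hG.continuous_smul hφc) _ _
  rw [intervalIntegral.integral_add i1 i2] at key
  have e1 : ∫ x, deriv φ x • F x = ∫ x in (-(|R| + 1))..(|R| + 1), ((deriv φ x : ℝ) : ℂ) * F x := by
    rw [intervalIntegral.integral_eq_integral_of_support_subset]
    · simp [Complex.real_smul]
    · intro x hx
      apply hR'
      by_contra h
      apply hx
      have : deriv φ x = 0 := by
        by_contra h'
        exact h (support_deriv_subset h')
      simp [this]
  have e2 : ∫ x, φ x • G x = ∫ x in (-(|R| + 1))..(|R| + 1), (φ x : ℂ) * G x := by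
    rw [intervalIntegral.integral_eq_integral_of_support_subset]
    · simp [Complex.real_smul]
    · intro x hx
      apply hR'
      by_contra h
      apply hx
      simp [z x h]
  rw [e1, e2]
  rw [Complex.ofReal_zero] at key
  linear_combination key

end Primitives

/-! ### Weak derivatives, their uniqueness, and representation by primitives -/

section WeakDeriv

theorem IsWeakDeriv.congr {f f' g g' : ℝ → ℂ} (h : IsWeakDeriv f g) (hf : f =ᵐ[volume] f')
    (hg : g =ᵐ[volume] g') : IsWeakDeriv f' g' := by
  obtain ⟨h1, h2, h3⟩ := h
  refine ⟨h1.congr hf, h2.congr hg, fun φ a b => ?_⟩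
  have e1 : ∫ x, deriv φ x • f' x = ∫ x, deriv φ x • f x :=
    integral_congr_ae (by filter_upwards [hf] with x hx; rw [hx])
  have e2 : ∫ x, φ x • g' x = ∫ x, φ x • g x :=
    integral_congr_ae (by filter_upwards [hg] with x hx; rw [hx])
  rw [e1, e2, h3 φ a b]

theorem IsWeakDeriv.unique {f g g' : ℝ → ℂ} (h : IsWeakDeriv f g) (h' : IsWeakDeriv f g') :
    g =ᵐ[volume] g' := by
  refine ae_eq_of_integral_contDiff_smul_eq h.2.1 h'.2.1 fun φ a b => ?_
  have := (h.2.2 φ a b).symm.trans (h'.2.2 φ a b)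
  exact neg_injective this

/-- The equality is literal and not merely almost everywhere: the chosen derivative depends only on
the predicate `IsWeakDeriv f`, and this predicate is the same for functions that agree almost
everywhere. -/
theorem weakDeriv_congr {f f' : ℝ → ℂ} (hf : f =ᵐ[volume] f') : weakDeriv f = weakDeriv f' := by
  have : IsWeakDeriv f = IsWeakDeriv f' := by
    funext g
    exact propext ⟨fun h => h.congr hf (ae_eq_refl g), fun h => h.congr hf.symm (ae_eq_refl g)⟩
  unfold weakDeriv HasWeakDeriv
  rw [this]

theorem IsWeakDeriv.weakDeriv_ae {f g : ℝ → ℂ} (h : IsWeakDeriv f g) :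
    weakDeriv f =ᵐ[volume] g := by
  have h1 : HasWeakDeriv f := ⟨g, h⟩
  have : weakDeriv f = h1.choose := by unfold weakDeriv; rw [dif_pos h1]
  rw [this]
  exact h1.choose_spec.unique h

theorem HasWeakDeriv.isWeakDeriv {f : ℝ → ℂ} (h : HasWeakDeriv f) :
    IsWeakDeriv f (weakDeriv f) := by
  have : weakDeriv f = h.choose := by unfold weakDeriv; rw [dif_pos h]
  rw [this]
  exact h.choose_spec

theorem hasWeakDeriv_congr {f f' : ℝ → ℂ} (hf : f =ᵐ[volume] f') (h : HasWeakDeriv f) :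
    HasWeakDeriv f' :=
  ⟨weakDeriv f, h.isWeakDeriv.congr hf (ae_eq_refl _)⟩

theorem exists_normalized_bump : ∃ η : ℝ → ℝ, ContDiff ℝ (⊤ : ℕ∞) η ∧ HasCompactSupport η ∧
    ∫ x, η x = 1 := by
  let b : ContDiffBump (0 : ℝ) := ⟨1, 2, by norm_num, by norm_num⟩
  exact ⟨b.normed volume, b.contDiff_normed, b.hasCompactSupport_normed, b.integral_normed⟩

/-- A compactly supported smooth function with integral zero is the derivative of one. -/
theorem exists_compactSupport_primitive {ψ : ℝ → ℝ} (h1 : ContDiff ℝ (⊤ : ℕ∞) ψ)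
    (h2 : HasCompactSupport ψ) (h3 : ∫ x, ψ x = 0) :
    ∃ Φ : ℝ → ℝ, ContDiff ℝ (⊤ : ℕ∞) Φ ∧ HasCompactSupport Φ ∧ deriv Φ = ψ := by
  obtain ⟨R, hR⟩ := h2.isBounded.subset_closedBall (0 : ℝ)
  have z : ∀ x, R < |x| → ψ x = 0 := by
    intro x hx
    apply image_eq_zero_of_notMem_tsupport
    intro h
    have := hR h
    rw [Metric.mem_closedBall, dist_zero_right, Real.norm_eq_abs] at this
    linarith
  have hc := h1.continuous
  have hi : Integrable ψ := hc.integrable_of_hasCompactSupport h2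
  have hd : ∀ x, HasDerivAt (fun x => ∫ t in (-(|R| + 1))..x, ψ t) (ψ x) x := fun x =>
    intervalIntegral.integral_hasDerivAt_right (hc.intervalIntegrable _ _)
      (hc.stronglyMeasurableAtFilter _ _) hc.continuousAt
  have hde : deriv (fun x => ∫ t in (-(|R| + 1))..x, ψ t) = ψ := funext fun x => (hd x).deriv
  refine ⟨fun x => ∫ t in (-(|R| + 1))..x, ψ t, ?_, ?_, hde⟩
  · rw [contDiff_infty_iff_deriv]
    exact ⟨fun x => (hd x).differentiableAt, by rw [hde]; exact h1⟩
  · refine HasCompactSupport.intro (isCompact_Icc (a := -(|R| + 1)) (b := |R| + 1)) ?_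
    intro x hx
    have hsplit : (x < -(|R| + 1)) ∨ (|R| + 1 < x) := by
      by_contra h; push Not at h; exact hx ⟨h.1, h.2⟩
    rcases hsplit with h | h
    · rw [intervalIntegral.integral_zero_ae]
      refine Eventually.of_forall fun t ht => z t ?_
      rw [uIoc_comm, uIoc_of_le h.le] at ht
      have := neg_abs_le t
      have := le_abs_self R
      have : t ≤ -(|R| + 1) := ht.2
      linarith
    · rw [intervalIntegral.integral_eq_integral_of_support_subset, h3]
      intro t ht
      have ht' : |t| ≤ R := by
        by_contra h'; push Not at h'; exact ht (z t h')
      have := abs_le.1 ht'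
      have := le_abs_self R
      constructor <;> linarith

/-- A function with zero weak derivative is almost everywhere constant. -/
theorem ae_const_of_isWeakDeriv_zero {f : ℝ → ℂ} (h : IsWeakDeriv f (fun _ => 0)) :
    ∃ C : ℂ, f =ᵐ[volume] fun _ => C := by
  obtain ⟨η, e1, e2, e3⟩ := exists_normalized_bump
  refine ⟨∫ x, η x • f x, ?_⟩
  refine ae_eq_of_integral_contDiff_smul_eq h.1 (continuous_const.locallyIntegrable)
    fun φ a b => ?_
  have hφi : Integrable φ := a.continuous.integrable_of_hasCompactSupport b
  have hηi : Integrable η := e1.continuous.integrable_of_hasCompactSupport e2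
  set c := ∫ x, φ x with hc
  have a' : ContDiff ℝ (⊤ : ℕ∞) φ := a
  -- Subtracting the multiple c of the bump makes the mean zero, so the difference is the derivative
  -- of a test function and f annihilates it. The constant is therefore the average of f against the
  -- bump.
  obtain ⟨Φ, p1, p2, p3⟩ := exists_compactSupport_primitive (ψ := fun x => φ x - c * η x)
    (a'.sub (contDiff_const.mul e1)) (b.sub e2.mul_left)
    (by rw [integral_sub hφi (hηi.const_mul c), integral_const_mul, e3]; simp [hc])
  have := h.2.2 Φ p1 p2
  rw [p3] at this
  have i1 : Integrable (fun x => φ x • f x) :=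
    h.1.integrable_smul_left_of_hasCompactSupport a.continuous b
  have i2 : Integrable (fun x => η x • f x) :=
    h.1.integrable_smul_left_of_hasCompactSupport e1.continuous e2
  simp only [sub_smul, mul_smul, smul_zero, integral_zero, neg_zero] at this
  have i3 : Integrable (fun x => c • η x • f x) := i2.smul c
  rw [integral_sub i1 i3, integral_smul] at this
  rw [sub_eq_zero.1 this, integral_smul_const]

/-- A weakly differentiable function is a.e. equal to a primitive of its weak derivative. -/
theorem IsWeakDeriv.exists_primitive {f g : ℝ → ℂ} (h : IsWeakDeriv f g) :
    ∃ F : ℝ → ℂ, f =ᵐ[volume] F ∧ ∀ x, F x = F 0 + ∫ t in (0 : ℝ)..x, g t := by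
  set F0 : ℝ → ℂ := fun x => ∫ t in (0 : ℝ)..x, g t with hF0
  have w0 : IsWeakDeriv F0 g := isWeakDeriv_of_primitive h.2.1 (fun x => by simp [hF0])
  have hz : IsWeakDeriv (f - F0) (fun _ => 0) := by
    refine ⟨h.1.sub w0.1, continuous_const.locallyIntegrable, fun φ a b => ?_⟩
    have a1 : ContDiff ℝ 1 φ := a.of_le (by exact_mod_cast le_top)
    have ad : Continuous (deriv φ) := a1.continuous_deriv (by simp)
    have bd : HasCompactSupport (deriv φ) := b.deriv
    simp only [Pi.sub_apply, smul_sub, smul_zero, integral_zero, neg_zero]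
    rw [integral_sub (h.1.integrable_smul_left_of_hasCompactSupport ad bd)
      (w0.1.integrable_smul_left_of_hasCompactSupport ad bd), h.2.2 φ a b, w0.2.2 φ a b, sub_self]
  obtain ⟨C, hC⟩ := ae_const_of_isWeakDeriv_zero hz
  refine ⟨fun x => C + F0 x, ?_, fun x => by simp [hF0]⟩
  filter_upwards [hC] with x hx
  simp only [Pi.sub_apply] at hx
  rw [← hx]; ring

end WeakDeriv


/-! ### Differentiable representatives of functions in `X` -/

/-- `u` is continuously differentiable with derivative `v`, which is a primitive of `w`, and the
squares of the norms of `⟨x⟩ u`, `⟨x⟩ v`, `w` in `L²` are at most `M²`. -/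
structure XRep (u v w : ℝ → ℂ) (M : ℝ) : Prop where
  hu : ∀ x, HasDerivAt u (v x) x
  hw : LocallyIntegrable w volume
  hv : ∀ x, v x = v 0 + ∫ t in (0 : ℝ)..x, w t
  iu : Integrable fun x => (1 + x ^ 2) * ‖u x‖ ^ 2
  bu : ∫ x, (1 + x ^ 2) * ‖u x‖ ^ 2 ≤ M ^ 2
  iv : Integrable fun x => (1 + x ^ 2) * ‖v x‖ ^ 2
  bv : ∫ x, (1 + x ^ 2) * ‖v x‖ ^ 2 ≤ M ^ 2
  iw : Integrable fun x => ‖w x‖ ^ 2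
  bw : ∫ x, ‖w x‖ ^ 2 ≤ M ^ 2

theorem normL2_sq {f : ℝ → ℂ} (hf : MemLp f 2 volume) : normL2 f ^ 2 = ∫ x, ‖f x‖ ^ 2 := by
  unfold normL2
  rw [hf.eLpNorm_eq_integral_rpow_norm (by norm_num) (by norm_num)]
  have h0 : 0 ≤ ∫ x, ‖f x‖ ^ (2 : ℝ) := integral_nonneg fun x => by positivity
  rw [ENNReal.toReal_ofReal (by positivity)]
  simp only [ENNReal.toReal_ofNat]
  rw [← Real.rpow_natCast, ← Real.rpow_mul h0]
  norm_num

theorem norm_weighted_sq (f : ℝ → ℂ) (x : ℝ) :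
    ‖weighted f x‖ ^ 2 = (1 + x ^ 2) * ‖f x‖ ^ 2 := by
  unfold weighted
  rw [norm_mul, mul_pow, Complex.norm_real, Real.norm_eq_abs, sq_abs,
    Real.sq_sqrt (by positivity)]

theorem normL2_nonneg (f : ℝ → ℂ) : 0 ≤ normL2 f := ENNReal.toReal_nonneg

theorem weighted_congr {f g : ℝ → ℂ} (h : f =ᵐ[volume] g) : weighted f =ᵐ[volume] weighted g := by
  filter_upwards [h] with x hx
  simp only [weighted, hx]

theorem normL2_congr {f g : ℝ → ℂ} (h : f =ᵐ[volume] g) : normL2 f = normL2 g := by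
  unfold normL2; rw [eLpNorm_congr_ae h]

theorem memX_congr {f g : ℝ → ℂ} (h : f =ᵐ[volume] g) (hf : MemX f) : MemX g := by
  obtain ⟨⟨a1, a2, a3, a4, a5⟩, ⟨b1, b2⟩, b3, b4⟩ := hf
  rw [weakDeriv_congr h] at a3 a4 a5 b4
  exact ⟨⟨(memLp_congr_ae h).1 a1, hasWeakDeriv_congr h a2, a3, a4, a5⟩,
    ⟨(memLp_congr_ae h).1 b1, (memLp_congr_ae (weighted_congr h)).1 b2⟩,
    hasWeakDeriv_congr h b3, b4⟩

theorem normX_congr {f g : ℝ → ℂ} (h : f =ᵐ[volume] g) : normX f = normX g := by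
  unfold normX normH2 normH11
  rw [weakDeriv_congr h, normL2_congr h, normL2_congr (weighted_congr h)]

/-- The second weak derivative is integrated twice: its primitive v represents the first derivative,
and the primitive u of v is classically differentiable because v is continuous. -/
theorem MemX.exists_rep {f : ℝ → ℂ} (hf : MemX f) {M : ℝ} (hM : normX f ≤ M) :
    ∃ u v w, f =ᵐ[volume] u ∧ XRep u v w M := by
  obtain ⟨⟨a1, a2, a3, a4, a5⟩, ⟨b1, b2⟩, b3, b4, b5⟩ := hf
  obtain ⟨v, hv1, hv2⟩ := a4.isWeakDeriv.exists_primitive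
  have hvc : Continuous v := continuous_of_primitive a4.isWeakDeriv.2.1 hv2
  have hfv : IsWeakDeriv f v := a2.isWeakDeriv.congr (ae_eq_refl f) hv1
  obtain ⟨u, hu1, hu2⟩ := hfv.exists_primitive
  have n2 : 0 ≤ normH2 f := Real.sqrt_nonneg _
  have n11 : 0 ≤ normH11 f := Real.sqrt_nonneg _
  have hM0 : 0 ≤ M := le_trans (add_nonneg n2 n11) hM
  have h2 : normL2 f ^ 2 + normL2 (weakDeriv f) ^ 2 + normL2 (weakDeriv (weakDeriv f)) ^ 2
      ≤ M ^ 2 := by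
    rw [← Real.sqrt_le_left hM0]
    change normH2 f ≤ M
    unfold normX at hM; linarith
  have h11 : normL2 (weighted f) ^ 2 + normL2 (weighted (weakDeriv f)) ^ 2 ≤ M ^ 2 := by
    rw [← Real.sqrt_le_left hM0]
    change normH11 f ≤ M
    unfold normX at hM; linarith
  have eu : (fun x => ‖weighted f x‖ ^ 2) =ᵐ[volume] fun x => (1 + x ^ 2) * ‖u x‖ ^ 2 := by
    filter_upwards [hu1] with x hx
    rw [norm_weighted_sq, hx]
  have ev : (fun x => ‖weighted (weakDeriv f) x‖ ^ 2) =ᵐ[volume]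
      fun x => (1 + x ^ 2) * ‖v x‖ ^ 2 := by
    filter_upwards [hv1] with x hx
    rw [norm_weighted_sq, hx]
  refine ⟨u, v, weakDeriv (weakDeriv f), hu1, ?_, a4.isWeakDeriv.2.1, hv2, ?_, ?_, ?_, ?_, ?_, ?_⟩
  · intro x
    have : u = fun x => u 0 + ∫ t in (0 : ℝ)..x, v t := funext hu2
    rw [this]
    exact (intervalIntegral.integral_hasDerivAt_right (hvc.intervalIntegrable _ _)
      (hvc.stronglyMeasurableAtFilter _ _) hvc.continuousAt).const_add _
  · exact ((memLp_two_iff_integrable_sq_norm b2.1).1 b2).congr eu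
  · rw [← integral_congr_ae eu, ← normL2_sq b2]
    nlinarith [normL2_nonneg (weighted (weakDeriv f))]
  · exact ((memLp_two_iff_integrable_sq_norm b5.1).1 b5).congr ev
  · rw [← integral_congr_ae ev, ← normL2_sq b5]
    nlinarith [normL2_nonneg (weighted f)]
  · exact (memLp_two_iff_integrable_sq_norm a5.1).1 a5
  · rw [← normL2_sq a5]
    nlinarith [normL2_nonneg f, normL2_nonneg (weakDeriv f)]

namespace XRep

variable {u v w : ℝ → ℂ} {M : ℝ}

theorem continuous_u (h : XRep u v w M) : Continuous u :=
  continuous_iff_continuousAt.2 fun x => (h.hu x).continuousAt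

theorem continuous_v (h : XRep u v w M) : Continuous v := continuous_of_primitive h.hw h.hv

theorem memLp_weighted {f : ℝ → ℂ} (hf : AEStronglyMeasurable f volume)
    (i : Integrable fun x => (1 + x ^ 2) * ‖f x‖ ^ 2) : MemLp (weighted f) 2 volume := by
  have hm : AEStronglyMeasurable (weighted f) volume := by
    refine AEStronglyMeasurable.mul (Continuous.aestronglyMeasurable ?_) hf
    exact Complex.continuous_ofReal.comp (by fun_prop)
  rw [memLp_two_iff_integrable_sq_norm hm]
  simpa only [norm_weighted_sq] using i

theorem integrable_sq {f : ℝ → ℂ} (hf : AEStronglyMeasurable f volume)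
    (i : Integrable fun x => (1 + x ^ 2) * ‖f x‖ ^ 2) : Integrable fun x => ‖f x‖ ^ 2 := by
  refine i.mono' (hf.norm.pow 2) (Eventually.of_forall fun x => ?_)
  rw [Real.norm_of_nonneg (by positivity)]
  nlinarith [sq_nonneg (x * ‖f x‖)]

theorem memX (h : XRep u v w M) : MemX u := by
  have wu : IsWeakDeriv u v := isWeakDeriv_of_primitive h.continuous_v.locallyIntegrable
    fun x => by
      rw [intervalIntegral.integral_eq_sub_of_hasDerivAt (fun y _ => h.hu y)
        (h.continuous_v.intervalIntegrable _ _)]; ring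
  have wv : IsWeakDeriv v w := isWeakDeriv_of_primitive h.hw h.hv
  have e1 := wu.weakDeriv_ae
  have wv' : IsWeakDeriv (weakDeriv u) w := wv.congr e1.symm (ae_eq_refl w)
  have e2 := wv'.weakDeriv_ae
  have mu := h.continuous_u.aestronglyMeasurable (μ := volume)
  have mv := h.continuous_v.aestronglyMeasurable (μ := volume)
  have l1 : MemLp u 2 volume := (memLp_two_iff_integrable_sq_norm mu).2 (integrable_sq mu h.iu)
  have l2 : MemLp v 2 volume := (memLp_two_iff_integrable_sq_norm mv).2 (integrable_sq mv h.iv)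
  have l3 : MemLp w 2 volume :=
    (memLp_two_iff_integrable_sq_norm h.hw.aestronglyMeasurable).2 h.iw
  exact ⟨⟨l1, ⟨v, wu⟩, (memLp_congr_ae e1).2 l2, ⟨w, wv'⟩, (memLp_congr_ae e2).2 l3⟩,
    ⟨l1, memLp_weighted mu h.iu⟩, ⟨v, wu⟩, (memLp_congr_ae e1).2 l2,
    (memLp_congr_ae (weighted_congr e1)).2 (memLp_weighted mv h.iv)⟩

/-- Each of the two norms is the square root of at most three squares bounded by M², hence at most
2M; this gives the factor 4. -/
theorem normX_le (h : XRep u v w M) (hM : 0 ≤ M) : normX u ≤ 4 * M := by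
  have wu : IsWeakDeriv u v := isWeakDeriv_of_primitive h.continuous_v.locallyIntegrable
    fun x => by
      rw [intervalIntegral.integral_eq_sub_of_hasDerivAt (fun y _ => h.hu y)
        (h.continuous_v.intervalIntegrable _ _)]; ring
  have wv : IsWeakDeriv v w := isWeakDeriv_of_primitive h.hw h.hv
  have e1 := wu.weakDeriv_ae
  have wv' : IsWeakDeriv (weakDeriv u) w := wv.congr e1.symm (ae_eq_refl w)
  have e2 := wv'.weakDeriv_ae
  have mu := h.continuous_u.aestronglyMeasurable (μ := volume)
  have mv := h.continuous_v.aestronglyMeasurable (μ := volume)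
  have l1 : MemLp u 2 volume := (memLp_two_iff_integrable_sq_norm mu).2 (integrable_sq mu h.iu)
  have l2 : MemLp v 2 volume := (memLp_two_iff_integrable_sq_norm mv).2 (integrable_sq mv h.iv)
  have l3 : MemLp w 2 volume :=
    (memLp_two_iff_integrable_sq_norm h.hw.aestronglyMeasurable).2 h.iw
  have key : ∀ f : ℝ → ℂ, AEStronglyMeasurable f volume →
      Integrable (fun x => (1 + x ^ 2) * ‖f x‖ ^ 2) →
      ∫ x, ‖f x‖ ^ 2 ≤ ∫ x, (1 + x ^ 2) * ‖f x‖ ^ 2 := fun f hf i =>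
    integral_mono (integrable_sq hf i) i fun x => by
      simp only
      nlinarith [sq_nonneg (x * ‖f x‖)]
  have b1 : normL2 u ^ 2 ≤ M ^ 2 := by
    rw [normL2_sq l1]; exact (key u mu h.iu).trans h.bu
  have b2 : normL2 v ^ 2 ≤ M ^ 2 := by
    rw [normL2_sq l2]; exact (key v mv h.iv).trans h.bv
  have b3 : normL2 w ^ 2 ≤ M ^ 2 := by rw [normL2_sq l3]; exact h.bw
  have b4 : normL2 (weighted u) ^ 2 ≤ M ^ 2 := by
    rw [normL2_sq (memLp_weighted mu h.iu)]; simpa only [norm_weighted_sq] using h.bu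
  have b5 : normL2 (weighted v) ^ 2 ≤ M ^ 2 := by
    rw [normL2_sq (memLp_weighted mv h.iv)]; simpa only [norm_weighted_sq] using h.bv
  have t1 : normH2 u ≤ 2 * M := by
    unfold normH2
    rw [normL2_congr e1, normL2_congr e2]
    exact Real.sqrt_le_iff.2 ⟨by positivity, by nlinarith⟩
  have t2 : normH11 u ≤ 2 * M := by
    unfold normH11
    rw [normL2_congr (weighted_congr e1)]
    exact Real.sqrt_le_iff.2 ⟨by positivity, by nlinarith⟩
  unfold normX; linarith

/-- Functions with square integrable `⟨x⟩ f` are integrable. -/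
theorem integrable_norm {f : ℝ → ℂ} (hf : AEStronglyMeasurable f volume)
    (i : Integrable fun x => (1 + x ^ 2) * ‖f x‖ ^ 2) : Integrable fun x => ‖f x‖ := by
  refine (integrable_inv_one_add_sq.add i).mono' hf.norm (Eventually.of_forall fun x => ?_)
  rw [Real.norm_of_nonneg (by positivity)]
  have h : 0 < 1 + x ^ 2 := by positivity
  simp only [Pi.add_apply]
  have h1 : (1 + x ^ 2) * (1 + x ^ 2)⁻¹ = 1 := mul_inv_cancel₀ h.ne'
  have h2 : 0 ≤ (1 + x ^ 2)⁻¹ := by positivity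
  -- The completed square behind 2|f| ≤ (1 + x²)⁻¹ + (1 + x²)|f|².
  have h3 : (1 + x ^ 2)⁻¹ + (1 + x ^ 2) * ‖f x‖ ^ 2 - 2 * ‖f x‖
      = (1 + x ^ 2)⁻¹ * (1 - (1 + x ^ 2) * ‖f x‖) ^ 2 := by
    field_simp; ring
  have h4 : 0 ≤ (1 + x ^ 2)⁻¹ * (1 - (1 + x ^ 2) * ‖f x‖) ^ 2 := by positivity
  nlinarith [norm_nonneg (f x)]

theorem integral_norm_le {f : ℝ → ℂ} (hf : AEStronglyMeasurable f volume)
    (i : Integrable fun x => (1 + x ^ 2) * ‖f x‖ ^ 2) :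
    ∫ x, ‖f x‖ ≤ Real.pi + ∫ x, (1 + x ^ 2) * ‖f x‖ ^ 2 := by
  rw [← integral_univ_inv_one_add_sq, ← integral_add integrable_inv_one_add_sq i]
  refine integral_mono (integrable_norm hf i) (integrable_inv_one_add_sq.add i) fun x => ?_
  have h : 0 < 1 + x ^ 2 := by positivity
  have h3 : (1 + x ^ 2)⁻¹ + (1 + x ^ 2) * ‖f x‖ ^ 2 - 2 * ‖f x‖
      = (1 + x ^ 2)⁻¹ * (1 - (1 + x ^ 2) * ‖f x‖) ^ 2 := by
    field_simp; ring
  have h4 : 0 ≤ (1 + x ^ 2)⁻¹ * (1 - (1 + x ^ 2) * ‖f x‖) ^ 2 := by positivity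
  simp only
  nlinarith [norm_nonneg (f x)]

/-- A bound for the `L¹`, `L²` and uniform norms of `u`. -/
theorem norm_le (h : XRep u v w M) (x : ℝ) : ‖u x‖ ≤ 2 * (Real.pi + M ^ 2) := by
  have mu := h.continuous_u.aestronglyMeasurable (μ := volume)
  have mv := h.continuous_v.aestronglyMeasurable (μ := volume)
  have iu := integrable_norm mu h.iu
  have iv := integrable_norm mv h.iv
  have b1 := (integral_norm_le mu h.iu).trans (add_le_add_right h.bu _)
  have b2 := (integral_norm_le mv h.iv).trans (add_le_add_right h.bv _)
  -- The value at x is compared with the values on [x, x + 1] through the L¹ norm of v and then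
  -- averaged over this unit interval.
  have pt : ∀ y ∈ Icc x (x + 1), ‖u x‖ ≤ ‖u y‖ + (Real.pi + M ^ 2) := by
    intro y hy
    have e : u y - u x = ∫ t in x..y, v t :=
      (intervalIntegral.integral_eq_sub_of_hasDerivAt (fun y _ => h.hu y)
        (h.continuous_v.intervalIntegrable _ _)).symm
    have e2 : ‖∫ t in x..y, v t‖ ≤ Real.pi + M ^ 2 := by
      refine (intervalIntegral.norm_integral_le_integral_norm hy.1).trans (le_trans ?_ b2)
      rw [intervalIntegral.integral_of_le hy.1]
      exact setIntegral_le_integral iv (Eventually.of_forall fun t => norm_nonneg _)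
    have : u x = u y - ∫ t in x..y, v t := by rw [← e]; ring
    rw [this]
    exact (norm_sub_le _ _).trans (by linarith)
  have hi : ∫ y in x..(x + 1), ‖u x‖ ≤ ∫ y in x..(x + 1), (‖u y‖ + (Real.pi + M ^ 2)) :=
    intervalIntegral.integral_mono_on (by linarith) intervalIntegrable_const
      ((h.continuous_u.norm.add continuous_const).intervalIntegrable _ _) pt
  rw [intervalIntegral.integral_add (h.continuous_u.norm.intervalIntegrable _ _)
    intervalIntegrable_const] at hi
  simp only [intervalIntegral.integral_const, add_sub_cancel_left, one_smul] at hi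
  have : ∫ y in x..(x + 1), ‖u y‖ ≤ Real.pi + M ^ 2 := by
    refine le_trans ?_ b1
    rw [intervalIntegral.integral_of_le (by linarith)]
    exact setIntegral_le_integral iu (Eventually.of_forall fun t => norm_nonneg _)
  linarith

end XRep


/-! ### Volterra equations on half lines -/

theorem hasDerivAt_integral_Iic {E : Type*} [NormedAddCommGroup E] [NormedSpace ℝ E]
    [CompleteSpace E] {g : ℝ → E} (hg : Continuous g) (hi : ∀ x, IntegrableOn g (Iic x))
    (x : ℝ) : HasDerivAt (fun x => ∫ y in Iic x, g y) (g x) x := by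
  have : (fun x => ∫ y in Iic x, g y) = fun x => (∫ y in Iic 0, g y) + ∫ y in (0 : ℝ)..x, g y := by
    funext x
    rw [← intervalIntegral.integral_Iic_sub_Iic (hi 0) (hi x)]; abel
  rw [this]
  exact (intervalIntegral.integral_hasDerivAt_right (hg.intervalIntegrable _ _)
    (hg.stronglyMeasurableAtFilter _ _) hg.continuousAt).const_add _

theorem tendsto_integral_Iic_atBot {E : Type*} [NormedAddCommGroup E] [NormedSpace ℝ E]
    [CompleteSpace E] {g : ℝ → E} (hi : Integrable g) :
    Tendsto (fun x => ∫ y in Iic x, g y) atBot (𝓝 0) := by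
  have h1 : Tendsto (fun x => ∫ y in x..(0 : ℝ), g y) atBot (𝓝 (∫ y in Iic 0, g y)) :=
    intervalIntegral_tendsto_integral_Iic 0 hi.integrableOn tendsto_id
  have h2 := (tendsto_const_nhds (x := ∫ y in Iic 0, g y)).sub h1
  rw [sub_self] at h2
  refine h2.congr fun x => ?_
  rw [← intervalIntegral.integral_Iic_sub_Iic hi.integrableOn hi.integrableOn]; abel

/-! ### An exponential weight and Gronwall's inequality -/

section Gronwall

variable {w : ℝ → ℝ}

theorem integral_Iic_le (hi : Integrable w) (h0 : ∀ x, 0 ≤ w x) (x : ℝ) :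
    ∫ y in Iic x, w y ≤ ∫ y, w y :=
  setIntegral_le_integral hi (Eventually.of_forall h0)

theorem integral_Iic_nonneg (h0 : ∀ x, 0 ≤ w x) (x : ℝ) : 0 ≤ ∫ y in Iic x, w y :=
  integral_nonneg h0

theorem hasDerivAt_exp_integral (hc : Continuous w) (hi : Integrable w) (x : ℝ) :
    HasDerivAt (fun x => Real.exp (2 * ∫ y in Iic x, w y) / 2)
      (w x * Real.exp (2 * ∫ y in Iic x, w y)) x := by
  have := (((hasDerivAt_integral_Iic hc (fun x => hi.integrableOn) x).const_mul 2).exp).div_const 2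
  refine this.congr_deriv ?_
  ring

theorem integrable_mul_exp_integral (hc : Continuous w) (hi : Integrable w) (h0 : ∀ x, 0 ≤ w x) :
    Integrable fun x => w x * Real.exp (2 * ∫ y in Iic x, w y) := by
  have hc' : Continuous fun x => ∫ y in Iic x, w y := continuous_iff_continuousAt.2 fun x =>
    (hasDerivAt_integral_Iic hc (fun x => hi.integrableOn) x).continuousAt
  refine (hi.mul_const (Real.exp (2 * ∫ y, w y))).mono' (by fun_prop)
    (Eventually.of_forall fun x => ?_)
  have := h0 x
  rw [Real.norm_of_nonneg (by positivity)]
  exact mul_le_mul_of_nonneg_left (Real.exp_le_exp.2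
    (mul_le_mul_of_nonneg_left (integral_Iic_le hi h0 x) (by norm_num))) this

/-- With W the primitive of w vanishing at -∞, e^{2W}/2 is a primitive of w e^{2W}. The factor 2 in
the exponent thus gains 1/2, so an operator bounded by integration against w contracts by 1/2 in the
norm sup |f| e^{-2W}. Both Gronwall's inequality and the Neumann series rest on this gain. -/
theorem integral_mul_exp_integral_le (hc : Continuous w) (hi : Integrable w) (h0 : ∀ x, 0 ≤ w x)
    (x : ℝ) : ∫ y in Iic x, w y * Real.exp (2 * ∫ z in Iic y, w z)
      ≤ Real.exp (2 * ∫ y in Iic x, w y) / 2 := by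
  have h2 : Tendsto (fun x => Real.exp (2 * ∫ y in Iic x, w y) / 2) atBot (𝓝 (1 / 2)) := by
    have := (((tendsto_integral_Iic_atBot hi).const_mul 2).rexp).div_const 2
    simpa using this
  rw [integral_Iic_of_hasDerivAt_of_tendsto' (fun y _ => hasDerivAt_exp_integral hc hi y)
    (integrable_mul_exp_integral hc hi h0).integrableOn h2]
  linarith

/-- Gronwall's inequality on `(-∞, x]`. -/
theorem gronwall_Iic (hc : Continuous w) (hi : Integrable w) (h0 : ∀ x, 0 ≤ w x)
    {δ : ℝ → ℝ} (hδ : Continuous δ) {A B : ℝ} (hA : 0 ≤ A) (hδ0 : ∀ x, 0 ≤ δ x)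
    (hB : ∀ x, δ x ≤ B) (h : ∀ x, δ x ≤ A + ∫ y in Iic x, w y * δ y) (x : ℝ) :
    δ x ≤ 2 * A * Real.exp (2 * ∫ y in Iic x, w y) := by
  have hB0 : 0 ≤ B := (hδ0 0).trans (hB 0)
  have e1 : ∀ x, 1 ≤ Real.exp (2 * ∫ y in Iic x, w y) := fun x =>
    Real.one_le_exp (mul_nonneg (by norm_num) (integral_Iic_nonneg h0 x))
  have hint : Integrable fun y => w y * δ y := by
    refine (hi.mul_const B).mono' (by fun_prop) (Eventually.of_forall fun x => ?_)
    rw [Real.norm_of_nonneg (mul_nonneg (h0 x) (hδ0 x))]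
    exact mul_le_mul_of_nonneg_left (hB x) (h0 x)
  -- The inequality is iterated from the a priori bound B. Each round sends 2A + B/2ⁿ to A + (2A +
  -- B/2ⁿ)/2 = 2A + B/2ⁿ⁺¹, where the isolated A is absorbed because the exponential is at least 1.
  have step : ∀ n : ℕ, ∀ x, δ x ≤ (2 * A + B / 2 ^ n) * Real.exp (2 * ∫ y in Iic x, w y) := by
    intro n
    induction n with
    | zero =>
      intro x
      simp only [pow_zero, div_one]
      nlinarith [e1 x, hB x]
    | succ n ih =>
      intro x
      have hk : 0 ≤ 2 * A + B / 2 ^ n := by positivity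
      have : ∫ y in Iic x, w y * δ y ≤ (2 * A + B / 2 ^ n) *
          (Real.exp (2 * ∫ y in Iic x, w y) / 2) := by
        refine le_trans ?_ (mul_le_mul_of_nonneg_left (integral_mul_exp_integral_le hc hi h0 x) hk)
        rw [← integral_const_mul]
        refine setIntegral_mono hint.integrableOn
          ((integrable_mul_exp_integral hc hi h0).const_mul _).integrableOn fun y => ?_
        have := mul_le_mul_of_nonneg_left (ih y) (h0 y)
        simp only
        linarith
      have h3 := h x
      have h4 : B / 2 ^ (n + 1) = (B / 2 ^ n) / 2 := by rw [pow_succ]; field_simp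
      rw [h4]
      nlinarith [e1 x]
  have lim : Tendsto (fun n : ℕ => (2 * A + B / 2 ^ n) * Real.exp (2 * ∫ y in Iic x, w y)) atTop
      (𝓝 ((2 * A + 0) * Real.exp (2 * ∫ y in Iic x, w y))) := by
    refine Tendsto.mul_const _ (Tendsto.const_add _ ?_)
    exact tendsto_const_nhds.div_atTop (tendsto_pow_atTop_atTop_of_one_lt (by norm_num))
  rw [add_zero] at lim
  exact ge_of_tendsto' lim fun n => step n x

end Gronwall

/-- Bounded continuous potentials in `L¹ ∩ L²`. -/
structure Pot (q : ℝ → ℂ) : Prop where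
  cont : Continuous q
  bdd : ∃ B, ∀ x, ‖q x‖ ≤ B
  i1 : Integrable fun x => ‖q x‖
  i2 : Integrable fun x => ‖q x‖ ^ 2

/-- The weight controlling the coefficients of the spectral problem. -/
noncomputable def wt (q : ℝ → ℂ) (l : ℂ) (x : ℝ) : ℝ := ‖q x‖ ^ 2 / 4 + ‖l‖ * ‖q x‖

theorem wt_nonneg (q : ℝ → ℂ) (l : ℂ) (x : ℝ) : 0 ≤ wt q l x := by unfold wt; positivity

theorem Pot.continuous_wt {q : ℝ → ℂ} (h : Pot q) (l : ℂ) : Continuous (wt q l) := by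
  have := h.cont; unfold wt; fun_prop

theorem Pot.integrable_wt {q : ℝ → ℂ} (h : Pot q) (l : ℂ) : Integrable (wt q l) :=
  (h.i2.div_const 4).add (h.i1.const_mul ‖l‖)

/-- The first component of the perturbation in the spectral problem. -/
noncomputable def src1 (q : ℝ → ℂ) (l : ℂ) (y : ℝ) (v : ℂ × ℂ) : ℂ :=
  Complex.I / 4 * (q y * conj (q y)) * v.1 + l * q y * v.2

/-- The second component of the perturbation in the spectral problem. -/
noncomputable def src2 (q : ℝ → ℂ) (l : ℂ) (y : ℝ) (v : ℂ × ℂ) : ℂ :=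
  -(l * conj (q y)) * v.1 - Complex.I / 4 * (q y * conj (q y)) * v.2

theorem norm_src1_le (q : ℝ → ℂ) (l : ℂ) (y : ℝ) (v : ℂ × ℂ) :
    ‖src1 q l y v‖ ≤ wt q l y * ‖v‖ := by
  unfold src1 wt
  have h1 := norm_fst_le v
  have h2 := norm_snd_le v
  refine (norm_add_le _ _).trans ?_
  simp only [norm_mul, norm_div, Complex.norm_I, RCLike.norm_conj, Complex.norm_ofNat]
  have : 1 / 4 * (‖q y‖ * ‖q y‖) * ‖v.1‖ ≤ 1 / 4 * (‖q y‖ * ‖q y‖) * ‖v‖ := by gcongr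
  have : ‖l‖ * ‖q y‖ * ‖v.2‖ ≤ ‖l‖ * ‖q y‖ * ‖v‖ := by gcongr
  linarith

theorem norm_src2_le (q : ℝ → ℂ) (l : ℂ) (y : ℝ) (v : ℂ × ℂ) :
    ‖src2 q l y v‖ ≤ wt q l y * ‖v‖ := by
  unfold src2 wt
  have h1 := norm_fst_le v
  have h2 := norm_snd_le v
  refine (norm_sub_le _ _).trans ?_
  simp only [norm_mul, norm_div, norm_neg, Complex.norm_I, RCLike.norm_conj, Complex.norm_ofNat]
  have : 1 / 4 * (‖q y‖ * ‖q y‖) * ‖v.2‖ ≤ 1 / 4 * (‖q y‖ * ‖q y‖) * ‖v‖ := by gcongr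
  have : ‖l‖ * ‖q y‖ * ‖v.1‖ ≤ ‖l‖ * ‖q y‖ * ‖v‖ := by gcongr
  linarith

theorem norm_kernel (l : ℂ) (x y : ℝ) :
    ‖Complex.exp (2 * Complex.I * l ^ 2 * ((x : ℂ) - (y : ℂ)))‖
      = Real.exp (-(2 * (l ^ 2).im * (x - y))) := by
  rw [Complex.norm_exp]
  congr 1
  rw [← Complex.ofReal_sub, Complex.re_mul_ofReal]
  simp [mul_assoc, Complex.mul_re]

theorem norm_kernel_le {l : ℂ} (hl : 0 ≤ (l ^ 2).im) {x y : ℝ} (h : y ≤ x) :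
    ‖Complex.exp (2 * Complex.I * l ^ 2 * ((x : ℂ) - (y : ℂ)))‖ ≤ 1 := by
  rw [norm_kernel, Real.exp_le_one_iff]
  have := mul_nonneg hl (sub_nonneg.2 h)
  linarith

/-- The Volterra operator whose fixed points (up to `e₁`) are the Jost functions. -/
noncomputable def volt (q : ℝ → ℂ) (l : ℂ) (φ : ℝ → ℂ × ℂ) (x : ℝ) : ℂ × ℂ :=
  (∫ y in Iic x, src1 q l y (φ y),
    ∫ y in Iic x, Complex.exp (2 * Complex.I * l ^ 2 * ((x : ℂ) - (y : ℂ))) * src2 q l y (φ y))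

theorem isJostMinus_iff {q : ℝ → ℂ} {l : ℂ} {φ : ℝ → ℂ × ℂ} :
    IsJostMinus q l φ ↔ Continuous φ ∧ (∃ K : ℝ, ∀ x, ‖φ x‖ ≤ K) ∧
      ∀ x, φ x = (1, 0) + volt q l φ x := by
  unfold IsJostMinus volt src1 src2
  simp only [Prod.mk_add_mk, zero_add]

/-! ### Existence, uniqueness and characterization of the Jost function at -∞ -/

section Volterra

variable {q : ℝ → ℂ} {l : ℂ} {φ ψ : ℝ → ℂ × ℂ} {K : ℝ}

theorem continuous_src1 (hq : Pot q) (l : ℂ) (hφ : Continuous φ) :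
    Continuous fun y => src1 q l y (φ y) := by
  have := hq.cont
  have := Complex.continuous_conj
  unfold src1; fun_prop

theorem continuous_src2 (hq : Pot q) (l : ℂ) (hφ : Continuous φ) :
    Continuous fun y => src2 q l y (φ y) := by
  have := hq.cont
  have := Complex.continuous_conj
  unfold src2; fun_prop

theorem integrable_wt_mul (hq : Pot q) (l : ℂ) (hφ : Continuous φ) (hK : ∀ x, ‖φ x‖ ≤ K) :
    Integrable fun y => wt q l y * ‖φ y‖ := by
  have := hq.continuous_wt l
  refine ((hq.integrable_wt l).mul_const K).mono' (by fun_prop) (Eventually.of_forall fun x => ?_)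
  have := wt_nonneg q l x
  rw [Real.norm_of_nonneg (by positivity)]
  exact mul_le_mul_of_nonneg_left (hK x) this

theorem integrable_src1 (hq : Pot q) (l : ℂ) (hφ : Continuous φ) (hK : ∀ x, ‖φ x‖ ≤ K) :
    Integrable fun y => src1 q l y (φ y) :=
  (integrable_wt_mul hq l hφ hK).mono' (continuous_src1 hq l hφ).aestronglyMeasurable
    (Eventually.of_forall fun y => norm_src1_le q l y (φ y))

theorem integrableOn_kernel (hq : Pot q) (hl : 0 ≤ (l ^ 2).im) (hφ : Continuous φ)
    (hK : ∀ x, ‖φ x‖ ≤ K) (x : ℝ) : IntegrableOn (fun y : ℝ =>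
      Complex.exp (2 * Complex.I * l ^ 2 * ((x : ℂ) - (y : ℂ))) * src2 q l y (φ y)) (Iic x) := by
  have := continuous_src2 hq l hφ
  refine Integrable.mono' (integrable_wt_mul hq l hφ hK).integrableOn
    (Continuous.aestronglyMeasurable (by fun_prop)) ?_
  filter_upwards [ae_restrict_mem measurableSet_Iic] with y hy
  rw [norm_mul]
  refine (mul_le_of_le_one_left (norm_nonneg _) (norm_kernel_le hl hy)).trans (norm_src2_le _ _ _ _)

theorem norm_volt_le (hq : Pot q) (hl : 0 ≤ (l ^ 2).im) (hφ : Continuous φ)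
    (hK : ∀ x, ‖φ x‖ ≤ K) (x : ℝ) : ‖volt q l φ x‖ ≤ ∫ y in Iic x, wt q l y * ‖φ y‖ := by
  have hi := integrable_wt_mul hq l hφ hK
  refine norm_prod_le_iff.2 ⟨?_, ?_⟩
  · exact norm_integral_le_of_norm_le hi.integrableOn
      (Eventually.of_forall fun y => norm_src1_le q l y (φ y))
  · refine norm_integral_le_of_norm_le hi.integrableOn ?_
    filter_upwards [ae_restrict_mem measurableSet_Iic] with y hy
    rw [norm_mul]
    exact (mul_le_of_le_one_left (norm_nonneg _) (norm_kernel_le hl hy)).trans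
      (norm_src2_le _ _ _ _)

theorem volt_sub (hq : Pot q) (hl : 0 ≤ (l ^ 2).im) {K' : ℝ} (hφ : Continuous φ)
    (hK : ∀ x, ‖φ x‖ ≤ K) (hψ : Continuous ψ) (hK' : ∀ x, ‖ψ x‖ ≤ K') (x : ℝ) :
    volt q l (fun y => φ y - ψ y) x = volt q l φ x - volt q l ψ x := by
  refine Prod.ext ?_ ?_
  · refine Eq.trans ?_ (integral_sub (integrable_src1 hq l hφ hK).integrableOn
      (integrable_src1 hq l hψ hK').integrableOn)
    refine integral_congr_ae (Eventually.of_forall fun y => ?_)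
    simp only [src1, Prod.fst_sub, Prod.snd_sub]; ring
  · refine Eq.trans ?_ (integral_sub (integrableOn_kernel hq hl hφ hK x)
      (integrableOn_kernel hq hl hψ hK' x))
    refine integral_congr_ae (Eventually.of_forall fun y => ?_)
    simp only [src2, Prod.fst_sub, Prod.snd_sub]; ring

theorem hasDerivAt_volt_fst (hq : Pot q) (hφ : Continuous φ)
    (hK : ∀ x, ‖φ x‖ ≤ K) (x : ℝ) :
    HasDerivAt (fun x => (volt q l φ x).1) (src1 q l x (φ x)) x :=
  hasDerivAt_integral_Iic (continuous_src1 hq l hφ)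
    (fun _ => (integrable_src1 hq l hφ hK).integrableOn) x

/-- Splitting the exponential moves x out of the integrand, so that the product rule and the
fundamental theorem of calculus give the derivative. -/
theorem volt_snd_eq (x : ℝ) : (volt q l φ x).2 = Complex.exp (2 * Complex.I * l ^ 2 * (x : ℂ)) *
    ∫ y in Iic x, Complex.exp (-(2 * Complex.I * l ^ 2 * (y : ℂ))) * src2 q l y (φ y) := by
  rw [← integral_const_mul]
  refine integral_congr_ae (Eventually.of_forall fun y => ?_)
  simp only
  rw [← mul_assoc, ← Complex.exp_add]; congr 2; ring

theorem hasDerivAt_volt_snd (hq : Pot q) (hl : 0 ≤ (l ^ 2).im) (hφ : Continuous φ)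
    (hK : ∀ x, ‖φ x‖ ≤ K) (x : ℝ) : HasDerivAt (fun x => (volt q l φ x).2)
      (2 * Complex.I * l ^ 2 * (volt q l φ x).2 + src2 q l x (φ x)) x := by
  have hi : ∀ x, IntegrableOn (fun y : ℝ =>
      Complex.exp (-(2 * Complex.I * l ^ 2 * (y : ℂ))) * src2 q l y (φ y)) (Iic x) := by
    intro x
    have := (integrableOn_kernel hq hl hφ hK x).const_mul
      (Complex.exp (-(2 * Complex.I * l ^ 2 * (x : ℂ))))
    refine this.congr (Eventually.of_forall fun y => ?_)
    simp only
    rw [← mul_assoc, ← Complex.exp_add]; congr 2; ring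
  have hc := continuous_src2 hq l hφ
  have h1 := hasDerivAt_integral_Iic (g := fun y : ℝ =>
      Complex.exp (-(2 * Complex.I * l ^ 2 * (y : ℂ))) * src2 q l y (φ y)) (by fun_prop) hi x
  have h2 : HasDerivAt (fun x : ℝ => Complex.exp (2 * Complex.I * l ^ 2 * (x : ℂ)))
      (Complex.exp (2 * Complex.I * l ^ 2 * (x : ℂ)) * (2 * Complex.I * l ^ 2)) x := by
    have := ((hasDerivAt_id (x : ℂ)).const_mul (2 * Complex.I * l ^ 2)).cexp.comp_ofReal
    simpa using this
  have h3 := h2.mul h1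
  have e : (fun x => (volt q l φ x).2) = (fun x : ℝ => Complex.exp (2 * Complex.I * l ^ 2 * (x : ℂ)))
    * fun x : ℝ => ∫ y in Iic x, Complex.exp (-(2 * Complex.I * l ^ 2 * (y : ℂ))) * src2 q l y (φ y) :=
    funext fun x => volt_snd_eq x
  rw [e]
  refine h3.congr_deriv ?_
  have e0 : Complex.exp (2 * Complex.I * l ^ 2 * (x : ℂ)) *
      Complex.exp (-(2 * Complex.I * l ^ 2 * (x : ℂ))) = 1 := by
    rw [← Complex.exp_add, add_neg_cancel, Complex.exp_zero]
  rw [volt_snd_eq]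
  linear_combination src2 q l x (φ x) * e0

theorem continuous_volt (hq : Pot q) (hl : 0 ≤ (l ^ 2).im) (hφ : Continuous φ)
    (hK : ∀ x, ‖φ x‖ ≤ K) : Continuous (volt q l φ) :=
  (continuous_iff_continuousAt.2 fun x =>
    (hasDerivAt_volt_fst (l := l) hq hφ hK x).continuousAt).prodMk
  (continuous_iff_continuousAt.2 fun x => (hasDerivAt_volt_snd hq hl hφ hK x).continuousAt)

/-- The terms of the Neumann series for the Jost function. -/
noncomputable def neumann (q : ℝ → ℂ) (l : ℂ) : ℕ → ℝ → ℂ × ℂ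
  | 0 => fun _ => (1, 0)
  | n + 1 => volt q l (neumann q l n)

/-- A bound for the Jost functions. -/
noncomputable def expBound (q : ℝ → ℂ) (l : ℂ) : ℝ := Real.exp (2 * ∫ y, wt q l y)

theorem one_le_expBound (q : ℝ → ℂ) (l : ℂ) : 1 ≤ expBound q l :=
  Real.one_le_exp (mul_nonneg (by norm_num) (integral_nonneg (wt_nonneg q l)))

theorem exp_integral_le_expBound (hq : Pot q) (l : ℂ) (x : ℝ) :
    Real.exp (2 * ∫ y in Iic x, wt q l y) ≤ expBound q l := by
  unfold expBound
  exact Real.exp_le_exp.2 (mul_le_mul_of_nonneg_left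
    (integral_Iic_le (hq.integrable_wt l) (wt_nonneg q l) x) (by norm_num))

/-- For Im l² ≥ 0 the kernel has modulus at most 1, so each application of the Volterra operator
contracts by 1/2 in the exponentially weighted norm. -/
theorem neumann_spec (hq : Pot q) (hl : 0 ≤ (l ^ 2).im) (n : ℕ) :
    Continuous (neumann q l n) ∧
    ∀ x, ‖neumann q l n x‖ ≤ (1 / 2) ^ n * Real.exp (2 * ∫ y in Iic x, wt q l y) := by
  induction n with
  | zero =>
    refine ⟨continuous_const, fun x => ?_⟩
    have : ‖neumann q l 0 x‖ = 1 := by simp [neumann, Prod.norm_def]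
    rw [this, pow_zero, one_mul]
    exact Real.one_le_exp (mul_nonneg (by norm_num) (integral_Iic_nonneg (wt_nonneg q l) x))
  | succ n ih =>
    have hK : ∀ x, ‖neumann q l n x‖ ≤ (1 / 2) ^ n * expBound q l := fun x =>
      (ih.2 x).trans (mul_le_mul_of_nonneg_left (exp_integral_le_expBound hq l x) (by positivity))
    refine ⟨continuous_volt hq hl ih.1 hK, fun x => ?_⟩
    refine (norm_volt_le hq hl ih.1 hK x).trans ?_
    have h2 := integral_mul_exp_integral_le (hq.continuous_wt l) (hq.integrable_wt l)
      (wt_nonneg q l) x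
    have h3 := integrable_mul_exp_integral (hq.continuous_wt l) (hq.integrable_wt l) (wt_nonneg q l)
    calc ∫ y in Iic x, wt q l y * ‖neumann q l n y‖
        ≤ ∫ y in Iic x, (1 / 2) ^ n * (wt q l y * Real.exp (2 * ∫ z in Iic y, wt q l z)) := by
          refine setIntegral_mono (integrable_wt_mul hq l ih.1 hK).integrableOn
            (h3.const_mul _).integrableOn fun y => ?_
          have := mul_le_mul_of_nonneg_left (ih.2 y) (wt_nonneg q l y)
          simp only
          linarith
      _ = (1 / 2) ^ n * ∫ y in Iic x, wt q l y * Real.exp (2 * ∫ z in Iic y, wt q l z) :=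
          integral_const_mul _ _
      _ ≤ (1 / 2) ^ n * (Real.exp (2 * ∫ y in Iic x, wt q l y) / 2) := by gcongr
      _ = _ := by rw [pow_succ]; ring

theorem norm_neumann_le (hq : Pot q) (hl : 0 ≤ (l ^ 2).im) (n : ℕ) (x : ℝ) :
    ‖neumann q l n x‖ ≤ (1 / 2) ^ n * expBound q l :=
  ((neumann_spec hq hl n).2 x).trans
    (mul_le_mul_of_nonneg_left (exp_integral_le_expBound hq l x) (by positivity))

theorem summable_bound (C : ℝ) : Summable fun n : ℕ => (1 / 2 : ℝ) ^ n * C :=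
  (summable_geometric_of_lt_one (by norm_num) (by norm_num)).mul_right C

theorem isJostMinus_tsum (hq : Pot q) (hl : 0 ≤ (l ^ 2).im) :
    IsJostMinus q l (fun x => ∑' n, neumann q l n x) := by
  set E := expBound q l with hE
  have hsum : ∀ x, Summable fun n => neumann q l n x := fun x =>
    Summable.of_norm_bounded (summable_bound E) fun n => norm_neumann_le hq hl n x
  have hcont : Continuous fun x => ∑' n, neumann q l n x :=
    continuous_tsum (fun n => (neumann_spec hq hl n).1) (summable_bound E)
      fun n x => norm_neumann_le hq hl n x
  have hbd : ∀ x, ‖∑' n, neumann q l n x‖ ≤ 2 * E := by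
    intro x
    have : HasSum (fun n : ℕ => (1 / 2 : ℝ) ^ n * E) (2 * E) := by
      have := (hasSum_geometric_of_lt_one (r := (1 / 2 : ℝ)) (by norm_num) (by norm_num)).mul_right E
      norm_num at this ⊢; exact this
    exact tsum_of_norm_bounded this fun n => norm_neumann_le hq hl n x
  rw [isJostMinus_iff]
  refine ⟨hcont, ⟨_, hbd⟩, fun x => ?_⟩
  -- partial sums
  have pc : ∀ N, Continuous fun x => ∑ n ∈ Finset.range N, neumann q l n x := fun N =>
    continuous_finsetSum _ fun n _ => (neumann_spec hq hl n).1
  have pb : ∀ N, ∀ x, ‖∑ n ∈ Finset.range N, neumann q l n x‖ ≤ 2 * E := by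
    intro N x
    refine (norm_sum_le _ _).trans ?_
    refine (Finset.sum_le_sum fun n _ => norm_neumann_le hq hl n x).trans ?_
    rw [← Finset.sum_mul]
    have h1 : ∑ i ∈ Finset.range N, (1 / 2 : ℝ) ^ i ≤ 2 := by
      have := Summable.sum_le_tsum (Finset.range N) (fun i _ => by positivity)
        (summable_geometric_of_lt_one (r := (1 / 2 : ℝ)) (by norm_num) (by norm_num))
      rw [tsum_geometric_two] at this
      exact this
    exact mul_le_mul_of_nonneg_right h1 (by linarith [one_le_expBound q l])
  -- The partial sums are the Picard iterates of the Volterra equation; the limit N → ∞ is taken in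
  -- this relation.
  have peq : ∀ N, ∑ n ∈ Finset.range (N + 1), neumann q l n x
      = (1, 0) + volt q l (fun y => ∑ n ∈ Finset.range N, neumann q l n y) x := by
    intro N
    induction N with
    | zero => simp [neumann, volt, src1, src2]
    | succ N ih =>
      rw [Finset.sum_range_succ, ih]
      have hd := volt_sub hq hl (pc (N + 1)) (pb (N + 1)) (pc N) (pb N) x
      have : (fun y => ∑ n ∈ Finset.range (N + 1), neumann q l n y
          - ∑ n ∈ Finset.range N, neumann q l n y) = neumann q l N := by
        funext y; rw [Finset.sum_range_succ]; abel
      rw [this] at hd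
      change (1, 0) + _ + volt q l (neumann q l N) x = _
      rw [hd]; abel
  -- The geometric tail is uniform in y, which allows the limit to pass under the Volterra integral.
  have rem : ∀ N, ∀ y, ‖(∑' n, neumann q l n y) - ∑ n ∈ Finset.range N, neumann q l n y‖
      ≤ (1 / 2) ^ N * (2 * E) := by
    intro N y
    rw [← (hsum y).sum_add_tsum_nat_add N, add_sub_cancel_left]
    have : HasSum (fun n : ℕ => (1 / 2 : ℝ) ^ (n + N) * E) ((1 / 2) ^ N * (2 * E)) := by
      have := (hasSum_geometric_of_lt_one (r := (1 / 2 : ℝ)) (by norm_num)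
        (by norm_num)).mul_right ((1 / 2) ^ N * E)
      have e : ((1 : ℝ) - 1 / 2)⁻¹ * ((1 / 2) ^ N * E) = (1 / 2) ^ N * (2 * E) := by ring
      rw [e] at this
      refine this.congr_fun ?_ |> fun h => h
      intro n; simp only [pow_add]; ring
    exact tsum_of_norm_bounded this fun n => norm_neumann_le hq hl (n + N) y
  have l1 : Tendsto (fun N => ∑ n ∈ Finset.range (N + 1), neumann q l n x) atTop
      (𝓝 (∑' n, neumann q l n x)) :=
    (tendsto_add_atTop_iff_nat 1).2 (hsum x).hasSum.tendsto_sum_nat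
  have l2 : Tendsto (fun N => (1, 0) + volt q l (fun y => ∑ n ∈ Finset.range N, neumann q l n y) x)
      atTop (𝓝 ((1, 0) + volt q l (fun y => ∑' n, neumann q l n y) x)) := by
    refine Tendsto.const_add _ ?_
    rw [tendsto_iff_norm_sub_tendsto_zero]
    have hz : Tendsto (fun N : ℕ => (1 / 2 : ℝ) ^ N * ((2 * E) * ∫ y, wt q l y)) atTop (𝓝 0) := by
      have := (tendsto_pow_atTop_nhds_zero_of_lt_one (r := (1 / 2 : ℝ)) (by norm_num)
        (by norm_num)).mul_const ((2 * E) * ∫ y, wt q l y)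
      simpa using this
    refine squeeze_zero (fun N => norm_nonneg _) (fun N => ?_) hz
    rw [norm_sub_rev, ← volt_sub hq hl hcont hbd (pc N) (pb N) x]
    have hbd' := rem N
    have hc' : Continuous fun y => (∑' n, neumann q l n y) - ∑ n ∈ Finset.range N, neumann q l n y :=
      hcont.sub (pc N)
    refine (norm_volt_le hq hl hc' hbd' x).trans ?_
    calc ∫ y in Iic x, wt q l y * ‖(∑' n, neumann q l n y) - ∑ n ∈ Finset.range N, neumann q l n y‖
        ≤ ∫ y in Iic x, wt q l y * ((1 / 2) ^ N * (2 * E)) :=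
          setIntegral_mono (integrable_wt_mul hq l hc' hbd').integrableOn
            ((hq.integrable_wt l).mul_const _).integrableOn
            fun y => mul_le_mul_of_nonneg_left (hbd' y) (wt_nonneg q l y)
      _ = (∫ y in Iic x, wt q l y) * ((1 / 2) ^ N * (2 * E)) := integral_mul_const _ _
      _ ≤ (∫ y, wt q l y) * ((1 / 2) ^ N * (2 * E)) := by
          refine mul_le_mul_of_nonneg_right (integral_Iic_le (hq.integrable_wt l) (wt_nonneg q l) x) ?_
          have := one_le_expBound q l
          positivity
      _ = _ := by ring
  exact tendsto_nhds_unique l1 (by simpa only [peq] using l2)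

/-- The difference of two solutions satisfies the homogeneous Volterra inequality, and Gronwall's
inequality with A = 0 makes it vanish. -/
theorem IsJostMinus.unique (hq : Pot q) (hl : 0 ≤ (l ^ 2).im) (h1 : IsJostMinus q l φ)
    (h2 : IsJostMinus q l ψ) : φ = ψ := by
  rw [isJostMinus_iff] at h1 h2
  obtain ⟨c1, ⟨K1, b1⟩, e1⟩ := h1
  obtain ⟨c2, ⟨K2, b2⟩, e2⟩ := h2
  have hb : ∀ x, ‖φ x - ψ x‖ ≤ K1 + K2 := fun x => (norm_sub_le _ _).trans (add_le_add (b1 x) (b2 x))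
  have := gronwall_Iic (hq.continuous_wt l) (hq.integrable_wt l) (wt_nonneg q l)
    (δ := fun x => ‖φ x - ψ x‖) (c1.sub c2).norm le_rfl (fun x => norm_nonneg _) hb (fun x => by
      have : φ x - ψ x = volt q l (fun y => φ y - ψ y) x := by
        rw [volt_sub hq hl c1 b1 c2 b2, e1 x, e2 x]; simp
      rw [this, zero_add]
      exact norm_volt_le hq hl (c1.sub c2) hb x)
  funext x
  have h0 := this x
  simp only [mul_zero, zero_mul] at h0
  exact sub_eq_zero.1 (norm_le_zero_iff.1 h0)

theorem isJostMinus_jostMinus (hq : Pot q) (hl : 0 ≤ (l ^ 2).im) :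
    IsJostMinus q l (jostMinus q l) := by
  have h : ∃ φ, IsJostMinus q l φ := ⟨_, isJostMinus_tsum hq hl⟩
  unfold jostMinus
  rw [dif_pos h]
  exact h.choose_spec

theorem jostMinus_eq_tsum (hq : Pot q) (hl : 0 ≤ (l ^ 2).im) (x : ℝ) :
    jostMinus q l x = ∑' n, neumann q l n x :=
  congrFun ((isJostMinus_jostMinus hq hl).unique hq hl (isJostMinus_tsum hq hl)) x

theorem IsJostMinus.eq_jostMinus (hq : Pot q) (hl : 0 ≤ (l ^ 2).im) (h : IsJostMinus q l φ) :
    φ = jostMinus q l := h.unique hq hl (isJostMinus_jostMinus hq hl)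

theorem norm_jostMinus_le (hq : Pot q) (hl : 0 ≤ (l ^ 2).im) (x : ℝ) :
    ‖jostMinus q l x‖ ≤ 2 * expBound q l := by
  obtain ⟨c1, ⟨K1, b1⟩, e1⟩ := isJostMinus_iff.1 (isJostMinus_jostMinus hq hl)
  have := gronwall_Iic (hq.continuous_wt l) (hq.integrable_wt l) (wt_nonneg q l)
    (δ := fun x => ‖jostMinus q l x‖) c1.norm zero_le_one (fun x => norm_nonneg _) b1 (fun x => by
      conv_lhs => rw [e1 x]
      refine (norm_add_le _ _).trans (add_le_add ?_ (norm_volt_le hq hl c1 b1 x))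
      simp [Prod.norm_def]) x
  rw [mul_one] at this
  exact this.trans (mul_le_mul_of_nonneg_left (exp_integral_le_expBound hq l x) (by norm_num))

theorem continuous_jostMinus (hq : Pot q) (hl : 0 ≤ (l ^ 2).im) : Continuous (jostMinus q l) :=
  (isJostMinus_jostMinus hq hl).1

theorem hasDerivAt_jostMinus_fst (hq : Pot q) (hl : 0 ≤ (l ^ 2).im) (x : ℝ) :
    HasDerivAt (fun x => (jostMinus q l x).1) (src1 q l x (jostMinus q l x)) x := by
  obtain ⟨c1, ⟨K1, b1⟩, e1⟩ := isJostMinus_iff.1 (isJostMinus_jostMinus hq hl)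
  have h := (hasDerivAt_volt_fst (l := l) hq c1 b1 x).const_add 1
  refine h.congr_of_eventuallyEq (Eventually.of_forall fun y => ?_)
  simp only
  conv_lhs => rw [e1 y]
  rfl

theorem hasDerivAt_jostMinus_snd (hq : Pot q) (hl : 0 ≤ (l ^ 2).im) (x : ℝ) :
    HasDerivAt (fun x => (jostMinus q l x).2)
      (2 * Complex.I * l ^ 2 * (jostMinus q l x).2 + src2 q l x (jostMinus q l x)) x := by
  obtain ⟨c1, ⟨K1, b1⟩, e1⟩ := isJostMinus_iff.1 (isJostMinus_jostMinus hq hl)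
  have h := (hasDerivAt_volt_snd hq hl c1 b1 x)
  have e : ∀ y, (jostMinus q l y).2 = (volt q l (jostMinus q l) y).2 := fun y => by
    conv_lhs => rw [e1 y]
    simp
  rw [e x]
  exact h.congr_of_eventuallyEq (Eventually.of_forall e)

theorem tendsto_jostMinus (hq : Pot q) (hl : 0 ≤ (l ^ 2).im) :
    Tendsto (jostMinus q l) atBot (𝓝 (1, 0)) := by
  obtain ⟨c1, ⟨K1, b1⟩, e1⟩ := isJostMinus_iff.1 (isJostMinus_jostMinus hq hl)
  have h : Tendsto (volt q l (jostMinus q l)) atBot (𝓝 0) :=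
    squeeze_zero_norm (fun x => norm_volt_le hq hl c1 b1 x)
      (tendsto_integral_Iic_atBot (integrable_wt_mul hq l c1 b1))
  have := h.const_add ((1, 0) : ℂ × ℂ)
  rw [add_zero] at this
  exact this.congr fun x => (e1 x).symm

/-- Bounded solutions of the differential equations of the Jost function with the right limit
at `-∞` are the Jost function. -/
theorem eq_jostMinus_of_hasDerivAt (hq : Pot q) (hl : 0 < (l ^ 2).im) (hφ : Continuous φ)
    (hK : ∀ x, ‖φ x‖ ≤ K)
    (h1 : ∀ x, HasDerivAt (fun x => (φ x).1) (src1 q l x (φ x)) x)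
    (h2 : ∀ x, HasDerivAt (fun x => (φ x).2)
      (2 * Complex.I * l ^ 2 * (φ x).2 + src2 q l x (φ x)) x)
    (hlim : Tendsto (fun x => (φ x).1) atBot (𝓝 1)) : φ = jostMinus q l := by
  refine IsJostMinus.eq_jostMinus hq hl.le (isJostMinus_iff.2 ⟨hφ, ⟨K, hK⟩, fun x => ?_⟩)
  have f1 := integral_Iic_of_hasDerivAt_of_tendsto' (a := x) (fun y _ => h1 y)
    (integrable_src1 hq l hφ hK).integrableOn hlim
  have hd : ∀ y : ℝ, HasDerivAt (fun y : ℝ =>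
      Complex.exp (2 * Complex.I * l ^ 2 * ((x : ℂ) - (y : ℂ))) * (φ y).2)
      (Complex.exp (2 * Complex.I * l ^ 2 * ((x : ℂ) - (y : ℂ))) * src2 q l y (φ y)) y := by
    intro y
    have a : HasDerivAt (fun y : ℝ => Complex.exp (2 * Complex.I * l ^ 2 * ((x : ℂ) - (y : ℂ))))
        (Complex.exp (2 * Complex.I * l ^ 2 * ((x : ℂ) - (y : ℂ))) * (-(2 * Complex.I * l ^ 2))) y := by
      have := (((hasDerivAt_id (y : ℂ)).const_sub (x : ℂ)).const_mul
        (2 * Complex.I * l ^ 2)).cexp.comp_ofReal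
      simpa using this
    have := a.mul (h2 y)
    refine this.congr_deriv ?_
    ring
  -- Because Im l² > 0 strictly, the integrating factor decays at -∞ and boundedness alone removes
  -- the boundary term. Hence only the limit of the first component has to be prescribed.
  have hz : Tendsto (fun y : ℝ =>
      Complex.exp (2 * Complex.I * l ^ 2 * ((x : ℂ) - (y : ℂ))) * (φ y).2) atBot (𝓝 0) := by
    have e : Tendsto (fun y : ℝ => Real.exp (-(2 * (l ^ 2).im * (x - y))) * K) atBot (𝓝 0) := by
      have : Tendsto (fun y : ℝ => Real.exp (-(2 * (l ^ 2).im * (x - y)))) atBot (𝓝 0) := by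
        refine Real.tendsto_exp_atBot.comp ?_
        have : Tendsto (fun y : ℝ => 2 * (l ^ 2).im * y + -(2 * (l ^ 2).im * x)) atBot atBot :=
          tendsto_atBot_add_const_right _ _ (tendsto_id.const_mul_atBot (by positivity))
        exact this.congr fun y => by ring
      simpa using this.mul_const K
    refine squeeze_zero_norm (fun y => ?_) e
    rw [norm_mul, norm_kernel]
    exact mul_le_mul_of_nonneg_left ((norm_snd_le _).trans (hK y)) (Real.exp_pos _).le
  have f2 := integral_Iic_of_hasDerivAt_of_tendsto' (a := x) (fun y _ => hd y)
    (integrableOn_kernel hq hl.le hφ hK x) hz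
  unfold volt
  rw [f1, f2]
  simp

end Volterra


/-! ### Solutions of the spectral problem -/

/-- The diagonal coefficient of the spectral problem. -/
noncomputable def diagCoeff (q : ℝ → ℂ) (l : ℂ) (x : ℝ) : ℂ :=
  -(Complex.I * l ^ 2) + Complex.I / 4 * (q x * conj (q x))

/-- `F` solves the spectral problem with potential `q`. -/
def IsSol (q : ℝ → ℂ) (l : ℂ) (F : ℝ → ℂ × ℂ) : Prop :=
  (∀ x, HasDerivAt (fun x => (F x).1) (diagCoeff q l x * (F x).1 + l * q x * (F x).2) x) ∧
    ∀ x, HasDerivAt (fun x => (F x).2)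
      (-(l * conj (q x)) * (F x).1 - diagCoeff q l x * (F x).2) x

/-- The Wronskian of two vector functions. -/
noncomputable def wronskian (F G : ℝ → ℂ × ℂ) (x : ℝ) : ℂ :=
  (F x).1 * (G x).2 - (F x).2 * (G x).1

/-- The reflected potential. -/
noncomputable def reflect (q : ℝ → ℂ) : ℝ → ℂ := fun x => conj (q (-x))

/-- The reflection of vector functions that corresponds to `reflect`. -/
def reflectVec (F : ℝ → ℂ × ℂ) : ℝ → ℂ × ℂ := fun x => (F (-x)).swap

section Sol

variable {q : ℝ → ℂ} {l : ℂ} {F G : ℝ → ℂ × ℂ}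

theorem IsSol.add (hF : IsSol q l F) (hG : IsSol q l G) : IsSol q l (fun x => F x + G x) :=
  ⟨fun x => ((hF.1 x).add (hG.1 x)).congr_deriv (by simp only [Prod.fst_add, Prod.snd_add]; ring),
    fun x => ((hF.2 x).add (hG.2 x)).congr_deriv (by simp only [Prod.fst_add, Prod.snd_add]; ring)⟩

theorem IsSol.smul (hF : IsSol q l F) (c : ℂ) : IsSol q l (fun x => c • F x) :=
  ⟨fun x => ((hF.1 x).const_mul c).congr_deriv
      (by simp only [Prod.smul_fst, Prod.smul_snd, smul_eq_mul]; ring),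
    fun x => ((hF.2 x).const_mul c).congr_deriv
      (by simp only [Prod.smul_fst, Prod.smul_snd, smul_eq_mul]; ring)⟩

theorem IsSol.sub (hF : IsSol q l F) (hG : IsSol q l G) : IsSol q l (fun x => F x - G x) := by
  have := hF.add (hG.smul (-1))
  simpa [sub_eq_add_neg] using this

theorem IsSol.hasDerivAt (hF : IsSol q l F) (x : ℝ) : HasDerivAt F
    (diagCoeff q l x * (F x).1 + l * q x * (F x).2,
      -(l * conj (q x)) * (F x).1 - diagCoeff q l x * (F x).2) x :=
  (hF.1 x).prodMk (hF.2 x)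

theorem IsSol.continuous (hF : IsSol q l F) : Continuous F :=
  continuous_iff_continuousAt.2 fun x => (hF.hasDerivAt x).continuousAt

theorem IsSol.wronskian_eq (hF : IsSol q l F) (hG : IsSol q l G) (x y : ℝ) :
    wronskian F G x = wronskian F G y := by
  have hd : ∀ x, HasDerivAt (wronskian F G) 0 x := fun x =>
    (((hF.1 x).mul (hG.2 x)).sub ((hF.2 x).mul (hG.1 x))).congr_deriv (by ring)
  exact is_const_of_deriv_eq_zero (fun x => (hd x).differentiableAt) (fun x => (hd x).deriv) x y

/-- The spectral problem is invariant under x ↦ -x combined with exchange of the components and q(x)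
↦ conj q(-x), at the same l. This symmetry reduces every statement at +∞ to the one at -∞. -/
theorem IsSol.reflect (hF : IsSol q l F) : IsSol (reflect q) l (reflectVec F) := by
  have n : ∀ x : ℝ, HasDerivAt (fun x : ℝ => -x) (-1) x := fun x => hasDerivAt_neg x
  refine ⟨fun x => ?_, fun x => ?_⟩
  · refine ((hF.2 (-x)).scomp x (n x)).congr_deriv ?_
    simp only [reflectVec, DNLSII.reflect, diagCoeff, Prod.fst_swap, Prod.snd_swap,
      Complex.conj_conj, neg_smul, one_smul]
    ring
  · refine ((hF.1 (-x)).scomp x (n x)).congr_deriv ?_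
    simp only [reflectVec, DNLSII.reflect, diagCoeff, Prod.fst_swap, Prod.snd_swap,
      Complex.conj_conj, neg_smul, one_smul]
    ring

theorem reflect_reflect (q : ℝ → ℂ) : reflect (reflect q) = q := by
  funext x; simp [reflect]

theorem reflectVec_reflectVec (F : ℝ → ℂ × ℂ) : reflectVec (reflectVec F) = F := by
  funext x; simp [reflectVec]

theorem Pot.reflect (hq : Pot q) : Pot (reflect q) where
  cont := by
    have := hq.cont
    have := Complex.continuous_conj
    unfold DNLSII.reflect; fun_prop
  bdd := by
    obtain ⟨B, hB⟩ := hq.bdd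
    exact ⟨B, fun x => by simpa [DNLSII.reflect] using hB (-x)⟩
  i1 := by simpa [DNLSII.reflect] using hq.i1.comp_neg
  i2 := by simpa [DNLSII.reflect] using hq.i2.comp_neg

theorem expBound_reflect (q : ℝ → ℂ) (l : ℂ) : expBound (reflect q) l = expBound q l := by
  unfold expBound
  congr 2
  rw [← integral_neg_eq_self (wt q l) volume]
  congr 1; funext x
  simp [wt, reflect]

theorem norm_diagCoeff_le {B : ℝ} (hB : ∀ x, ‖q x‖ ≤ B) (l : ℂ) (x : ℝ) :
    ‖diagCoeff q l x‖ ≤ ‖l‖ ^ 2 + B ^ 2 := by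
  have hB0 := (norm_nonneg _).trans (hB 0)
  unfold diagCoeff
  refine (norm_add_le _ _).trans ?_
  simp only [norm_neg, norm_mul, norm_div, norm_pow, Complex.norm_I, RCLike.norm_conj,
    Complex.norm_ofNat]
  have : ‖q x‖ * ‖q x‖ ≤ B * B := mul_le_mul (hB x) (hB x) (norm_nonneg _) hB0
  nlinarith [norm_nonneg (q x)]

/-- A solution that vanishes at a point vanishes identically. -/
theorem IsSol.eq_zero (hq : Pot q) (hF : IsSol q l F) {x₀ : ℝ} (h0 : F x₀ = 0) (x : ℝ) :
    F x = 0 := by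
  obtain ⟨B, hB⟩ := hq.bdd
  have hB0 := (norm_nonneg _).trans (hB 0)
  set K : ℝ := ‖l‖ ^ 2 + B ^ 2 + ‖l‖ * B with hK
  have hK0 : 0 ≤ K := by positivity
  let v : ℝ → ℂ × ℂ → ℂ × ℂ := fun x p =>
    (diagCoeff q l x * p.1 + l * q x * p.2, -(l * conj (q x)) * p.1 - diagCoeff q l x * p.2)
  have hv : ∀ t, LipschitzOnWith K.toNNReal (v t) univ := by
    intro t
    rw [lipschitzOnWith_univ]
    refine LipschitzWith.of_dist_le_mul fun p r => ?_
    rw [Real.coe_toNNReal K hK0, dist_eq_norm, dist_eq_norm]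
    have hd := norm_diagCoeff_le hB l t
    have hl : ‖l‖ * ‖q t‖ ≤ ‖l‖ * B := mul_le_mul_of_nonneg_left (hB t) (norm_nonneg _)
    have n1 : ‖p.1 - r.1‖ ≤ ‖p - r‖ := norm_fst_le (p - r)
    have n2 : ‖p.2 - r.2‖ ≤ ‖p - r‖ := norm_snd_le (p - r)
    refine norm_prod_le_iff.2 ⟨?_, ?_⟩
    · have : (v t p - v t r).1 = diagCoeff q l t * (p.1 - r.1) + l * q t * (p.2 - r.2) := by
        simp only [v, Prod.fst_sub]; ring
      rw [this]
      refine (norm_add_le _ _).trans ?_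
      simp only [norm_mul]
      calc _ ≤ (‖l‖ ^ 2 + B ^ 2) * ‖p - r‖ + (‖l‖ * B) * ‖p - r‖ := by gcongr
        _ = K * ‖p - r‖ := by rw [hK]; ring
    · have : (v t p - v t r).2
          = -(l * conj (q t)) * (p.1 - r.1) - diagCoeff q l t * (p.2 - r.2) := by
        simp only [v, Prod.snd_sub]; ring
      rw [this]
      refine (norm_sub_le _ _).trans ?_
      simp only [norm_mul, norm_neg, RCLike.norm_conj]
      calc _ ≤ (‖l‖ * B) * ‖p - r‖ + (‖l‖ ^ 2 + B ^ 2) * ‖p - r‖ := by gcongr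
        _ = K * ‖p - r‖ := by rw [hK]; ring
  have := ODE_solution_unique_univ (v := v) (s := fun _ => univ) (t₀ := x₀) (g := fun _ => 0) hv
    (fun t => ⟨hF.hasDerivAt t, mem_univ _⟩)
    (fun t => ⟨(hasDerivAt_const t (0 : ℂ × ℂ)).congr_deriv (by simp [v]; rfl), mem_univ _⟩) h0
  exact congrFun this x

theorem src1_eq (q : ℝ → ℂ) (l : ℂ) (x : ℝ) (v : ℂ × ℂ) :
    src1 q l x v = diagCoeff q l x * v.1 + l * q x * v.2 + Complex.I * l ^ 2 * v.1 := by
  unfold src1 diagCoeff; ring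

theorem src2_eq (q : ℝ → ℂ) (l : ℂ) (x : ℝ) (v : ℂ × ℂ) :
    src2 q l x v = -(l * conj (q x)) * v.1 - diagCoeff q l x * v.2 - Complex.I * l ^ 2 * v.2 := by
  unfold src2 diagCoeff; ring

theorem hasDerivAt_cexp_mul (c : ℂ) (x : ℝ) :
    HasDerivAt (fun x : ℝ => Complex.exp (c * (x : ℂ))) (Complex.exp (c * (x : ℂ)) * c) x := by
  have := ((hasDerivAt_id (x : ℂ)).const_mul c).cexp.comp_ofReal
  simpa using this

theorem solMinus_eq (q : ℝ → ℂ) (l : ℂ) (x : ℝ) :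
    solMinus q l x = Complex.exp (-(Complex.I * l ^ 2) * (x : ℂ)) • jostMinus q l x := by
  unfold solMinus; congr 2; ring

theorem isSol_solMinus (hq : Pot q) (hl : 0 ≤ (l ^ 2).im) : IsSol q l (solMinus q l) := by
  have e := hasDerivAt_cexp_mul (-(Complex.I * l ^ 2))
  have e1 : solMinus q l = fun x : ℝ => Complex.exp (-(Complex.I * l ^ 2) * (x : ℂ)) • jostMinus q l x :=
    funext fun x => solMinus_eq q l x
  rw [e1]
  refine ⟨fun x => ?_, fun x => ?_⟩
  · refine ((e x).mul (hasDerivAt_jostMinus_fst hq hl x)).congr_deriv ?_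
    simp only [Prod.smul_fst, Prod.smul_snd, smul_eq_mul, src1_eq]
    ring
  · refine ((e x).mul (hasDerivAt_jostMinus_snd hq hl x)).congr_deriv ?_
    simp only [Prod.smul_fst, Prod.smul_snd, smul_eq_mul, src2_eq]
    ring

/-- A solution whose normalization at `-∞` is that of the Jost solution is the Jost solution. -/
theorem IsSol.eq_solMinus (hq : Pot q) (hl : 0 < (l ^ 2).im) (hF : IsSol q l F) {K : ℝ}
    (hK : ∀ x : ℝ, ‖Complex.exp (Complex.I * l ^ 2 * (x : ℂ)) • F x‖ ≤ K)
    (hlim : Tendsto (fun x : ℝ => Complex.exp (Complex.I * l ^ 2 * (x : ℂ)) * (F x).1) atBot (𝓝 1)) :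
    F = solMinus q l := by
  have e := hasDerivAt_cexp_mul (Complex.I * l ^ 2)
  have hF' := hF.continuous
  have key := eq_jostMinus_of_hasDerivAt (φ := fun x : ℝ =>
    Complex.exp (Complex.I * l ^ 2 * (x : ℂ)) • F x) hq hl (by fun_prop) hK (fun x => by
      refine ((e x).mul (hF.1 x)).congr_deriv ?_
      simp only [Prod.smul_fst, Prod.smul_snd, smul_eq_mul, src1_eq]; ring) (fun x => by
      refine ((e x).mul (hF.2 x)).congr_deriv ?_
      simp only [Prod.smul_fst, Prod.smul_snd, smul_eq_mul, src2_eq]; ring) hlim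
  funext x
  rw [solMinus_eq, ← key, smul_smul, ← Complex.exp_add]
  have : -(Complex.I * l ^ 2) * (x : ℂ) + Complex.I * l ^ 2 * x = 0 := by ring
  rw [this, Complex.exp_zero, one_smul]

/-- The substitution y ↦ -y turns the Volterra equation on (x, ∞) into the one on (-∞, -x) for the
reflected potential, with the two components exchanged. -/
theorem isJostPlus_iff {φ : ℝ → ℂ × ℂ} :
    IsJostPlus q l φ ↔ IsJostMinus (reflect q) l (reflectVec φ) := by
  have e1 : Continuous φ ↔ Continuous (reflectVec φ) := by
    refine ⟨fun h => ?_, fun h => ?_⟩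
    · exact continuous_swap.comp (h.comp continuous_neg)
    · have := continuous_swap.comp (h.comp continuous_neg)
      refine this.congr fun x => ?_
      simp [reflectVec]
  have nsw : ∀ v : ℂ × ℂ, ‖v.swap‖ = ‖v‖ := fun v => by simp [Prod.norm_def, max_comm]
  have e2 : (∃ K, ∀ x, ‖φ x‖ ≤ K) ↔ ∃ K, ∀ x, ‖reflectVec φ x‖ ≤ K := by
    refine exists_congr fun K => ⟨fun h x => ?_, fun h x => ?_⟩
    · simpa [reflectVec, nsw] using h (-x)
    · simpa [reflectVec, nsw] using h (-x)
  unfold IsJostPlus IsJostMinus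
  refine and_congr e1 (and_congr e2 ?_)
  refine ⟨fun h x => ?_, fun h x => ?_⟩
  · have h' := h (-x)
    rw [show reflectVec φ x = (φ (-x)).swap from rfl, h']
    refine Prod.ext ?_ ?_
    · simp only [Prod.swap_prod_mk]
      rw [← integral_comp_neg_Iic x, sub_eq_add_neg, ← integral_neg]
      congr 1
      refine integral_congr_ae (Eventually.of_forall fun y => ?_)
      simp only [reflect, reflectVec, Prod.fst_swap, Prod.snd_swap, Complex.conj_conj]
      ring
    · simp only [Prod.swap_prod_mk]
      rw [← integral_comp_neg_Iic x, ← integral_neg]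
      refine integral_congr_ae (Eventually.of_forall fun y => ?_)
      simp only [reflect, reflectVec, Prod.fst_swap, Prod.snd_swap, Complex.conj_conj]
      push_cast
      rw [show -(2 * Complex.I * l ^ 2 * (-(x : ℂ) - -(y : ℂ)))
        = 2 * Complex.I * l ^ 2 * ((x : ℂ) - (y : ℂ)) by ring]
      ring
  · have h' := h (-x)
    have h2 : φ x = (reflectVec φ (-x)).swap := by simp [reflectVec]
    rw [h2, h']
    refine Prod.ext ?_ ?_
    · simp only [Prod.swap_prod_mk]
      have := integral_comp_neg_Iic (-x) (fun y : ℝ =>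
        Complex.exp (-(2 * Complex.I * l ^ 2 * ((x : ℂ) - (y : ℂ)))) *
          (Complex.I / 4 * (q y * conj (q y)) * (φ y).1 + l * q y * (φ y).2))
      rw [neg_neg] at this
      rw [← this, ← integral_neg]
      refine integral_congr_ae (Eventually.of_forall fun y => ?_)
      simp only [reflect, reflectVec, Prod.fst_swap, Prod.snd_swap, Complex.conj_conj]
      push_cast
      rw [show -(2 * Complex.I * l ^ 2 * ((x : ℂ) - -(y : ℂ)))
        = 2 * Complex.I * l ^ 2 * (-(x : ℂ) - (y : ℂ)) by ring]
      ring
    · simp only [Prod.swap_prod_mk]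
      have := integral_comp_neg_Iic (-x) (fun y : ℝ =>
          (-(l * conj (q y)) * (φ y).1 - Complex.I / 4 * (q y * conj (q y)) * (φ y).2))
      rw [neg_neg] at this
      rw [← this, sub_eq_add_neg, ← integral_neg]
      congr 1
      refine integral_congr_ae (Eventually.of_forall fun y => ?_)
      simp only [reflect, reflectVec, Prod.fst_swap, Prod.snd_swap, Complex.conj_conj]
      ring

theorem jostPlus_eq (hq : Pot q) (hl : 0 ≤ (l ^ 2).im) :
    jostPlus q l = reflectVec (jostMinus (reflect q) l) := by
  have h1 := isJostMinus_jostMinus hq.reflect hl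
  have h : ∃ φ, IsJostPlus q l φ := ⟨reflectVec (jostMinus (reflect q) l), by
    rw [isJostPlus_iff, reflectVec_reflectVec]; exact h1⟩
  have h2 : IsJostPlus q l (jostPlus q l) := by
    unfold jostPlus; rw [dif_pos h]; exact h.choose_spec
  rw [isJostPlus_iff] at h2
  rw [← h2.unique hq.reflect hl h1, reflectVec_reflectVec]

theorem solPlus_eq (hq : Pot q) (hl : 0 ≤ (l ^ 2).im) :
    solPlus q l = reflectVec (solMinus (reflect q) l) := by
  funext x
  unfold solPlus
  rw [jostPlus_eq hq hl]
  simp only [reflectVec, solMinus, Prod.smul_swap]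
  congr 2; push_cast; ring

theorem isSol_solPlus (hq : Pot q) (hl : 0 ≤ (l ^ 2).im) : IsSol q l (solPlus q l) := by
  rw [solPlus_eq hq hl]
  have := (isSol_solMinus hq.reflect hl).reflect
  rwa [reflect_reflect] at this

theorem norm_swap (v : ℂ × ℂ) : ‖v.swap‖ = ‖v‖ := by simp [Prod.norm_def, max_comm]

theorem norm_jostPlus_le (hq : Pot q) (hl : 0 ≤ (l ^ 2).im) (x : ℝ) :
    ‖jostPlus q l x‖ ≤ 2 * expBound q l := by
  rw [jostPlus_eq hq hl, ← expBound_reflect]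
  simp only [reflectVec, norm_swap]
  exact norm_jostMinus_le hq.reflect hl (-x)

theorem tendsto_jostPlus (hq : Pot q) (hl : 0 ≤ (l ^ 2).im) :
    Tendsto (jostPlus q l) atTop (𝓝 (0, 1)) := by
  rw [jostPlus_eq hq hl]
  have h := (tendsto_jostMinus hq.reflect hl).comp tendsto_neg_atTop_atBot
  exact (continuous_swap.tendsto ((1, 0) : ℂ × ℂ)).comp h

theorem IsSol.eq_solPlus (hq : Pot q) (hl : 0 < (l ^ 2).im) (hF : IsSol q l F) {K : ℝ}
    (hK : ∀ x : ℝ, ‖Complex.exp (-(Complex.I * l ^ 2 * (x : ℂ))) • F x‖ ≤ K)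
    (hlim : Tendsto (fun x : ℝ => Complex.exp (-(Complex.I * l ^ 2 * (x : ℂ))) * (F x).2) atTop
      (𝓝 1)) : F = solPlus q l := by
  rw [solPlus_eq hq hl.le, ← hF.reflect.eq_solMinus hq.reflect hl (K := K), reflectVec_reflectVec]
  · intro x
    have := hK (-x)
    push_cast at this
    rw [mul_neg, neg_neg, norm_smul] at this
    rw [norm_smul]
    simpa [reflectVec, norm_swap] using this
  · have := hlim.comp tendsto_neg_atBot_atTop
    refine this.congr fun x => ?_
    simp [reflectVec]

theorem scatA_eq_wronskian (hq : Pot q) (hl : 0 ≤ (l ^ 2).im) (x : ℝ) :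
    scatA q l = wronskian (solMinus q l) (solPlus q l) x :=
  (isSol_solMinus hq hl).wronskian_eq (isSol_solPlus hq hl) 0 x

theorem scatA_eq (hq : Pot q) (hl : 0 ≤ (l ^ 2).im) : scatA q l =
    (jostMinus q l 0).1 * (jostMinus (reflect q) l 0).1
      - (jostMinus q l 0).2 * (jostMinus (reflect q) l 0).2 := by
  unfold scatA
  rw [solPlus_eq hq hl]
  simp [solMinus, reflectVec]

theorem norm_scatA_le (hq : Pot q) (hl : 0 ≤ (l ^ 2).im) : ‖scatA q l‖ ≤ 8 * expBound q l ^ 2 := by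
  rw [scatA_eq hq hl]
  have a := norm_jostMinus_le hq hl 0
  have b := norm_jostMinus_le hq.reflect hl 0
  rw [expBound_reflect] at b
  have a1 := (norm_fst_le _).trans a
  have a2 := (norm_snd_le _).trans a
  have b1 := (norm_fst_le _).trans b
  have b2 := (norm_snd_le _).trans b
  have hE := one_le_expBound q l
  refine (norm_sub_le _ _).trans ?_
  rw [norm_mul, norm_mul]
  have := mul_le_mul a1 b1 (norm_nonneg _) (by positivity)
  have := mul_le_mul a2 b2 (norm_nonneg _) (by positivity)
  nlinarith

/-- One zero would force the solution to vanish identically, against the limit e₁ of the Jost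
function. -/
theorem solMinus_ne_zero (hq : Pot q) (hl : 0 ≤ (l ^ 2).im) (x : ℝ) : solMinus q l x ≠ 0 := by
  intro h
  have hz := (isSol_solMinus hq hl).eq_zero hq h
  have hj : ∀ x, jostMinus q l x = 0 := fun x => by
    have := hz x
    rw [solMinus_eq, smul_eq_zero] at this
    exact this.resolve_left (Complex.exp_ne_zero _)
  have ht := tendsto_jostMinus hq hl
  rw [funext hj] at ht
  have := tendsto_nhds_unique ht tendsto_const_nhds
  simp [Prod.ext_iff] at this

theorem solPlus_ne_zero (hq : Pot q) (hl : 0 ≤ (l ^ 2).im) (x : ℝ) : solPlus q l x ≠ 0 := by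
  rw [solPlus_eq hq hl]
  intro h
  refine solMinus_ne_zero hq.reflect hl (-x) ?_
  have : (solMinus (DNLSII.reflect q) l (-x)).swap.swap = (0 : ℂ × ℂ).swap := congrArg Prod.swap h
  simpa using this

/-- At a zero of `a` the two Jost solutions are proportional. -/
theorem exists_norming (hq : Pot q) (hl : 0 ≤ (l ^ 2).im) (ha : scatA q l = 0) :
    ∃ c : ℂ, c ≠ 0 ∧ ∀ x, solMinus q l x = c • solPlus q l x := by
  have h0 : (solMinus q l 0).1 * (solPlus q l 0).2 = (solMinus q l 0).2 * (solPlus q l 0).1 :=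
    sub_eq_zero.1 ha
  have hp := solPlus_ne_zero hq hl 0
  have hc : ∃ c : ℂ, solMinus q l 0 = c • solPlus q l 0 := by
    by_cases h1 : (solPlus q l 0).1 = 0
    · have h2 : (solPlus q l 0).2 ≠ 0 := fun h2 => hp (Prod.ext h1 h2)
      refine ⟨(solMinus q l 0).2 / (solPlus q l 0).2, Prod.ext ?_ ?_⟩
      · rw [h1, mul_zero] at h0
        simp only [Prod.smul_fst, smul_eq_mul, h1, mul_zero]
        exact (mul_eq_zero.1 h0).resolve_right h2
      · simp only [Prod.smul_snd, smul_eq_mul]; field_simp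
    · refine ⟨(solMinus q l 0).1 / (solPlus q l 0).1, Prod.ext ?_ ?_⟩
      · simp only [Prod.smul_fst, smul_eq_mul]; field_simp
      · simp only [Prod.smul_snd, smul_eq_mul]; field_simp; exact h0.symm
  obtain ⟨c, hc⟩ := hc
  have h := ((isSol_solMinus hq hl).sub ((isSol_solPlus hq hl).smul c)).eq_zero hq (x₀ := 0)
    (sub_eq_zero.2 hc)
  refine ⟨c, ?_, fun x => sub_eq_zero.1 (h x)⟩
  rintro rfl
  rw [zero_smul] at hc
  exact solMinus_ne_zero hq hl 0 hc

end Sol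


/-! ### Analyticity of the scattering coefficient -/

/-- Locally dominated integrals of holomorphic families are holomorphic. -/
theorem differentiableOn_integral {α : Type*} [MeasurableSpace α] {μ : Measure α} {U : Set ℂ}
    {F : ℂ → α → ℂ} (hm : ∀ l ∈ U, AEStronglyMeasurable (F l) μ)
    (hd : ∀ a, DifferentiableOn ℂ (fun l => F l a) U)
    (hb : ∀ l₀ ∈ U, ∃ ε > 0, Metric.ball l₀ ε ⊆ U ∧ ∃ b : α → ℝ, Integrable b μ ∧
      ∀ᵐ a ∂μ, ∀ l ∈ Metric.ball l₀ ε, ‖F l a‖ ≤ b a) :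
    DifferentiableOn ℂ (fun l => ∫ a, F l a ∂μ) U := by
  intro l₀ h₀
  obtain ⟨ε, hε, hU, b, hbi, hb⟩ := hb l₀ h₀
  have hda : ∀ a, ∀ l ∈ Metric.ball l₀ ε, HasDerivAt (fun l => F l a) (deriv (fun l => F l a) l) l :=
    fun a l hl => (((hd a).mono hU).differentiableAt (Metric.isOpen_ball.mem_nhds hl)).hasDerivAt
  -- The derivative in l is a pointwise limit of difference quotients along the sequence t n → 0,
  -- and measurability passes to the limit.
  have hmeas : AEStronglyMeasurable (fun a => deriv (fun l => F l a) l₀) μ := by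
    set t : ℕ → ℂ := fun n => ((ε / 2) / ((n : ℝ) + 1) : ℝ) with ht
    have ht0 : ∀ n, t n ≠ 0 := fun n => by
      simp only [ht]; exact Complex.ofReal_ne_zero.2 (by positivity)
    have htm : ∀ n, l₀ + t n ∈ Metric.ball l₀ ε := fun n => by
      rw [Metric.mem_ball, dist_eq_norm, add_sub_cancel_left]
      simp only [ht, Complex.norm_real]
      rw [Real.norm_of_nonneg (by positivity)]
      have : (ε / 2) / ((n : ℝ) + 1) ≤ ε / 2 :=
        div_le_self (by positivity) (by linarith [Nat.cast_nonneg (α := ℝ) n])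
      linarith
    have htl : Tendsto t atTop (𝓝[≠] 0) := by
      refine tendsto_nhdsWithin_iff.2 ⟨?_, Eventually.of_forall ht0⟩
      have : Tendsto (fun n : ℕ => (ε / 2) / ((n : ℝ) + 1)) atTop (𝓝 0) :=
        tendsto_const_nhds.div_atTop
          (tendsto_atTop_add_const_right _ _ tendsto_natCast_atTop_atTop)
      have h2 := (Complex.continuous_ofReal.tendsto (0 : ℝ)).comp this
      rw [Complex.ofReal_zero] at h2
      exact h2
    refine aestronglyMeasurable_of_tendsto_ae atTop
      (f := fun (n : ℕ) a => (t n)⁻¹ • (F (l₀ + t n) a - F l₀ a)) (fun n => ?_)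
      (Eventually.of_forall fun a => ?_)
    · exact ((hm _ (hU (htm n))).sub (hm _ h₀)).const_smul ((t n)⁻¹)
    · exact (hasDerivAt_iff_tendsto_slope_zero.1
        (hda a l₀ (Metric.mem_ball_self hε))).comp htl
  -- Cauchy's estimate on circles of radius ε/4, which stay inside the ball where the family is
  -- dominated.
  have hbound : ∀ᵐ a ∂μ, ∀ l ∈ Metric.ball l₀ (ε / 2),
      ‖deriv (fun l => F l a) l‖ ≤ b a / (ε / 4) := by
    filter_upwards [hb] with a ha l hl
    rw [Metric.mem_ball] at hl
    have hsub : Metric.closedBall l (ε / 4) ⊆ Metric.ball l₀ ε := by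
      intro z hz
      rw [Metric.mem_closedBall] at hz
      rw [Metric.mem_ball]
      linarith [dist_triangle z l l₀]
    refine Complex.norm_deriv_le_of_forall_mem_sphere_norm_le (by positivity) ?_ fun z hz =>
      ha z (hsub (Metric.sphere_subset_closedBall hz))
    refine DifferentiableOn.diffContOnCl ?_
    rw [closure_ball _ (by positivity)]
    exact (hd a).mono (hsub.trans hU)
  have := hasDerivAt_integral_of_dominated_loc_of_deriv_le (𝕜 := ℂ) (F := F)
    (F' := fun l a => deriv (fun l => F l a) l) (x₀ := l₀) (s := Metric.ball l₀ (ε / 2))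
    (bound := fun a => b a / (ε / 4))
    (Metric.ball_mem_nhds _ (by positivity))
    (by filter_upwards [Metric.ball_mem_nhds l₀ hε] with l hl using hm l (hU hl))
    (hbi.mono' (hm _ h₀) (by
      filter_upwards [hb] with a ha using ha l₀ (Metric.mem_ball_self hε)))
    hmeas hbound (hbi.div_const _)
    (Eventually.of_forall fun a l hl => hda a l (Metric.ball_subset_ball (by linarith) hl))
  exact this.2.differentiableAt.differentiableWithinAt

/-- The set of spectral parameters with `Im l² > 0`. -/
def upperSq : Set ℂ := {l | 0 < (l ^ 2).im}

theorem isOpen_upperSq : IsOpen upperSq :=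
  isOpen_lt continuous_const (Complex.continuous_im.comp (continuous_pow 2))

theorem quadrantI_subset : quadrantI ⊆ upperSq := by
  intro l hl
  have h1 : 0 < l.re := hl.1
  have h2 : 0 < l.im := hl.2
  have : (l ^ 2).im = 2 * (l.re * l.im) := by rw [sq, Complex.mul_im]; ring
  change 0 < (l ^ 2).im
  rw [this]; positivity

theorem wt_mono (q : ℝ → ℂ) {l l' : ℂ} (h : ‖l‖ ≤ ‖l'‖) (x : ℝ) : wt q l x ≤ wt q l' x := by
  unfold wt; gcongr

theorem expBound_mono {q : ℝ → ℂ} (hq : Pot q) {l l' : ℂ} (h : ‖l‖ ≤ ‖l'‖) :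
    expBound q l ≤ expBound q l' :=
  Real.exp_le_exp.2 (mul_le_mul_of_nonneg_left
    (integral_mono (hq.integrable_wt l) (hq.integrable_wt l') (wt_mono q h)) (by norm_num))

theorem norm_le_of_mem_ball {l₀ l : ℂ} {ε : ℝ} (hε : 0 < ε) (hl : l ∈ Metric.ball l₀ ε) :
    ‖l‖ ≤ ‖((‖l₀‖ + ε : ℝ) : ℂ)‖ := by
  rw [Complex.norm_real, Real.norm_of_nonneg (by positivity)]
  rw [Metric.mem_ball, dist_eq_norm] at hl
  linarith [norm_le_norm_add_norm_sub' l l₀]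

/-- Induction on n, differentiating under the integral. The weight and the exponential bound
increase with ‖l‖, so their values at ‖l₀‖ + ε dominate the integrand throughout the ball around l₀.
-/
theorem differentiableOn_neumann {q : ℝ → ℂ} (hq : Pot q) (n : ℕ) : ∀ x,
    DifferentiableOn ℂ (fun l => (neumann q l n x).1) upperSq ∧
    DifferentiableOn ℂ (fun l => (neumann q l n x).2) upperSq := by
  induction n with
  | zero => exact fun x => ⟨differentiableOn_const 1, differentiableOn_const 0⟩
  | succ n ih =>
    have hn : ∀ l ∈ upperSq, Continuous (neumann q l n) := fun l hl =>
      (neumann_spec hq (le_of_lt hl) n).1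
    have hw : ∀ l₀ : ℂ, ∀ ε > 0, Metric.ball l₀ ε ⊆ upperSq → ∀ l ∈ Metric.ball l₀ ε, ∀ y,
        wt q l y * ‖neumann q l n y‖ ≤ wt q ((‖l₀‖ + ε : ℝ) : ℂ) y *
          ((1 / 2) ^ n * expBound q ((‖l₀‖ + ε : ℝ) : ℂ)) := by
      intro l₀ ε hε hU l hl y
      have h1 := norm_le_of_mem_ball hε hl
      refine mul_le_mul (wt_mono q h1 y) ?_ (norm_nonneg _) (wt_nonneg _ _ _)
      exact (norm_neumann_le hq (le_of_lt (hU hl)) n y).trans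
        (mul_le_mul_of_nonneg_left (expBound_mono hq h1) (by positivity))
    intro x
    refine ⟨?_, ?_⟩
    · change DifferentiableOn ℂ (fun l => ∫ y in Iic x, src1 q l y (neumann q l n y)) upperSq
      refine differentiableOn_integral (fun l hl =>
        (continuous_src1 hq l (hn l hl)).aestronglyMeasurable) (fun y => ?_) fun l₀ h₀ => ?_
      · have h1 := (ih y).1
        have h2 := (ih y).2
        unfold src1
        fun_prop
      · obtain ⟨ε, hε, hU⟩ := Metric.isOpen_iff.1 isOpen_upperSq l₀ h₀
        refine ⟨ε, hε, hU, _, ((hq.integrable_wt _).mul_const _).integrableOn,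
          Eventually.of_forall fun y l hl => (norm_src1_le q l y _).trans (hw l₀ ε hε hU l hl y)⟩
    · change DifferentiableOn ℂ (fun l => ∫ y in Iic x,
        Complex.exp (2 * Complex.I * l ^ 2 * ((x : ℂ) - (y : ℂ))) * src2 q l y (neumann q l n y))
        upperSq
      refine differentiableOn_integral (fun l hl => ?_) (fun y => ?_) fun l₀ h₀ => ?_
      · have := continuous_src2 hq l (hn l hl)
        exact Continuous.aestronglyMeasurable (by fun_prop)
      · have h1 := (ih y).1
        have h2 := (ih y).2
        unfold src2
        fun_prop
      · obtain ⟨ε, hε, hU⟩ := Metric.isOpen_iff.1 isOpen_upperSq l₀ h₀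
        refine ⟨ε, hε, hU, fun y => wt q ((‖l₀‖ + ε : ℝ) : ℂ) y *
          ((1 / 2) ^ n * expBound q ((‖l₀‖ + ε : ℝ) : ℂ)),
          ((hq.integrable_wt _).mul_const _).integrableOn, ?_⟩
        filter_upwards [ae_restrict_mem measurableSet_Iic] with y hy l hl
        rw [norm_mul]
        exact (mul_le_of_le_one_left (norm_nonneg _) (norm_kernel_le (le_of_lt (hU hl)) hy)).trans
          ((norm_src2_le q l y _).trans (hw l₀ ε hε hU l hl y))

/-- The geometric bound on the Neumann terms is locally uniform in l, so the sum is holomorphic by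
Weierstrass. -/
theorem differentiableOn_jostMinus {q : ℝ → ℂ} (hq : Pot q) (x : ℝ) :
    DifferentiableOn ℂ (fun l => (jostMinus q l x).1) upperSq ∧
    DifferentiableOn ℂ (fun l => (jostMinus q l x).2) upperSq := by
  have hs : ∀ l ∈ upperSq, Summable fun n => neumann q l n x := fun l hl =>
    Summable.of_norm_bounded (summable_bound (expBound q l))
      fun n => norm_neumann_le hq (le_of_lt hl) n x
  have main : ∀ p : ℂ × ℂ →L[ℂ] ℂ, (∀ v, ‖p v‖ ≤ ‖v‖) →
      (∀ n, DifferentiableOn ℂ (fun l => p (neumann q l n x)) upperSq) →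
      DifferentiableOn ℂ (fun l => p (jostMinus q l x)) upperSq := by
    intro p hp hd l₀ h₀
    obtain ⟨ε, hε, hU⟩ := Metric.isOpen_iff.1 isOpen_upperSq l₀ h₀
    have h1 : DifferentiableOn ℂ (fun l => ∑' n, p (neumann q l n x)) (Metric.ball l₀ ε) :=
      Complex.differentiableOn_tsum_of_summable_norm
        (summable_bound (expBound q ((‖l₀‖ + ε : ℝ) : ℂ)))
        (fun n => (hd n).mono hU) Metric.isOpen_ball fun n l hl =>
          (hp _).trans ((norm_neumann_le hq (le_of_lt (hU hl)) n x).trans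
            (mul_le_mul_of_nonneg_left (expBound_mono hq (norm_le_of_mem_ball hε hl))
              (by positivity)))
    have h2 := h1.differentiableAt (Metric.ball_mem_nhds l₀ hε)
    refine (h2.congr_of_eventuallyEq ?_).differentiableWithinAt
    filter_upwards [Metric.ball_mem_nhds l₀ hε] with l hl
    rw [jostMinus_eq_tsum hq (le_of_lt (hU hl)), p.map_tsum (hs l (hU hl))]
  exact ⟨main (ContinuousLinearMap.fst ℂ ℂ ℂ) norm_fst_le
      fun n => (differentiableOn_neumann hq n x).1,
    main (ContinuousLinearMap.snd ℂ ℂ ℂ) norm_snd_le fun n => (differentiableOn_neumann hq n x).2⟩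

theorem differentiableOn_scatA {q : ℝ → ℂ} (hq : Pot q) :
    DifferentiableOn ℂ (scatA q) upperSq := by
  obtain ⟨a1, a2⟩ := differentiableOn_jostMinus hq 0
  obtain ⟨b1, b2⟩ := differentiableOn_jostMinus hq.reflect 0
  exact ((a1.mul b1).sub (a2.mul b2)).congr fun l hl => scatA_eq hq (le_of_lt hl)

/-! ### The scattering coefficient near the origin -/

section SmallParameter

variable {q : ℝ → ℂ} {l : ℂ}

/-- Lets the single quantity E = `expBound q 1` serve as the constant in all estimates near the
origin. -/
theorem integral_norm_le_expBound (hq : Pot q) : ∫ y, ‖q y‖ ≤ expBound q 1 := by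
  have h1 : ∫ y, ‖q y‖ ≤ ∫ y, wt q 1 y := integral_mono hq.i1 (hq.integrable_wt 1) fun y => by
    simp only [wt, norm_one, one_mul]
    have : 0 ≤ ‖q y‖ ^ 2 / 4 := by positivity
    linarith
  have h2 := Real.add_one_le_exp (2 * ∫ y, wt q 1 y)
  have h3 : 0 ≤ ∫ y, wt q 1 y := integral_nonneg (wt_nonneg q 1)
  unfold expBound
  linarith

/-- The second component starts from zero and is fed by the first only through the term -l q̄, which
has size O(l). The diagonal term |q|²/4 carries no l and is absorbed by Gronwall's inequality. -/
theorem norm_jostMinus_snd_le (hq : Pot q) (hl : 0 ≤ (l ^ 2).im) (h1 : ‖l‖ ≤ 1) (x : ℝ) :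
    ‖(jostMinus q l x).2‖ ≤ 4 * expBound q 1 ^ 3 * ‖l‖ := by
  set E := expBound q 1 with hE
  have hE1 : 1 ≤ E := one_le_expBound q 1
  have hc := continuous_jostMinus hq hl
  have hb : ∀ x, ‖jostMinus q l x‖ ≤ 2 * E := fun x => (norm_jostMinus_le hq hl x).trans
    (mul_le_mul_of_nonneg_left (expBound_mono hq (by simpa using h1)) (by norm_num))
  have hc4 : Continuous fun y => ‖q y‖ ^ 2 / 4 := by have := hq.cont; fun_prop
  have hi4 : Integrable fun y => ‖q y‖ ^ 2 / 4 := hq.i2.div_const 4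
  have hc2 : Continuous fun x => ‖(jostMinus q l x).2‖ := by fun_prop
  have hb2 : ∀ x, ‖(jostMinus q l x).2‖ ≤ 2 * E := fun x => (norm_snd_le _).trans (hb x)
  have hint : Integrable fun y => ‖q y‖ ^ 2 / 4 * ‖(jostMinus q l y).2‖ := by
    refine (hi4.mul_const (2 * E)).mono' (hc4.mul hc2).aestronglyMeasurable
      (Eventually.of_forall fun y => ?_)
    rw [Real.norm_of_nonneg (by positivity)]
    exact mul_le_mul_of_nonneg_left (hb2 y) (by positivity)
  have hG := gronwall_Iic hc4 hi4 (fun y => by positivity) hc2 (A := ‖l‖ * (2 * E ^ 2))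
    (by positivity) (fun x => norm_nonneg _) hb2 (fun x => by
      obtain ⟨-, -, e⟩ := isJostMinus_iff.1 (isJostMinus_jostMinus hq hl)
      have e2 : (jostMinus q l x).2 = (volt q l (jostMinus q l) x).2 := by
        conv_lhs => rw [e x]
        simp
      rw [e2]
      have : ‖(volt q l (jostMinus q l) x).2‖
          ≤ ∫ y in Iic x, (‖l‖ * (2 * E) * ‖q y‖ + ‖q y‖ ^ 2 / 4 * ‖(jostMinus q l y).2‖) := by
        refine norm_integral_le_of_norm_le ((hq.i1.const_mul _).add hint).integrableOn ?_
        filter_upwards [ae_restrict_mem measurableSet_Iic] with y hy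
        rw [norm_mul]
        refine (mul_le_of_le_one_left (norm_nonneg _) (norm_kernel_le hl hy)).trans ?_
        unfold src2
        refine (norm_sub_le _ _).trans ?_
        simp only [norm_mul, norm_div, norm_neg, Complex.norm_I, RCLike.norm_conj,
          Complex.norm_ofNat]
        have := mul_le_mul_of_nonneg_left ((norm_fst_le _).trans (hb y))
          (by positivity : 0 ≤ ‖l‖ * ‖q y‖)
        nlinarith
      refine this.trans ?_
      rw [integral_add (hq.i1.const_mul _).integrableOn hint.integrableOn, integral_const_mul]
      have h2 : ∫ y in Iic x, ‖q y‖ ≤ E :=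
        (integral_Iic_le hq.i1 (fun _ => norm_nonneg _) x).trans (integral_norm_le_expBound hq)
      have := mul_le_mul_of_nonneg_left h2 (by positivity : 0 ≤ ‖l‖ * (2 * E))
      nlinarith) x
  have hexp : Real.exp (2 * ∫ y in Iic x, ‖q y‖ ^ 2 / 4) ≤ E := by
    refine Real.exp_le_exp.2 (mul_le_mul_of_nonneg_left ?_ (by norm_num))
    refine (integral_Iic_le hi4 (fun y => by positivity) x).trans
      (integral_mono hi4 (hq.integrable_wt 1) fun y => ?_)
    simp only [wt, norm_one, one_mul]
    linarith [norm_nonneg (q y)]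
  refine hG.trans ((mul_le_mul_of_nonneg_left hexp (by positivity)).trans (le_of_eq ?_))
  ring

/-- Up to a phase, the first component changes only through l q φ₂, and φ₂ is itself O(l). The
deviation of its modulus from 1 is therefore at most of order l². -/
theorem norm_jostMinus_fst_ge (hq : Pot q) (hl : 0 ≤ (l ^ 2).im) (h1 : ‖l‖ ≤ 1) (x : ℝ) :
    1 - 4 * expBound q 1 ^ 4 * ‖l‖ ^ 2 ≤ ‖(jostMinus q l x).1‖ := by
  set E := expBound q 1 with hE
  have hE1 : 1 ≤ E := one_le_expBound q 1
  have hc := continuous_jostMinus hq hl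
  have hc4 : Continuous fun y => ‖q y‖ ^ 2 / 4 := by have := hq.cont; fun_prop
  have hi4 : Integrable fun y => ‖q y‖ ^ 2 / 4 := hq.i2.div_const 4
  have h2 := norm_jostMinus_snd_le hq hl h1
  -- The phase e^{-iθ} removes the diagonal term (i/4)|q|² without changing moduli.
  set θ : ℝ → ℝ := fun x => ∫ y in Iic x, ‖q y‖ ^ 2 / 4 with hθ
  have dθ : ∀ x, HasDerivAt θ (‖q x‖ ^ 2 / 4) x :=
    hasDerivAt_integral_Iic hc4 fun x => hi4.integrableOn
  have hθc : Continuous θ := continuous_iff_continuousAt.2 fun x => (dθ x).continuousAt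
  have de : ∀ x, HasDerivAt (fun x => Complex.exp (-(Complex.I * (θ x : ℂ))))
      (Complex.exp (-(Complex.I * (θ x : ℂ))) * (-(Complex.I * ((‖q x‖ ^ 2 / 4 : ℝ) : ℂ)))) x :=
    fun x => (((dθ x).ofReal_comp).const_mul Complex.I).neg.cexp
  have ne : ∀ x, ‖Complex.exp (-(Complex.I * (θ x : ℂ)))‖ = 1 := fun x => by
    rw [Complex.norm_exp]; simp
  have dψ : ∀ x, HasDerivAt (fun x => Complex.exp (-(Complex.I * (θ x : ℂ))) * (jostMinus q l x).1)
      (Complex.exp (-(Complex.I * (θ x : ℂ))) * (l * q x * (jostMinus q l x).2)) x := fun x => by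
    refine ((de x).mul (hasDerivAt_jostMinus_fst hq hl x)).congr_deriv ?_
    have : q x * conj (q x) = ((‖q x‖ ^ 2 : ℝ) : ℂ) := by
      rw [Complex.mul_conj, Complex.normSq_eq_norm_sq]
    unfold src1
    rw [this]
    push_cast
    ring
  have hbd : ∀ y, ‖Complex.exp (-(Complex.I * (θ y : ℂ))) * (l * q y * (jostMinus q l y).2)‖
      ≤ ‖l‖ * (4 * E ^ 3 * ‖l‖) * ‖q y‖ := fun y => by
    rw [norm_mul, ne, one_mul, norm_mul, norm_mul]
    have := mul_le_mul_of_nonneg_left (h2 y) (by positivity : 0 ≤ ‖l‖ * ‖q y‖)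
    linarith
  have hint : Integrable fun y =>
      Complex.exp (-(Complex.I * (θ y : ℂ))) * (l * q y * (jostMinus q l y).2) := by
    have := hq.cont
    exact (hq.i1.const_mul _).mono' (Continuous.aestronglyMeasurable (by fun_prop))
      (Eventually.of_forall hbd)
  have hlim : Tendsto (fun x => Complex.exp (-(Complex.I * (θ x : ℂ))) * (jostMinus q l x).1) atBot
      (𝓝 1) := by
    have a := tendsto_integral_Iic_atBot hi4
    have b : Tendsto (fun x => Complex.exp (-(Complex.I * (θ x : ℂ)))) atBot (𝓝 1) := by
      have := (Continuous.tendsto (f := fun t : ℝ => Complex.exp (-(Complex.I * (t : ℂ))))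
        (by fun_prop) 0).comp a
      rw [Complex.ofReal_zero, mul_zero, neg_zero, Complex.exp_zero] at this
      exact this
    have c := (continuous_fst.tendsto ((1, 0) : ℂ × ℂ)).comp (tendsto_jostMinus hq hl)
    simpa using b.mul c
  have hF := integral_Iic_of_hasDerivAt_of_tendsto' (a := x) (fun y _ => dψ y)
    hint.integrableOn hlim
  have hn : ‖∫ y in Iic x, Complex.exp (-(Complex.I * (θ y : ℂ))) *
      (l * q y * (jostMinus q l y).2)‖ ≤ 4 * E ^ 4 * ‖l‖ ^ 2 := by
    refine (norm_integral_le_of_norm_le (hq.i1.const_mul _).integrableOn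
      (Eventually.of_forall hbd)).trans ?_
    rw [integral_const_mul]
    have h3 : ∫ y in Iic x, ‖q y‖ ≤ E :=
      (integral_Iic_le hq.i1 (fun _ => norm_nonneg _) x).trans (integral_norm_le_expBound hq)
    have := mul_le_mul_of_nonneg_left h3 (by positivity : 0 ≤ ‖l‖ * (4 * E ^ 3 * ‖l‖))
    nlinarith
  rw [hF] at hn
  have h4 : ‖Complex.exp (-(Complex.I * (θ x : ℂ))) * (jostMinus q l x).1‖
      = ‖(jostMinus q l x).1‖ := by rw [norm_mul, ne, one_mul]
  rw [← h4]
  have := norm_sub_norm_le (1 : ℂ)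
    (Complex.exp (-(Complex.I * (θ x : ℂ))) * (jostMinus q l x).1)
  rw [norm_one, norm_sub_rev] at this
  linarith

/-- The smallness condition makes both first components at least 7/8 and both second components at
most 1/2 in modulus, and 49/64 - 1/4 > 1/2. -/
theorem norm_scatA_ge_of_small (hq : Pot q) (hl : 0 ≤ (l ^ 2).im)
    (h1 : 8 * expBound q 1 ^ 4 * ‖l‖ ≤ 1) : 1 / 2 ≤ ‖scatA q l‖ := by
  set E := expBound q 1 with hE
  have hE1 : 1 ≤ E := one_le_expBound q 1
  have hEr : expBound (reflect q) 1 = E := expBound_reflect q 1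
  have hE4 : 1 ≤ E ^ 4 := one_le_pow₀ hE1
  have hl1 : ‖l‖ ≤ 1 := by nlinarith [norm_nonneg l]
  have a1 := norm_jostMinus_fst_ge hq hl hl1 0
  have a2 := norm_jostMinus_snd_le hq hl hl1 0
  have b1 := norm_jostMinus_fst_ge hq.reflect hl hl1 0
  have b2 := norm_jostMinus_snd_le hq.reflect hl hl1 0
  rw [hEr] at b1 b2
  rw [← hE] at a1 a2
  rw [scatA_eq hq hl]
  have hs : E ^ 4 * ‖l‖ ^ 2 ≤ 1 / 64 := by
    have h5 : (8 * E ^ 4 * ‖l‖) ^ 2 ≤ 1 := pow_le_one₀ (by positivity) h1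
    have : E ^ 4 * ‖l‖ ^ 2 ≤ E ^ 4 * (E ^ 4 * ‖l‖ ^ 2) :=
      le_mul_of_one_le_left (by positivity) hE4
    nlinarith
  have hs3 : E ^ 3 * ‖l‖ ≤ 1 / 8 := by
    have : E ^ 3 ≤ E ^ 4 := pow_le_pow_right₀ hE1 (by norm_num)
    nlinarith [norm_nonneg l]
  have h6 : (7 / 8 : ℝ) ≤ ‖(jostMinus q l 0).1‖ := by linarith
  have h7 : (7 / 8 : ℝ) ≤ ‖(jostMinus (DNLSII.reflect q) l 0).1‖ := by linarith
  have h8 : ‖(jostMinus q l 0).2‖ ≤ 1 / 2 := by linarith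
  have h9 : ‖(jostMinus (DNLSII.reflect q) l 0).2‖ ≤ 1 / 2 := by linarith
  have t := norm_sub_norm_le ((jostMinus q l 0).1 * (jostMinus (DNLSII.reflect q) l 0).1)
    ((jostMinus q l 0).2 * (jostMinus (DNLSII.reflect q) l 0).2)
  rw [norm_mul, norm_mul] at t
  have u1 := mul_le_mul h6 h7 (by norm_num) (norm_nonneg _)
  have u2 := mul_le_mul h8 h9 (norm_nonneg _) (by norm_num)
  linarith

end SmallParameter


/-! ### A Harnack inequality for zero free holomorphic functions -/

/-- Without zeros, a/A is the exponential of a holomorphic g with Re g ≤ 0. Borel-Carathéodory then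
bounds |g| on the half disc by |g| at the centre. There |ζ| ≤ r/2 gives 2|ζ|/(r - |ζ|) ≤ 2 and (r +
|ζ|)/(r - |ζ|) ≤ 3, which are the constants 2 and 3. -/
theorem norm_ge_of_ball {a : ℂ → ℂ} {c z : ℂ} {r A δ : ℝ} (hr : 0 < r) (hA : 0 < A) (hδ : 0 < δ)
    (hd : DifferentiableOn ℂ a (Metric.ball c r)) (hne : ∀ z ∈ Metric.ball c r, a z ≠ 0)
    (hb : ∀ z ∈ Metric.ball c r, ‖a z‖ ≤ A) (hc : δ ≤ ‖a c‖) (hz : dist z c ≤ r / 2) :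
    A * Real.exp (-(2 + 3 * (|Real.log (δ / A)| + Real.pi))) ≤ ‖a z‖ := by
  set f : ℂ → ℂ := fun ζ => a (c + ζ) / A with hf
  have hmem : ∀ ζ ∈ Metric.ball (0 : ℂ) r, c + ζ ∈ Metric.ball c r := fun ζ hζ => by
    simpa [Metric.mem_ball, dist_eq_norm] using hζ
  have hfd : DifferentiableOn ℂ f (Metric.ball 0 r) :=
    (hd.comp (by fun_prop) hmem).div_const _
  have hA' : (A : ℂ) ≠ 0 := Complex.ofReal_ne_zero.2 hA.ne'
  have hf0 : ∀ ζ ∈ Metric.ball (0 : ℂ) r, f ζ ≠ 0 := fun ζ hζ => div_ne_zero (hne _ (hmem ζ hζ)) hA'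
  have h00 : (0 : ℂ) ∈ Metric.ball (0 : ℂ) r := Metric.mem_ball_self hr
  have hlog : DifferentiableOn ℂ (fun ζ => deriv f ζ / f ζ) (Metric.ball 0 r) :=
    (hfd.deriv Metric.isOpen_ball).div hfd hf0
  obtain ⟨g, hg0, hg⟩ := hlog.isExactOn_ball.with_val_at 0 (Complex.log (f 0))
  have hfg : ∀ ζ ∈ Metric.ball (0 : ℂ) r, f ζ = Complex.exp (g ζ) := by
    have hder : ∀ ζ ∈ Metric.ball (0 : ℂ) r, HasDerivAt (fun ζ => f ζ * Complex.exp (-g ζ)) 0 ζ := by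
      intro ζ hζ
      have h1 := (hfd.differentiableAt (Metric.isOpen_ball.mem_nhds hζ)).hasDerivAt
      refine (h1.mul (hg ζ hζ).neg.cexp).congr_deriv ?_
      have := hf0 ζ hζ
      field_simp
      ring
    intro ζ hζ
    have hconst := IsOpen.is_const_of_deriv_eq_zero Metric.isOpen_ball
      (convex_ball (0 : ℂ) r).isPreconnected
      (fun x hx => (hder x hx).differentiableAt.differentiableWithinAt)
      (fun x hx => (hder x hx).deriv) hζ h00
    rw [hg0, Complex.exp_neg, Complex.exp_neg, Complex.exp_log (hf0 0 h00),
      mul_inv_cancel₀ (hf0 0 h00)] at hconst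
    field_simp at hconst
    exact hconst
  have hgd : DifferentiableOn ℂ g (Metric.ball 0 r) := fun ζ hζ =>
    (hg ζ hζ).differentiableAt.differentiableWithinAt
  have hnf : ∀ ζ, ‖f ζ‖ = ‖a (c + ζ)‖ / A := fun ζ => by
    simp only [hf, norm_div, Complex.norm_real, Real.norm_of_nonneg hA.le]
  -- The true bound Re g ≤ 0 is relaxed to 1, since Borel-Carathéodory is applied with a positive
  -- upper bound.
  have hre : MapsTo g (Metric.ball 0 r) {z | z.re ≤ 1} := by
    intro ζ hζ
    have h1 : ‖f ζ‖ ≤ 1 := by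
      rw [hnf, div_le_one hA]; exact hb _ (hmem ζ hζ)
    rw [hfg ζ hζ, Complex.norm_exp, Real.exp_le_one_iff] at h1
    exact h1.trans zero_le_one
  set ζ := z - c with hζd
  have hζn : ‖ζ‖ ≤ r / 2 := by rwa [dist_eq_norm] at hz
  have hζ : ζ ∈ Metric.ball (0 : ℂ) r := by
    rw [mem_ball_zero_iff]; linarith
  have hbc := Complex.borelCaratheodory one_pos hgd hre hr hζ
  -- At the centre g is the principal logarithm: π bounds its imaginary part, and the lower bound δ
  -- bounds its real part.
  have hg0n : ‖g 0‖ ≤ |Real.log (δ / A)| + Real.pi := by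
    rw [hg0]
    refine (Complex.norm_le_abs_re_add_abs_im _).trans (add_le_add ?_ ?_)
    · rw [Complex.log_re, hnf, add_zero]
      have h1 : δ / A ≤ ‖a c‖ / A := by gcongr
      have h2 : ‖a c‖ / A ≤ 1 := by
        rw [div_le_one hA]; exact hb _ (Metric.mem_ball_self hr)
      have h3 : 0 < δ / A := by positivity
      rw [abs_of_nonpos (Real.log_nonpos (h3.le.trans h1) h2),
        abs_of_nonpos (Real.log_nonpos h3.le (h1.trans h2))]
      exact neg_le_neg (Real.log_le_log h3 h1)
    · rw [Complex.log_im]; exact Complex.abs_arg_le_pi _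
  have hden : 0 < r - ‖ζ‖ := by linarith
  have hgn : ‖g ζ‖ ≤ 2 + 3 * (|Real.log (δ / A)| + Real.pi) := by
    have t1 : 2 * 1 * ‖ζ‖ / (r - ‖ζ‖) ≤ 2 := by
      rw [div_le_iff₀ hden]; linarith
    have t2 : ‖g 0‖ * (r + ‖ζ‖) / (r - ‖ζ‖) ≤ 3 * ‖g 0‖ := by
      rw [div_le_iff₀ hden]
      nlinarith [norm_nonneg (g 0)]
    linarith
  have hz' : ‖a z‖ = A * Real.exp (g ζ).re := by
    have h1 := hnf ζ
    rw [hfg ζ hζ, Complex.norm_exp] at h1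
    have h2 : c + ζ = z := by rw [hζd]; ring
    rw [h2] at h1
    rw [h1]; field_simp
  rw [hz']
  refine mul_le_mul_of_nonneg_left (Real.exp_le_exp.2 ?_) hA.le
  have := Complex.abs_re_le_norm (g ζ)
  have := neg_abs_le (g ζ).re
  linarith

/-- Zero free holomorphic functions in the quadrant, uniformly bounded and bounded from below near
the origin, are bounded from below at each point. -/
theorem exists_lower_bound {l₁ : ℂ} (hl₁ : l₁ ∈ quadrantI) {A r₀ : ℝ} (hA : 0 < A) (hr₀ : 0 < r₀) :
    ∃ d > 0, ∀ a : ℂ → ℂ, DifferentiableOn ℂ a quadrantI → (∀ l ∈ quadrantI, a l ≠ 0) →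
      (∀ l ∈ quadrantI, ‖l‖ ≤ 2 * ‖l₁‖ → ‖a l‖ ≤ A) →
      (∀ l ∈ quadrantI, ‖l‖ ≤ r₀ → 1 / 2 ≤ ‖a l‖) → d ≤ ‖a l₁‖ := by
  have hre : 0 < l₁.re := hl₁.1
  have him : 0 < l₁.im := hl₁.2
  have hn : 0 < ‖l₁‖ := by
    have := Complex.abs_re_le_norm l₁
    rw [abs_of_pos hre] at this
    linarith
  -- ρ is the distance from l₁ to the boundary of the quadrant. The disc of radius sρ about s l₁
  -- stays in the quadrant, and multiplying s by θ moves the point by exactly half that radius.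
  set ρ := min l₁.re l₁.im with hρ
  have hρ0 : 0 < ρ := lt_min hre him
  have hρn : ρ ≤ ‖l₁‖ := (min_le_left _ _).trans ((le_abs_self _).trans (Complex.abs_re_le_norm l₁))
  set θ := 1 + ρ / (2 * ‖l₁‖) with hθ
  have hθ1 : 1 < θ := by rw [hθ]; have : 0 < ρ / (2 * ‖l₁‖) := by positivity
                         linarith
  -- A chain of discs along the ray through l₁: each step extends the reach by the factor θ and
  -- spends one Harnack inequality. The condition t ≤ 1 keeps the discs in ‖z‖ ≤ 2‖l₁‖, where the
  -- bound A is available.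
  have step : ∀ n : ℕ, ∃ d > 0, ∀ a : ℂ → ℂ, DifferentiableOn ℂ a quadrantI →
      (∀ l ∈ quadrantI, a l ≠ 0) → (∀ l ∈ quadrantI, ‖l‖ ≤ 2 * ‖l₁‖ → ‖a l‖ ≤ A) →
      (∀ l ∈ quadrantI, ‖l‖ ≤ r₀ → 1 / 2 ≤ ‖a l‖) → ∀ t : ℝ, 0 < t → t ≤ 1 →
      t ≤ r₀ / ‖l₁‖ * θ ^ n → d ≤ ‖a (t * l₁)‖ := by
    intro n
    induction n with
    | zero =>
      refine ⟨1 / 2, by norm_num, fun a _ _ _ h t ht _ ht2 => h _ ?_ ?_⟩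
      · refine ⟨?_, ?_⟩
        · simpa using mul_pos ht hre
        · simpa using mul_pos ht him
      · rw [pow_zero, mul_one, le_div_iff₀ hn] at ht2
        rwa [norm_mul, Complex.norm_real, Real.norm_of_nonneg ht.le]
    | succ n ih =>
      obtain ⟨d, hd0, hd⟩ := ih
      refine ⟨A * Real.exp (-(2 + 3 * (|Real.log (d / A)| + Real.pi))), by positivity,
        fun a h1 h2 h3 h4 t ht ht1 ht2 => ?_⟩
      set s := t / θ with hs
      have hθ0 : 0 < θ := by linarith
      have hs0 : 0 < s := by positivity
      have hts : t = s * θ := by rw [hs]; field_simp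
      have hst : s ≤ t := by rw [hts]; nlinarith
      have hs1 : s ≤ 1 := hst.trans ht1
      have hs2 : s ≤ r₀ / ‖l₁‖ * θ ^ n := by
        rw [hs, div_le_iff₀ hθ0]
        refine ht2.trans (le_of_eq ?_)
        rw [pow_succ]; ring
      have hball : ∀ z ∈ Metric.ball (s * l₁ : ℂ) (s * ρ), z ∈ quadrantI ∧ ‖z‖ ≤ 2 * ‖l₁‖ := by
        intro z hz
        rw [Metric.mem_ball, dist_eq_norm] at hz
        have a1 := (Complex.abs_re_le_norm (z - s * l₁)).trans_lt hz
        have a2 := (Complex.abs_im_le_norm (z - s * l₁)).trans_lt hz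
        simp only [Complex.sub_re, Complex.sub_im, Complex.re_ofReal_mul, Complex.im_ofReal_mul]
          at a1 a2
        have b1 := (abs_lt.1 a1).1
        have b2 := (abs_lt.1 a2).1
        have c1 : s * ρ ≤ s * l₁.re := mul_le_mul_of_nonneg_left (min_le_left _ _) hs0.le
        have c2 : s * ρ ≤ s * l₁.im := mul_le_mul_of_nonneg_left (min_le_right _ _) hs0.le
        refine ⟨⟨?_, ?_⟩, ?_⟩
        · linarith
        · linarith
        · have e1 := norm_le_norm_add_norm_sub' z (s * l₁)
          rw [norm_mul, Complex.norm_real, Real.norm_of_nonneg hs0.le] at e1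
          nlinarith
      refine norm_ge_of_ball (c := s * l₁) (r := s * ρ) (by positivity) hA hd0
        (h1.mono fun z hz => (hball z hz).1) (fun z hz => h2 z (hball z hz).1)
        (fun z hz => h3 z (hball z hz).1 (hball z hz).2) (hd a h1 h2 h3 h4 s hs0 hs1 hs2) ?_
      rw [dist_eq_norm, ← sub_mul, norm_mul, ← Complex.ofReal_sub, Complex.norm_real,
        Real.norm_of_nonneg (by linarith)]
      have : (t - s) * ‖l₁‖ = s * ρ / 2 := by rw [hts, hθ]; field_simp; ring
      rw [this]
  obtain ⟨n, hn2⟩ := pow_unbounded_of_one_lt (‖l₁‖ / r₀) hθ1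
  obtain ⟨d, hd0, hd⟩ := step n
  refine ⟨d, hd0, fun a h1 h2 h3 h4 => ?_⟩
  have := hd a h1 h2 h3 h4 1 one_pos le_rfl (by
    rw [div_lt_iff₀ hr₀] at hn2
    rw [div_mul_eq_mul_div, le_div_iff₀ hn]
    linarith)
  simpa using this


/-! ### The Darboux matrix -/

section Algebra

variable {l k f fb g gb q qb J F G I kb M Mb a ab A A1 f' fb' g' gb' M' Mb' q1 F' G' h : ℂ}

-- Conjugates enter as independent variables, so after multiplication by 2 M Mb the claim is a
-- polynomial identity modulo the equations for h, A1 and q1. Here h is the logarithmic derivative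
-- of |M|, coming from the normalization by 1/|M|. The variable I is not required to square to -1,
-- so I ↦ -I is an admissible substitution and one identity serves both components.
set_option maxRecDepth 4000 in
theorem darboux_identity (hM : M = k * f * fb + kb * g * gb) (hMb : Mb = kb * f * fb + k * g * gb)
    (h0 : M ≠ 0) (h0b : Mb ≠ 0) (ha : a = -(I * k ^ 2) + J) (hab : ab = I * kb ^ 2 - J)
    (hA : A = -(I * l ^ 2) + J)
    (hA1 : A1 = -(I * l ^ 2) + (J + (k ^ 2 - kb ^ 2) / 2 * (fb * g * q / M + f * gb * qb / Mb)
      - I * (k ^ 2 - kb ^ 2) ^ 2 * (f * fb * g * gb) / (M * Mb)))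
    (hq1 : q1 = Mb / M * q - 2 * I * ((k ^ 2 - kb ^ 2) * f * gb / M))
    (hf : f' = a * f + k * q * g) (hg : g' = -(k * qb) * f - a * g)
    (hfb : fb' = ab * fb + kb * qb * gb) (hgb : gb' = -(kb * q) * fb - ab * gb)
    (hM' : M' = k * (f' * fb + f * fb') + kb * (g' * gb + g * gb'))
    (hMb' : Mb' = kb * (f' * fb + f * fb') + k * (g' * gb + g * gb'))
    (hh : h = (M' * Mb + M * Mb') / (2 * (M * Mb)))
    (hF : F' = A * F + l * q * G) (hG : G' = -(l * qb) * F - A * G) :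
    -h * ((Mb * l ^ 2 - k * kb * M) * F - l * (k ^ 2 - kb ^ 2) * f * gb * G) +
      ((Mb' * l ^ 2 - k * kb * M') * F + (Mb * l ^ 2 - k * kb * M) * F'
        - l * (k ^ 2 - kb ^ 2) * (f' * gb + f * gb') * G - l * (k ^ 2 - kb ^ 2) * f * gb * G') =
    A1 * ((Mb * l ^ 2 - k * kb * M) * F - l * (k ^ 2 - kb ^ 2) * f * gb * G)
      + l * q1 * (-(l * (k ^ 2 - kb ^ 2) * fb * g * F) + (M * l ^ 2 - k * kb * Mb) * G) := by
  have h2 : h * (2 * (M * Mb)) = M' * Mb + M * Mb' := by rw [hh]; field_simp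
  have h3 : (A1 + I * l ^ 2 - J) * (2 * (M * Mb)) =
      (k ^ 2 - kb ^ 2) * (fb * g * q * Mb + f * gb * qb * M)
        - 2 * I * (k ^ 2 - kb ^ 2) ^ 2 * (f * fb * g * gb) := by rw [hA1]; field_simp; ring
  have h4 : q1 * M = Mb * q - 2 * I * ((k ^ 2 - kb ^ 2) * f * gb) := by rw [hq1]; field_simp
  have h5 : (2 * (M * Mb)) ≠ 0 := mul_ne_zero two_ne_zero (mul_ne_zero h0 h0b)
  apply mul_right_cancel₀ h5
  clear hh hA1 hq1 h5
  subst hF hG hMb' hM' hgb hfb hg hf hA hab ha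
  clear h0 h0b
  subst hM hMb
  linear_combination (exp := 1)
    -((((kb * f * fb + k * g * gb) * l ^ 2 - k * kb * (k * f * fb + kb * g * gb)) * F
        - l * (k ^ 2 - kb ^ 2) * f * gb * G)) * h2
    - (((kb * f * fb + k * g * gb) * l ^ 2 - k * kb * (k * f * fb + kb * g * gb)) * F
        - l * (k ^ 2 - kb ^ 2) * f * gb * G) * h3
    - 2 * (kb * f * fb + k * g * gb) * l * (-(l * (k ^ 2 - kb ^ 2) * fb * g * F)
        + ((k * f * fb + kb * g * gb) * l ^ 2 - k * kb * (kb * f * fb + k * g * gb)) * G) * h4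

/-- The same elimination as for the Darboux matrix, again with conjugates and I as free variables so
that it covers both components. -/
theorem inverse_identity (hM : M = k * f * fb + kb * g * gb) (hMb : Mb = kb * f * fb + k * g * gb)
    (h0 : M ≠ 0) (h0b : Mb ≠ 0) (ha : a = -(I * k ^ 2) + J) (hab : ab = I * kb ^ 2 - J)
    (hA1 : A1 = -(I * k ^ 2) + (J + (k ^ 2 - kb ^ 2) / 2 * (fb * g * q / M + f * gb * qb / Mb)
      - I * (k ^ 2 - kb ^ 2) ^ 2 * (f * fb * g * gb) / (M * Mb)))
    (hq1 : q1 = Mb / M * q - 2 * I * ((k ^ 2 - kb ^ 2) * f * gb / M))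
    (hf : f' = a * f + k * q * g) (hg : g' = -(k * qb) * f - a * g)
    (hfb : fb' = ab * fb + kb * qb * gb) (hgb : gb' = -(kb * q) * fb - ab * gb)
    (hM' : M' = k * (f' * fb + f * fb') + kb * (g' * gb + g * gb'))
    (hMb' : Mb' = kb * (f' * fb + f * fb') + k * (g' * gb + g * gb'))
    (hh : h = (M' * Mb + M * Mb') / (2 * (M * Mb))) :
    -h * gb + gb' = A1 * gb - k * q1 * fb := by
  have h2 : h * (2 * (M * Mb)) = M' * Mb + M * Mb' := by rw [hh]; field_simp
  have h3 : (A1 + I * k ^ 2 - J) * (2 * (M * Mb)) =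
      (k ^ 2 - kb ^ 2) * (fb * g * q * Mb + f * gb * qb * M)
        - 2 * I * (k ^ 2 - kb ^ 2) ^ 2 * (f * fb * g * gb) := by rw [hA1]; field_simp; ring
  have h4 : q1 * M = Mb * q - 2 * I * ((k ^ 2 - kb ^ 2) * f * gb) := by rw [hq1]; field_simp
  have h5 : (2 * (M * Mb)) ≠ 0 := mul_ne_zero two_ne_zero (mul_ne_zero h0 h0b)
  apply mul_right_cancel₀ h5
  clear hh hA1 hq1 h5
  subst hMb' hM' hgb hfb hg hf hab ha
  clear h0 h0b
  subst hM hMb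
  linear_combination (exp := 1) -gb * h2 - gb * h3
    + 2 * (kb * f * fb + k * g * gb) * k * fb * h4

/-- The expansion of (i/4)|q₁|². The two sides differ by a multiple of I² + 1, and this is the place
where I² = -1 enters. -/
theorem diag_identity (h0 : M ≠ 0) (h0b : Mb ≠ 0) (hI : I ^ 2 = -1) :
    I / 4 * ((Mb / M * q - 2 * I * ((k ^ 2 - kb ^ 2) * f * gb / M)) *
      (M / Mb * qb - 2 * I * ((k ^ 2 - kb ^ 2) * fb * g / Mb)))
    = I / 4 * (q * qb) + (k ^ 2 - kb ^ 2) / 2 * (fb * g * q / M + f * gb * qb / Mb)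
      - I * (k ^ 2 - kb ^ 2) ^ 2 * (f * fb * g * gb) / (M * Mb) := by
  rw [← sub_eq_zero]
  have : I / 4 * ((Mb / M * q - 2 * I * ((k ^ 2 - kb ^ 2) * f * gb / M)) *
      (M / Mb * qb - 2 * I * ((k ^ 2 - kb ^ 2) * fb * g / Mb)))
    - (I / 4 * (q * qb) + (k ^ 2 - kb ^ 2) / 2 * (fb * g * q / M + f * gb * qb / Mb)
      - I * (k ^ 2 - kb ^ 2) ^ 2 * (f * fb * g * gb) / (M * Mb))
      = (I * (k ^ 2 - kb ^ 2) ^ 2 * (f * fb * g * gb) / (M * Mb)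
        - (k ^ 2 - kb ^ 2) / 2 * (fb * g * q / M + f * gb * qb / Mb)) * (I ^ 2 + 1) := by
    field_simp
    ring
  rw [this, hI]; ring

end Algebra

/-- The logarithmic derivative of |M| is written through M and its conjugate in order to match h in
`darboux_identity`. -/
theorem hasDerivAt_norm_inv {M : ℝ → ℂ} {M' : ℂ} {x : ℝ} (h : HasDerivAt M M' x) (h0 : M x ≠ 0) :
    HasDerivAt (fun x => ((‖M x‖ : ℝ) : ℂ)⁻¹)
      (-((M' * conj (M x) + M x * conj M') / (2 * (M x * conj (M x))))
        * ((‖M x‖ : ℝ) : ℂ)⁻¹) x := by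
  have hn : ‖M x‖ ≠ 0 := norm_ne_zero_iff.2 h0
  have h1 : HasDerivAt (fun x => ‖M x‖) (2 * inner ℝ (M x) M' / (2 * ‖M x‖)) x := by
    have := h.norm_sq.sqrt (pow_ne_zero 2 hn)
    simpa [Real.sqrt_sq] using this
  have h2 := (h1.ofReal_comp).inv (Complex.ofReal_ne_zero.2 hn)
  refine h2.congr_deriv ?_
  have e1 : ((2 * inner ℝ (M x) M' : ℝ) : ℂ) = M' * conj (M x) + M x * conj M' := by
    have : M x * conj M' = conj (M' * conj (M x)) := by simp [mul_comm]
    rw [this, Complex.add_conj, Complex.inner]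
  have e2 : M x * conj (M x) = ((‖M x‖ : ℝ) : ℂ) ^ 2 := Complex.mul_conj' _
  have hn' : ((‖M x‖ : ℝ) : ℂ) ≠ 0 := Complex.ofReal_ne_zero.2 hn
  rw [Complex.ofReal_div, e1, e2]
  push_cast
  field_simp

theorem m_conj (l : ℂ) (v : ℂ × ℂ) : m (conj l) v v = conj (m l v v) := by
  simp only [m, map_add, map_mul, Complex.conj_conj]; ring

/-- The coefficients l and l̄ have equal real part. This makes m coercive for Re l > 0, and every
division by m relies on it. -/
theorem re_m (l : ℂ) (v : ℂ × ℂ) : (m l v v).re = l.re * (‖v.1‖ ^ 2 + ‖v.2‖ ^ 2) := by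
  have h1 : m l v v = l * ((‖v.1‖ ^ 2 : ℝ) : ℂ) + conj l * ((‖v.2‖ ^ 2 : ℝ) : ℂ) := by
    simp only [m, mul_assoc, Complex.mul_conj']; push_cast; ring
  rw [h1, Complex.add_re, Complex.re_mul_ofReal, Complex.re_mul_ofReal, Complex.conj_re]; ring

theorem norm_m_ge (l : ℂ) (v : ℂ × ℂ) :
    l.re * (‖v.1‖ ^ 2 + ‖v.2‖ ^ 2) ≤ ‖m l v v‖ := by
  rw [← re_m]; exact Complex.re_le_norm _

theorem m_ne_zero {l : ℂ} (hl : 0 < l.re) {v : ℂ × ℂ} (hv : v ≠ 0) : m l v v ≠ 0 := by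
  intro h
  have h1 := norm_m_ge l v
  rw [h, norm_zero] at h1
  have h2 : ‖v.1‖ ^ 2 + ‖v.2‖ ^ 2 ≤ 0 := by
    by_contra h3
    push Not at h3
    have := mul_pos hl h3
    linarith
  have h3 : ‖v.1‖ = 0 := by nlinarith [sq_nonneg ‖v.1‖, sq_nonneg ‖v.2‖, norm_nonneg v.1]
  have h4 : ‖v.2‖ = 0 := by nlinarith [sq_nonneg ‖v.1‖, sq_nonneg ‖v.2‖, norm_nonneg v.2]
  exact hv (Prod.ext (norm_eq_zero.1 h3) (norm_eq_zero.1 h4))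

theorem m_smul (l c : ℂ) (v : ℂ × ℂ) : m l (c • v) (c • v) = c * conj c * m l v v := by
  simp only [m, Prod.smul_fst, Prod.smul_snd, smul_eq_mul, map_mul]; ring

/-- The Darboux matrix at the spectral parameter `l`, built from the vector `v` at the parameter
`k`, applied to the vector `F`. -/
noncomputable def darbouxMat (k l : ℂ) (v F : ℂ × ℂ) : ℂ × ℂ :=
  (((‖m k v v‖ : ℝ) : ℂ)⁻¹ * ((conj (m k v v) * l ^ 2 - k * conj k * m k v v) * F.1
      - l * (k ^ 2 - conj k ^ 2) * v.1 * conj v.2 * F.2),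
    ((‖m k v v‖ : ℝ) : ℂ)⁻¹ * (-(l * (k ^ 2 - conj k ^ 2) * conj v.1 * v.2 * F.1)
      + (m k v v * l ^ 2 - k * conj k * conj (m k v v)) * F.2))

/-! ### The Darboux matrix acting on solutions -/

section Darboux

variable {q : ℝ → ℂ} {k l : ℂ} {Φ F : ℝ → ℂ × ℂ}

theorem conj_div_m (k : ℂ) (v : ℂ × ℂ) (z : ℂ) :
    conj (coeffC k v * z - 2 * Complex.I * coeffD k v)
      = m k v v / conj (m k v v) * conj z
        - 2 * Complex.I * ((k ^ 2 - conj k ^ 2) * conj v.1 * v.2 / conj (m k v v)) := by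
  simp only [coeffC, coeffD, m_conj, map_sub, map_mul, map_div₀, Complex.conj_conj, map_pow,
    Complex.conj_I, map_ofNat]
  ring

theorem darboux_apply (k : ℂ) (x : ℝ) : darboux Φ k q x
    = conj (m k (Φ x) (Φ x)) / m k (Φ x) (Φ x) * q x
      - 2 * Complex.I * ((k ^ 2 - conj k ^ 2) * (Φ x).1 * conj (Φ x).2 / m k (Φ x) (Φ x)) := by
  simp only [darboux, coeffC, coeffD, m_conj]

theorem conj_darboux_apply (k : ℂ) (x : ℝ) : conj (darboux Φ k q x)
    = m k (Φ x) (Φ x) / conj (m k (Φ x) (Φ x)) * conj (q x)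
      - 2 * Complex.I * ((k ^ 2 - conj k ^ 2) * conj (Φ x).1 * (Φ x).2
        / conj (m k (Φ x) (Φ x))) := conj_div_m k (Φ x) (q x)

theorem diagCoeff_darboux (hk : 0 < k.re) {x : ℝ} (h0 : Φ x ≠ 0) (l : ℂ) :
    diagCoeff (darboux Φ k q) l x = -(Complex.I * l ^ 2) + (Complex.I / 4 * (q x * conj (q x))
      + (k ^ 2 - conj k ^ 2) / 2 * (conj (Φ x).1 * (Φ x).2 * q x / m k (Φ x) (Φ x)
        + (Φ x).1 * conj (Φ x).2 * conj (q x) / conj (m k (Φ x) (Φ x)))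
      - Complex.I * (k ^ 2 - conj k ^ 2) ^ 2 * ((Φ x).1 * conj (Φ x).1 * (Φ x).2 * conj (Φ x).2)
        / (m k (Φ x) (Φ x) * conj (m k (Φ x) (Φ x)))) := by
  have hm := m_ne_zero hk h0
  have hmb : conj (m k (Φ x) (Φ x)) ≠ 0 := (map_ne_zero _).2 hm
  unfold diagCoeff
  rw [conj_darboux_apply, darboux_apply]
  congr 1
  exact diag_identity hm hmb Complex.I_sq

theorem hasDerivAt_conj {f : ℝ → ℂ} {f' : ℂ} {x : ℝ} (h : HasDerivAt f f' x) :
    HasDerivAt (fun x => conj (f x)) (conj f') x := h.star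

theorem hasDerivAt_m {f' g' : ℂ} {x : ℝ} (hf : HasDerivAt (fun x => (Φ x).1) f' x)
    (hg : HasDerivAt (fun x => (Φ x).2) g' x) (k : ℂ) :
    HasDerivAt (fun x => m k (Φ x) (Φ x)) (k * (f' * conj (Φ x).1 + (Φ x).1 * conj f')
      + conj k * (g' * conj (Φ x).2 + (Φ x).2 * conj g')) x := by
  have h1 := (hf.mul (hasDerivAt_conj hf)).const_mul k
  have h2 := (hg.mul (hasDerivAt_conj hg)).const_mul (conj k)
  refine (h1.add h2).congr_of_eventuallyEq (Eventually.of_forall fun y => ?_)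
  simp only [m, Pi.add_apply, Pi.mul_apply]; ring

theorem conj_diagCoeff (q : ℝ → ℂ) (k : ℂ) (x : ℝ) : conj (diagCoeff q k x)
    = Complex.I * conj k ^ 2 - Complex.I / 4 * (q x * conj (q x)) := by
  simp only [diagCoeff, map_add, map_neg, map_mul, map_div₀, Complex.conj_I, Complex.conj_conj,
    map_pow, map_ofNat]
  ring

/-- The Darboux matrix maps solutions to solutions for the transformed potential. -/
theorem IsSol.darbouxMat (hk : 0 < k.re) (hΦ : IsSol q k Φ) (h0 : ∀ x, Φ x ≠ 0)
    (hF : IsSol q l F) :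
    IsSol (darboux Φ k q) l (fun x => darbouxMat k l (Φ x) (F x)) := by
  have aux : ∀ x, ∃ f' g' : ℂ, HasDerivAt (fun x => (Φ x).1) f' x ∧
      HasDerivAt (fun x => (Φ x).2) g' x ∧
      f' = diagCoeff q k x * (Φ x).1 + k * q x * (Φ x).2 ∧
      g' = -(k * conj (q x)) * (Φ x).1 - diagCoeff q k x * (Φ x).2 := fun x =>
    ⟨_, _, hΦ.1 x, hΦ.2 x, rfl, rfl⟩
  refine ⟨fun x => ?_, fun x => ?_⟩
  · obtain ⟨f', g', df, dg, hf', hg'⟩ := aux x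
    have hm := m_ne_zero hk (h0 x)
    have hmb : conj (m k (Φ x) (Φ x)) ≠ 0 := (map_ne_zero _).2 hm
    have dm := hasDerivAt_m df dg k
    have d := (hasDerivAt_norm_inv dm hm).mul
      ((((((hasDerivAt_conj dm).mul_const (l ^ 2)).sub (dm.const_mul (k * conj k))).mul
        (hF.1 x))).sub (((df.const_mul (l * (k ^ 2 - conj k ^ 2))).mul
          (hasDerivAt_conj dg)).mul (hF.2 x)))
    refine d.congr_deriv ?_
    have id := darboux_identity (l := l) (I := Complex.I) (k := k) (kb := conj k) (f := (Φ x).1)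
      (fb := conj (Φ x).1) (g := (Φ x).2) (gb := conj (Φ x).2) (q := q x) (qb := conj (q x))
      (J := Complex.I / 4 * (q x * conj (q x))) (F := (F x).1) (G := (F x).2)
      (M := m k (Φ x) (Φ x)) (Mb := conj (m k (Φ x) (Φ x)))
      (by simp only [m]) (by rw [← m_conj]; simp only [m, Complex.conj_conj]) hm hmb
      (a := diagCoeff q k x) (ab := conj (diagCoeff q k x)) rfl (conj_diagCoeff q k x)
      (A := diagCoeff q l x) rfl (diagCoeff_darboux hk (h0 x) l) (darboux_apply k x) hf' hg'
      (fb' := conj f') (by rw [hf']; simp) (gb' := conj g') (by rw [hg']; simp) rfl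
      (Mb' := conj (k * (f' * conj (Φ x).1 + (Φ x).1 * conj f')
        + conj k * (g' * conj (Φ x).2 + (Φ x).2 * conj g')))
      (by simp only [map_add, map_mul, Complex.conj_conj]; ring) rfl rfl rfl
    simp only [DNLSII.darbouxMat, Pi.mul_apply, Pi.sub_apply]
    linear_combination ((‖m k (Φ x) (Φ x)‖ : ℝ) : ℂ)⁻¹ * id
  · obtain ⟨f', g', df, dg, hf', hg'⟩ := aux x
    have hm := m_ne_zero hk (h0 x)
    have hmb : conj (m k (Φ x) (Φ x)) ≠ 0 := (map_ne_zero _).2 hm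
    have dm := hasDerivAt_m df dg k
    have d := (hasDerivAt_norm_inv dm hm).mul
      (((((hasDerivAt_conj df).const_mul (l * (k ^ 2 - conj k ^ 2))).mul dg).mul (hF.1 x)).neg.add
      ((((dm.mul_const (l ^ 2)).sub ((hasDerivAt_conj dm).const_mul (k * conj k))).mul (hF.2 x))))
    refine d.congr_deriv ?_
    -- The second component follows from the identity for the first under f ↔ g, M ↔ M̄, q ↦ -q̄ and
    -- i ↦ -i.
    have id := darboux_identity (l := l) (I := -Complex.I) (k := k) (kb := conj k) (f := (Φ x).2)
      (fb := conj (Φ x).2) (g := (Φ x).1) (gb := conj (Φ x).1) (q := -conj (q x)) (qb := -q x)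
      (J := -(Complex.I / 4 * (q x * conj (q x)))) (F := (F x).2) (G := (F x).1)
      (M := conj (m k (Φ x) (Φ x))) (Mb := m k (Φ x) (Φ x))
      (by rw [← m_conj]; simp only [m, Complex.conj_conj]; ring) (by simp only [m]; ring) hmb hm
      (a := -diagCoeff q k x) (ab := -conj (diagCoeff q k x))
      (by simp only [diagCoeff]; ring) (by rw [conj_diagCoeff]; ring)
      (A := -diagCoeff q l x) (by simp only [diagCoeff]; ring)
      (A1 := -diagCoeff (darboux Φ k q) l x) (by rw [diagCoeff_darboux hk (h0 x) l]; ring)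
      (q1 := -conj (darboux Φ k q x)) (by rw [conj_darboux_apply]; ring)
      (f' := g') (by rw [hg']; ring) (g' := f') (by rw [hf']; ring)
      (fb' := conj g') (by rw [hg']; simp; ring) (gb' := conj f') (by rw [hf']; simp; ring)
      (M' := conj (k * (f' * conj (Φ x).1 + (Φ x).1 * conj f')
        + conj k * (g' * conj (Φ x).2 + (Φ x).2 * conj g')))
      (by simp only [map_add, map_mul, Complex.conj_conj]; ring)
      (Mb' := k * (f' * conj (Φ x).1 + (Φ x).1 * conj f')
        + conj k * (g' * conj (Φ x).2 + (Φ x).2 * conj g')) (by ring)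
      (h := ((k * (f' * conj (Φ x).1 + (Φ x).1 * conj f')
        + conj k * (g' * conj (Φ x).2 + (Φ x).2 * conj g')) * conj (m k (Φ x) (Φ x))
        + m k (Φ x) (Φ x) * conj (k * (f' * conj (Φ x).1 + (Φ x).1 * conj f')
        + conj k * (g' * conj (Φ x).2 + (Φ x).2 * conj g'))) /
        (2 * (m k (Φ x) (Φ x) * conj (m k (Φ x) (Φ x))))) (by congr 1 <;> ring)
      (F' := -(l * conj (q x)) * (F x).1 - diagCoeff q l x * (F x).2) (by ring)
      (G' := diagCoeff q l x * (F x).1 + l * q x * (F x).2) (by ring)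
    simp only [DNLSII.darbouxMat, Pi.mul_apply, Pi.sub_apply, Pi.add_apply, Pi.neg_apply]
    linear_combination ((‖m k (Φ x) (Φ x)‖ : ℝ) : ℂ)⁻¹ * id

/-- The vector that inverts the Darboux transformation solves the transformed problem. -/
theorem IsSol.inverseVector (hk : 0 < k.re) (hΦ : IsSol q k Φ) (h0 : ∀ x, Φ x ≠ 0) :
    IsSol (darboux Φ k q) k (inverseVector Φ k) := by
  have aux : ∀ x, ∃ f' g' : ℂ, HasDerivAt (fun x => (Φ x).1) f' x ∧
      HasDerivAt (fun x => (Φ x).2) g' x ∧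
      f' = diagCoeff q k x * (Φ x).1 + k * q x * (Φ x).2 ∧
      g' = -(k * conj (q x)) * (Φ x).1 - diagCoeff q k x * (Φ x).2 := fun x =>
    ⟨_, _, hΦ.1 x, hΦ.2 x, rfl, rfl⟩
  refine ⟨fun x => ?_, fun x => ?_⟩
  · obtain ⟨f', g', df, dg, hf', hg'⟩ := aux x
    have hm := m_ne_zero hk (h0 x)
    have hmb : conj (m k (Φ x) (Φ x)) ≠ 0 := (map_ne_zero _).2 hm
    have dm := hasDerivAt_m df dg k
    have d := (hasDerivAt_norm_inv dm hm).mul (hasDerivAt_conj dg)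
    refine d.congr_deriv ?_
    have id := inverse_identity (I := Complex.I) (k := k) (kb := conj k) (f := (Φ x).1)
      (fb := conj (Φ x).1) (g := (Φ x).2) (gb := conj (Φ x).2) (q := q x) (qb := conj (q x))
      (J := Complex.I / 4 * (q x * conj (q x)))
      (M := m k (Φ x) (Φ x)) (Mb := conj (m k (Φ x) (Φ x)))
      (by simp only [m]) (by rw [← m_conj]; simp only [m, Complex.conj_conj]) hm hmb
      (a := diagCoeff q k x) (ab := conj (diagCoeff q k x)) rfl (conj_diagCoeff q k x)
      (diagCoeff_darboux hk (h0 x) k) (darboux_apply k x) hf' hg'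
      (fb' := conj f') (by rw [hf']; simp) (gb' := conj g') (by rw [hg']; simp) rfl
      (Mb' := conj (k * (f' * conj (Φ x).1 + (Φ x).1 * conj f')
        + conj k * (g' * conj (Φ x).2 + (Φ x).2 * conj g')))
      (by simp only [map_add, map_mul, Complex.conj_conj]; ring) rfl
    simp only [DNLSII.inverseVector, Prod.smul_fst, Prod.smul_snd, smul_eq_mul]
    linear_combination ((‖m k (Φ x) (Φ x)‖ : ℝ) : ℂ)⁻¹ * id
  · obtain ⟨f', g', df, dg, hf', hg'⟩ := aux x
    have hm := m_ne_zero hk (h0 x)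
    have hmb : conj (m k (Φ x) (Φ x)) ≠ 0 := (map_ne_zero _).2 hm
    have dm := hasDerivAt_m df dg k
    have d := (hasDerivAt_norm_inv dm hm).mul (hasDerivAt_conj df).neg
    refine d.congr_deriv ?_
    -- The same exchange of roles; the second entry of the vector is -f̄, hence the opposite sign in
    -- the final combination.
    have id := inverse_identity (I := -Complex.I) (k := k) (kb := conj k) (f := (Φ x).2)
      (fb := conj (Φ x).2) (g := (Φ x).1) (gb := conj (Φ x).1) (q := -conj (q x)) (qb := -q x)
      (J := -(Complex.I / 4 * (q x * conj (q x))))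
      (M := conj (m k (Φ x) (Φ x))) (Mb := m k (Φ x) (Φ x))
      (by rw [← m_conj]; simp only [m, Complex.conj_conj]; ring) (by simp only [m]; ring) hmb hm
      (a := -diagCoeff q k x) (ab := -conj (diagCoeff q k x))
      (by simp only [diagCoeff]; ring) (by rw [conj_diagCoeff]; ring)
      (A1 := -diagCoeff (darboux Φ k q) k x) (by rw [diagCoeff_darboux hk (h0 x) k]; ring)
      (q1 := -conj (darboux Φ k q x)) (by rw [conj_darboux_apply]; ring)
      (f' := g') (by rw [hg']; ring) (g' := f') (by rw [hf']; ring)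
      (fb' := conj g') (by rw [hg']; simp; ring) (gb' := conj f') (by rw [hf']; simp; ring)
      (M' := conj (k * (f' * conj (Φ x).1 + (Φ x).1 * conj f')
        + conj k * (g' * conj (Φ x).2 + (Φ x).2 * conj g')))
      (by simp only [map_add, map_mul, Complex.conj_conj]; ring)
      (Mb' := k * (f' * conj (Φ x).1 + (Φ x).1 * conj f')
        + conj k * (g' * conj (Φ x).2 + (Φ x).2 * conj g')) (by ring)
      (h := ((k * (f' * conj (Φ x).1 + (Φ x).1 * conj f')
        + conj k * (g' * conj (Φ x).2 + (Φ x).2 * conj g')) * conj (m k (Φ x) (Φ x))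
        + m k (Φ x) (Φ x) * conj (k * (f' * conj (Φ x).1 + (Φ x).1 * conj f')
        + conj k * (g' * conj (Φ x).2 + (Φ x).2 * conj g'))) /
        (2 * (m k (Φ x) (Φ x) * conj (m k (Φ x) (Φ x))))) (by congr 1 <;> ring)
    simp only [DNLSII.inverseVector, Prod.smul_fst, Prod.smul_snd, smul_eq_mul, Pi.neg_apply]
    linear_combination -((‖m k (Φ x) (Φ x)‖ : ℝ) : ℂ)⁻¹ * id

end Darboux


/-! ### Scattering data of the transformed potential -/

section MatrixProps

variable {k l : ℂ}

/-- The matrix depends only on the direction of v. Exponential factors and norming constants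
therefore drop out, and the Jost functions, which have limits at infinity, can replace the Jost
solutions. -/
theorem darbouxMat_smul_left {c : ℂ} (hc : c ≠ 0) (v F : ℂ × ℂ) :
    darbouxMat k l (c • v) F = darbouxMat k l v F := by
  have hn : ((‖c‖ : ℝ) : ℂ) ≠ 0 := Complex.ofReal_ne_zero.2 (norm_ne_zero_iff.2 hc)
  have h1 : c * conj c = ((‖c‖ : ℝ) : ℂ) ^ 2 := Complex.mul_conj' c
  have h2 : ((‖m k (c • v) (c • v)‖ : ℝ) : ℂ)⁻¹
      = (((‖c‖ : ℝ) : ℂ) ^ 2)⁻¹ * ((‖m k v v‖ : ℝ) : ℂ)⁻¹ := by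
    rw [m_smul, norm_mul, norm_mul, RCLike.norm_conj, ← mul_inv]
    push_cast; ring
  have h3 : (((‖c‖ : ℝ) : ℂ) ^ 2)⁻¹ * (c * conj c) = 1 := by rw [h1]; field_simp
  unfold darbouxMat
  rw [h2, m_smul]
  simp only [Prod.smul_fst, Prod.smul_snd, smul_eq_mul, map_mul, Complex.conj_conj]
  refine Prod.ext ?_ ?_
  · simp only
    linear_combination (((‖m k v v‖ : ℝ) : ℂ)⁻¹ * ((conj (m k v v) * l ^ 2 - k * conj k * m k v v)
      * F.1 - l * (k ^ 2 - conj k ^ 2) * v.1 * conj v.2 * F.2)) * h3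
  · simp only
    linear_combination (((‖m k v v‖ : ℝ) : ℂ)⁻¹ * (-(l * (k ^ 2 - conj k ^ 2) * conj v.1 * v.2 * F.1)
      + (m k v v * l ^ 2 - k * conj k * conj (m k v v)) * F.2)) * h3

theorem darbouxMat_smul_right (c : ℂ) (v F : ℂ × ℂ) :
    darbouxMat k l v (c • F) = c • darbouxMat k l v F := by
  unfold darbouxMat
  refine Prod.ext ?_ ?_ <;>
  · simp only [Prod.smul_fst, Prod.smul_snd, smul_eq_mul]; ring

theorem norm_mul_le_m (hk : 0 < k.re) (v : ℂ × ℂ) : ‖v.1‖ * ‖v.2‖ ≤ ‖m k v v‖ / k.re := by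
  rw [le_div_iff₀ hk]
  have := norm_m_ge k v
  nlinarith [sq_nonneg (‖v.1‖ - ‖v.2‖), sq_nonneg ‖v.1‖, sq_nonneg ‖v.2‖]

theorem norm_darbouxMat_le (hk : 0 < k.re) {v : ℂ × ℂ} (hv : v ≠ 0) (F : ℂ × ℂ) :
    ‖darbouxMat k l v F‖
      ≤ (‖l‖ ^ 2 + ‖k‖ ^ 2 + ‖l‖ * ‖k ^ 2 - conj k ^ 2‖ / k.re) * ‖F‖ := by
  have hm := m_ne_zero hk hv
  set n := ‖m k v v‖ with hn
  have hn0 : 0 < n := norm_pos_iff.2 hm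
  have h1 := norm_fst_le F
  have h2 := norm_snd_le F
  have h3 := norm_mul_le_m hk v
  have e1 : ‖conj (m k v v) * l ^ 2 - k * conj k * m k v v‖ ≤ n * (‖l‖ ^ 2 + ‖k‖ ^ 2) := by
    refine (norm_sub_le _ _).trans (le_of_eq ?_)
    simp only [norm_mul, norm_pow, RCLike.norm_conj]; ring
  have e2 : ‖m k v v * l ^ 2 - k * conj k * conj (m k v v)‖ ≤ n * (‖l‖ ^ 2 + ‖k‖ ^ 2) := by
    refine (norm_sub_le _ _).trans (le_of_eq ?_)
    simp only [norm_mul, norm_pow, RCLike.norm_conj]; ring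
  have e3 : ‖l‖ * ‖k ^ 2 - conj k ^ 2‖ * (‖v.1‖ * ‖v.2‖)
      ≤ n * (‖l‖ * ‖k ^ 2 - conj k ^ 2‖ / k.re) := by
    refine (mul_le_mul_of_nonneg_left h3 (by positivity)).trans (le_of_eq ?_)
    ring
  have hni : ‖((n : ℝ) : ℂ)⁻¹‖ = n⁻¹ := by
    rw [norm_inv, Complex.norm_real, Real.norm_of_nonneg hn0.le]
  refine norm_prod_le_iff.2 ⟨?_, ?_⟩
  · simp only [darbouxMat]
    rw [norm_mul, hni, inv_mul_le_iff₀ hn0]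
    refine (norm_sub_le _ _).trans ?_
    rw [norm_mul, norm_mul _ F.2]
    have a1 := mul_le_mul e1 h1 (norm_nonneg _) (by positivity)
    have a2 : ‖l * (k ^ 2 - conj k ^ 2) * v.1 * conj v.2‖ * ‖F.2‖
        ≤ n * (‖l‖ * ‖k ^ 2 - conj k ^ 2‖ / k.re) * ‖F‖ := by
      refine mul_le_mul ?_ h2 (norm_nonneg _) (by positivity)
      refine le_trans (le_of_eq ?_) e3
      simp only [norm_mul, RCLike.norm_conj]; ring
    linarith
  · simp only [darbouxMat]
    rw [norm_mul, hni, inv_mul_le_iff₀ hn0]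
    refine (norm_add_le _ _).trans ?_
    rw [norm_neg, norm_mul _ F.1, norm_mul _ F.2]
    have a1 := mul_le_mul e2 h2 (norm_nonneg _) (by positivity)
    have a2 : ‖l * (k ^ 2 - conj k ^ 2) * conj v.1 * v.2‖ * ‖F.1‖
        ≤ n * (‖l‖ * ‖k ^ 2 - conj k ^ 2‖ / k.re) * ‖F‖ := by
      refine mul_le_mul ?_ h1 (norm_nonneg _) (by positivity)
      refine le_trans (le_of_eq ?_) e3
      simp only [norm_mul, RCLike.norm_conj]; ring
    linarith

theorem continuous_m (k : ℂ) : Continuous fun v : ℂ × ℂ => m k v v := by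
  have := Complex.continuous_conj
  unfold m; fun_prop

theorem tendsto_darbouxMat {α : Type*} {L : Filter α} {v F : α → ℂ × ℂ} {v₀ F₀ : ℂ × ℂ}
    (hk : 0 < k.re) (h0 : v₀ ≠ 0) (hv : Tendsto v L (𝓝 v₀)) (hF : Tendsto F L (𝓝 F₀)) :
    Tendsto (fun x => darbouxMat k l (v x) (F x)) L (𝓝 (darbouxMat k l v₀ F₀)) := by
  have hm := m_ne_zero hk h0
  have cc : ∀ z : ℂ, Tendsto (fun w : ℂ => conj w) (𝓝 z) (𝓝 (conj z)) :=
    fun z => Complex.continuous_conj.tendsto z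
  have tm : Tendsto (fun x => m k (v x) (v x)) L (𝓝 (m k v₀ v₀)) :=
    ((continuous_m k).tendsto v₀).comp hv
  have tn : Tendsto (fun x => ((‖m k (v x) (v x)‖ : ℝ) : ℂ)⁻¹) L
      (𝓝 ((‖m k v₀ v₀‖ : ℝ) : ℂ)⁻¹) :=
    Tendsto.inv₀ ((Complex.continuous_ofReal.tendsto _).comp tm.norm)
      (Complex.ofReal_ne_zero.2 (norm_ne_zero_iff.2 hm))
  have tmc : Tendsto (fun x => conj (m k (v x) (v x))) L (𝓝 (conj (m k v₀ v₀))) :=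
    (cc _).comp tm
  have v1 : Tendsto (fun x => (v x).1) L (𝓝 v₀.1) := (continuous_fst.tendsto v₀).comp hv
  have v2 : Tendsto (fun x => (v x).2) L (𝓝 v₀.2) := (continuous_snd.tendsto v₀).comp hv
  have w1 : Tendsto (fun x => conj (v x).1) L (𝓝 (conj v₀.1)) := (cc _).comp v1
  have w2 : Tendsto (fun x => conj (v x).2) L (𝓝 (conj v₀.2)) := (cc _).comp v2
  have f1 : Tendsto (fun x => (F x).1) L (𝓝 F₀.1) := (continuous_fst.tendsto F₀).comp hF
  have f2 : Tendsto (fun x => (F x).2) L (𝓝 F₀.2) := (continuous_snd.tendsto F₀).comp hF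
  exact Tendsto.prodMk_nhds
    (tn.mul ((((tmc.mul_const _).sub (tm.const_mul _)).mul f1).sub
      (((v1.const_mul _).mul w2).mul f2)))
    (tn.mul ((((w1.const_mul _).mul v2).mul f1).neg.add
      (((tm.mul_const _).sub (tmc.const_mul _)).mul f2)))

/-- The normalization factor of the Darboux matrix at infinity. -/
noncomputable def darbouxFactor (k l : ℂ) : ℂ := ((‖k‖ : ℝ) : ℂ)⁻¹ * conj k * (l ^ 2 - k ^ 2)

theorem darbouxMat_e1 (k l : ℂ) : (darbouxMat k l (1, 0) (1, 0)).1 = darbouxFactor k l := by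
  have : m k ((1, 0) : ℂ × ℂ) (1, 0) = k := by simp [m]
  simp only [darbouxMat, darbouxFactor, this]
  ring

/-- The diagonal entry at +∞ equals the one at -∞, so one factor normalizes both Jost solutions. -/
theorem darbouxMat_e2 (k l : ℂ) : (darbouxMat k l (0, 1) (0, 1)).2 = darbouxFactor k l := by
  have : m k ((0, 1) : ℂ × ℂ) (0, 1) = conj k := by simp [m]
  simp only [darbouxMat, darbouxFactor, this, RCLike.norm_conj, Complex.conj_conj]
  ring

/-- The numerator of the determinant factors as m m̄ (l² - k²)(l² - k̄²), and m m̄ cancels against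
the normalization; nothing depends on v. -/
theorem darbouxMat_det (hk : 0 < k.re) {v : ℂ × ℂ} (hv : v ≠ 0) (F G : ℂ × ℂ) :
    (darbouxMat k l v F).1 * (darbouxMat k l v G).2 - (darbouxMat k l v F).2 * (darbouxMat k l v G).1
      = (l ^ 2 - k ^ 2) * (l ^ 2 - conj k ^ 2) * (F.1 * G.2 - F.2 * G.1) := by
  have hm := m_ne_zero hk hv
  set n := ((‖m k v v‖ : ℝ) : ℂ)⁻¹ with hn
  have hnn : n ^ 2 * (m k v v * conj (m k v v)) = 1 := by
    rw [Complex.mul_conj', hn]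
    have : ((‖m k v v‖ : ℝ) : ℂ) ≠ 0 := Complex.ofReal_ne_zero.2 (norm_ne_zero_iff.2 hm)
    field_simp
  have hM : m k v v = k * v.1 * conj v.1 + conj k * v.2 * conj v.2 := rfl
  have hMb : conj (m k v v) = conj k * v.1 * conj v.1 + k * v.2 * conj v.2 := by
    rw [← m_conj]; simp only [m, Complex.conj_conj]
  have e : (darbouxMat k l v F).1 * (darbouxMat k l v G).2
      - (darbouxMat k l v F).2 * (darbouxMat k l v G).1
      = n ^ 2 * ((conj (m k v v) * l ^ 2 - k * conj k * m k v v) *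
        (m k v v * l ^ 2 - k * conj k * conj (m k v v))
        - l ^ 2 * (k ^ 2 - conj k ^ 2) ^ 2 * (v.1 * conj v.1) * (v.2 * conj v.2))
        * (F.1 * G.2 - F.2 * G.1) := by
    simp only [darbouxMat, ← hn]; ring
  have e2 : (conj (m k v v) * l ^ 2 - k * conj k * m k v v) *
        (m k v v * l ^ 2 - k * conj k * conj (m k v v))
        - l ^ 2 * (k ^ 2 - conj k ^ 2) ^ 2 * (v.1 * conj v.1) * (v.2 * conj v.2)
      = (m k v v * conj (m k v v)) * ((l ^ 2 - k ^ 2) * (l ^ 2 - conj k ^ 2)) := by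
    rw [hMb, hM]; ring
  rw [e, e2]
  linear_combination ((l ^ 2 - k ^ 2) * (l ^ 2 - conj k ^ 2)) * (F.1 * G.2 - F.2 * G.1) * hnn

end MatrixProps

/-! ### Jost solutions and scattering coefficient after the transformation -/

section Scattering

variable {q : ℝ → ℂ} {k l : ℂ}

theorem jostMinus_ne_zero (hq : Pot q) (hl : 0 ≤ (l ^ 2).im) (x : ℝ) : jostMinus q l x ≠ 0 := by
  intro h
  apply solMinus_ne_zero hq hl x
  rw [solMinus_eq, h, smul_zero]

theorem jostPlus_ne_zero (hq : Pot q) (hl : 0 ≤ (l ^ 2).im) (x : ℝ) : jostPlus q l x ≠ 0 := by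
  intro h
  apply solPlus_ne_zero hq hl x
  unfold solPlus
  rw [h, smul_zero]

theorem darbouxFactor_ne_zero (hk : 0 < k.re) (hlk : l ^ 2 ≠ k ^ 2) : darbouxFactor k l ≠ 0 := by
  have hk0 : k ≠ 0 := by rintro rfl; simp at hk
  unfold darbouxFactor
  refine mul_ne_zero (mul_ne_zero (inv_ne_zero ?_) ((map_ne_zero _).2 hk0)) (sub_ne_zero.2 hlk)
  exact Complex.ofReal_ne_zero.2 (norm_ne_zero_iff.2 hk0)

theorem exp_mul_solMinus (q : ℝ → ℂ) (l : ℂ) (x : ℝ) :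
    Complex.exp (Complex.I * l ^ 2 * (x : ℂ)) • solMinus q l x = jostMinus q l x := by
  rw [solMinus_eq, smul_smul, ← Complex.exp_add]
  have : Complex.I * l ^ 2 * (x : ℂ) + -(Complex.I * l ^ 2) * x = 0 := by ring
  rw [this, Complex.exp_zero, one_smul]

theorem exp_mul_solPlus (q : ℝ → ℂ) (l : ℂ) (x : ℝ) :
    Complex.exp (-(Complex.I * l ^ 2 * (x : ℂ))) • solPlus q l x = jostPlus q l x := by
  unfold solPlus
  rw [smul_smul, ← Complex.exp_add, neg_add_cancel, Complex.exp_zero, one_smul]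

/-- The Jost solutions of the transformed potential at `-∞`. -/
theorem solMinus_darboux (hq : Pot q) (hk : k ∈ quadrantI)
    (hq₁ : Pot (darboux (solMinus q k) k q)) (hl : 0 < (l ^ 2).im) (hlk : l ^ 2 ≠ k ^ 2) (x : ℝ) :
    darbouxMat k l (solMinus q k x) (solMinus q l x)
      = darbouxFactor k l • solMinus (darboux (solMinus q k) k q) l x := by
  have hkr : 0 < k.re := hk.1
  have hki : 0 ≤ (k ^ 2).im := le_of_lt (quadrantI_subset hk)
  have hκ := darbouxFactor_ne_zero hkr hlk
  have hs := (((isSol_solMinus hq hki).darbouxMat hkr (solMinus_ne_zero hq hki)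
    (isSol_solMinus hq hl.le)).smul (darbouxFactor k l)⁻¹)
  have he : ∀ x : ℝ, Complex.exp (Complex.I * l ^ 2 * (x : ℂ)) •
      ((darbouxFactor k l)⁻¹ • darbouxMat k l (solMinus q k x) (solMinus q l x))
      = (darbouxFactor k l)⁻¹ • darbouxMat k l (jostMinus q k x) (jostMinus q l x) := fun x => by
    rw [smul_comm, ← darbouxMat_smul_right, exp_mul_solMinus, solMinus_eq q k,
      darbouxMat_smul_left (Complex.exp_ne_zero _)]
  have hlim : Tendsto (fun x => (darbouxFactor k l)⁻¹ •
      darbouxMat k l (jostMinus q k x) (jostMinus q l x)) atBot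
      (𝓝 ((darbouxFactor k l)⁻¹ • darbouxMat k l (1, 0) (1, 0))) :=
    (tendsto_darbouxMat hkr (by simp) (tendsto_jostMinus hq hki)
      (tendsto_jostMinus hq hl.le)).const_smul _
  have := hs.eq_solMinus hq₁ hl
    (K := ‖(darbouxFactor k l)⁻¹‖ * ((‖l‖ ^ 2 + ‖k‖ ^ 2 + ‖l‖ * ‖k ^ 2 - conj k ^ 2‖ / k.re) *
      (2 * expBound q l)))
    (fun x => by
      rw [he, norm_smul]
      refine mul_le_mul_of_nonneg_left ((norm_darbouxMat_le hkr (jostMinus_ne_zero hq hki x) _).trans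
        (mul_le_mul_of_nonneg_left (norm_jostMinus_le hq hl.le x) (by positivity))) (norm_nonneg _))
    (by
      have h1 := (continuous_fst.tendsto _).comp hlim
      rw [Prod.smul_fst, darbouxMat_e1, smul_eq_mul, inv_mul_cancel₀ hκ] at h1
      refine h1.congr fun x => ?_
      simp only [Function.comp_apply, ← he]
      rfl)
  rw [← congrFun this x, smul_smul, mul_inv_cancel₀ hκ, one_smul]

/-- The Jost solutions of the transformed potential at `+∞`. -/
theorem solPlus_darboux (hq : Pot q) (hk : k ∈ quadrantI) (ha : scatA q k = 0)
    (hq₁ : Pot (darboux (solMinus q k) k q)) (hl : 0 < (l ^ 2).im) (hlk : l ^ 2 ≠ k ^ 2) (x : ℝ) :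
    darbouxMat k l (solMinus q k x) (solPlus q l x)
      = darbouxFactor k l • solPlus (darboux (solMinus q k) k q) l x := by
  have hkr : 0 < k.re := hk.1
  have hki : 0 ≤ (k ^ 2).im := le_of_lt (quadrantI_subset hk)
  have hκ := darbouxFactor_ne_zero hkr hlk
  -- Since a(k) = 0, the vector in the matrix is also a multiple of the Jost solution at +∞. Hence
  -- the matrix converges there along the direction e₂.
  obtain ⟨c, hc, hcx⟩ := exists_norming hq hki ha
  have hs := (((isSol_solMinus hq hki).darbouxMat hkr (solMinus_ne_zero hq hki)
    (isSol_solPlus hq hl.le)).smul (darbouxFactor k l)⁻¹)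
  have he : ∀ x : ℝ, Complex.exp (-(Complex.I * l ^ 2 * (x : ℂ))) •
      ((darbouxFactor k l)⁻¹ • darbouxMat k l (solMinus q k x) (solPlus q l x))
      = (darbouxFactor k l)⁻¹ • darbouxMat k l (jostPlus q k x) (jostPlus q l x) := fun x => by
    rw [smul_comm, ← darbouxMat_smul_right, exp_mul_solPlus, hcx, darbouxMat_smul_left hc]
    unfold solPlus
    rw [darbouxMat_smul_left (Complex.exp_ne_zero _)]
  have hlim : Tendsto (fun x => (darbouxFactor k l)⁻¹ •
      darbouxMat k l (jostPlus q k x) (jostPlus q l x)) atTop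
      (𝓝 ((darbouxFactor k l)⁻¹ • darbouxMat k l (0, 1) (0, 1))) :=
    (tendsto_darbouxMat hkr (by simp) (tendsto_jostPlus hq hki)
      (tendsto_jostPlus hq hl.le)).const_smul _
  have := hs.eq_solPlus hq₁ hl
    (K := ‖(darbouxFactor k l)⁻¹‖ * ((‖l‖ ^ 2 + ‖k‖ ^ 2 + ‖l‖ * ‖k ^ 2 - conj k ^ 2‖ / k.re) *
      (2 * expBound q l)))
    (fun x => by
      rw [he, norm_smul]
      refine mul_le_mul_of_nonneg_left ((norm_darbouxMat_le hkr (jostPlus_ne_zero hq hki x) _).trans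
        (mul_le_mul_of_nonneg_left (norm_jostPlus_le hq hl.le x) (by positivity))) (norm_nonneg _))
    (by
      have h1 := (continuous_snd.tendsto _).comp hlim
      rw [Prod.smul_snd, darbouxMat_e2, smul_eq_mul, inv_mul_cancel₀ hκ] at h1
      refine h1.congr fun x => ?_
      simp only [Function.comp_apply, ← he]
      rfl)
  rw [← congrFun this x, smul_smul, mul_inv_cancel₀ hκ, one_smul]

/-- The scattering coefficient of the transformed potential. -/
theorem scatA_darboux (hq : Pot q) (hk : k ∈ quadrantI) (ha : scatA q k = 0)
    (hq₁ : Pot (darboux (solMinus q k) k q)) (hl : 0 < (l ^ 2).im) (hlk : l ^ 2 ≠ k ^ 2) :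
    conj k * (l ^ 2 - k ^ 2) * scatA (darboux (solMinus q k) k q) l
      = k * (l ^ 2 - conj k ^ 2) * scatA q l := by
  have hkr : 0 < k.re := hk.1
  have hki : 0 ≤ (k ^ 2).im := le_of_lt (quadrantI_subset hk)
  have hk0 : k ≠ 0 := by rintro rfl; simp at hkr
  -- The determinant formula compares the Wronskians of the two pairs of Jost solutions at x = 0.
  have hd := darbouxMat_det (l := l) hkr (solMinus_ne_zero hq hki 0) (solMinus q l 0) (solPlus q l 0)
  rw [solMinus_darboux hq hk hq₁ hl hlk, solPlus_darboux hq hk ha hq₁ hl hlk] at hd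
  simp only [Prod.smul_fst, Prod.smul_snd, smul_eq_mul] at hd
  have hd' : darbouxFactor k l ^ 2 * scatA (darboux (solMinus q k) k q) l
      = (l ^ 2 - k ^ 2) * (l ^ 2 - conj k ^ 2) * scatA q l := by
    unfold scatA
    linear_combination hd
  have hn : ((‖k‖ : ℝ) : ℂ) ≠ 0 := Complex.ofReal_ne_zero.2 (norm_ne_zero_iff.2 hk0)
  have hf : k * darbouxFactor k l ^ 2 = conj k * (l ^ 2 - k ^ 2) ^ 2 := by
    have h1 : k * conj k = ((‖k‖ : ℝ) : ℂ) ^ 2 := Complex.mul_conj' k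
    unfold darbouxFactor
    field_simp
    linear_combination conj k * h1
  have hne : l ^ 2 - k ^ 2 ≠ 0 := sub_ne_zero.2 hlk
  apply mul_left_cancel₀ hne
  linear_combination k * hd' - scatA (darboux (solMinus q k) k q) l * hf

theorem sq_injOn_quadrantI {l k : ℂ} (hl : l ∈ quadrantI) (hk : k ∈ quadrantI) (h : l ^ 2 = k ^ 2) :
    l = k := by
  rcases sq_eq_sq_iff_eq_or_eq_neg.1 h with h | h
  · exact h
  · exfalso
    have h1 : 0 < l.re := hl.1
    have h2 : 0 < k.re := hk.1
    rw [h, Complex.neg_re] at h1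
    linarith

theorem sq_ne_conj_sq {l k : ℂ} (hl : l ∈ quadrantI) (hk : k ∈ quadrantI) : l ^ 2 ≠ conj k ^ 2 := by
  intro h
  have h1 : 0 < (l ^ 2).im := quadrantI_subset hl
  have h2 : 0 < (k ^ 2).im := quadrantI_subset hk
  rw [h, ← map_pow, Complex.conj_im] at h1
  linarith

theorem isOpen_quadrantI : IsOpen quadrantI :=
  (isOpen_lt continuous_const Complex.continuous_re).inter
    (isOpen_lt continuous_const Complex.continuous_im)

/-- If `k` is the only zero of `a` in the quadrant and it is simple then the scattering coefficient
of the transformed potential has no zeros in the quadrant. -/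
theorem scatA_darboux_ne_zero (hq : Pot q) (hk : k ∈ quadrantI) (ha : scatA q k = 0)
    (huniq : ∀ l ∈ quadrantI, scatA q l = 0 → l = k) (hsimple : deriv (scatA q) k ≠ 0)
    (hq₁ : Pot (darboux (solMinus q k) k q)) (hl : l ∈ quadrantI) :
    scatA (darboux (solMinus q k) k q) l ≠ 0 := by
  have hkr : 0 < k.re := hk.1
  have hk0 : k ≠ 0 := by rintro rfl; simp at hkr
  by_cases hlk : l = k
  · subst hlk
    set q₁ := darboux (solMinus q l) l q with hq₁d
    have hcont : ContinuousAt (scatA q₁) l :=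
      ((differentiableOn_scatA hq₁).differentiableAt
        (isOpen_upperSq.mem_nhds (quadrantI_subset hl))).continuousAt
    have hder : HasDerivAt (scatA q) (deriv (scatA q) l) l :=
      ((differentiableOn_scatA hq).differentiableAt
        (isOpen_upperSq.mem_nhds (quadrantI_subset hl))).hasDerivAt
    have hslope := hasDerivAt_iff_tendsto_slope.1 hder
    have hid : Tendsto (fun z : ℂ => z) (𝓝[≠] l) (𝓝 l) := tendsto_id.mono_left nhdsWithin_le_nhds
    -- At the removed zero the relation between the coefficients is divided by z - l, using z² - l²
    -- = (z - l)(z + l). In the limit the quotient a(z)/(z - l) becomes a'(l), which is nonzero by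
    -- simplicity.
    have lim1 : Tendsto (fun z => conj l * (z + l) * scatA q₁ z) (𝓝[≠] l)
        (𝓝 (conj l * (l + l) * scatA q₁ l)) :=
      ((hid.add_const l).const_mul (conj l)).mul (hcont.tendsto.mono_left nhdsWithin_le_nhds)
    have lim2 : Tendsto (fun z => l * (z ^ 2 - conj l ^ 2) * slope (scatA q) l z) (𝓝[≠] l)
        (𝓝 (l * (l ^ 2 - conj l ^ 2) * deriv (scatA q) l)) :=
      (((hid.pow 2).sub_const _).const_mul l).mul hslope
    have heq : (fun z => conj l * (z + l) * scatA q₁ z) =ᶠ[𝓝[≠] l]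
        fun z => l * (z ^ 2 - conj l ^ 2) * slope (scatA q) l z := by
      filter_upwards [self_mem_nhdsWithin,
        mem_nhdsWithin_of_mem_nhds (isOpen_quadrantI.mem_nhds hl)] with z hz hzq
      have hne : z - l ≠ 0 := sub_ne_zero.2 hz
      have h := scatA_darboux hq hk ha hq₁ (quadrantI_subset hzq)
        (fun h => hz (sq_injOn_quadrantI hzq hl h))
      rw [slope_def_field, ha, sub_zero]
      field_simp
      rw [← hq₁d] at h
      linear_combination h
    have := tendsto_nhds_unique (lim1.congr' heq) lim2
    intro h0
    rw [h0, mul_zero] at this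
    have h1 : l ^ 2 - conj l ^ 2 ≠ 0 := sub_ne_zero.2 (sq_ne_conj_sq hl hl)
    exact mul_ne_zero (mul_ne_zero hk0 h1) hsimple this.symm
  · intro h0
    have h := scatA_darboux hq hk ha hq₁ (quadrantI_subset hl)
        (fun h => hlk (sq_injOn_quadrantI hl hk h))
    rw [h0, mul_zero] at h
    have h1 : l ^ 2 - conj k ^ 2 ≠ 0 := sub_ne_zero.2 (sq_ne_conj_sq hl hk)
    exact hlk (huniq l hl ((mul_eq_zero.1 h.symm).resolve_left (mul_ne_zero hk0 h1)))

/-- The vector that inverts the Darboux transformation as a combination of Jost solutions. -/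
theorem inverseVector_eq (hq : Pot q) (hk : k ∈ quadrantI)
    (hq₁ : Pot (darboux (solMinus q k) k q)) {c : ℂ} (hc : c ≠ 0)
    (hcx : ∀ x, solMinus q k x = c • solPlus q k x)
    (ha₁ : scatA (darboux (solMinus q k) k q) k ≠ 0) :
    ∃ s : ℂ, s ≠ 0 ∧ ∀ x, inverseVector (solMinus q k) k x
      = s • jostCombination (darboux (solMinus q k) k q) k (-c) x := by
  have hkr : 0 < k.re := hk.1
  have hki : 0 < (k ^ 2).im := quadrantI_subset hk
  have hk0 : k ≠ 0 := by rintro rfl; simp at hkr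
  have hn : ((‖k‖ : ℝ) : ℂ) ≠ 0 := Complex.ofReal_ne_zero.2 (norm_ne_zero_iff.2 hk0)
  set q₁ := darboux (solMinus q k) k q with hq₁d
  set Y := inverseVector (solMinus q k) k with hY
  have sY : IsSol q₁ k Y := (isSol_solMinus hq hki.le).inverseVector hkr (solMinus_ne_zero hq hki.le)
  have sm := isSol_solMinus hq₁ hki.le
  have sp := isSol_solPlus hq₁ hki.le
  have cc := Complex.continuous_conj
  have cm := continuous_m k
  -- scaling of the inverse vector
  have hsc : ∀ (e : ℂ) (v : ℂ × ℂ), e ≠ 0 → e • ((((‖m k (e • v) (e • v)‖ : ℝ) : ℂ)⁻¹) •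
      (conj (e • v).2, -conj (e • v).1)) = (((‖m k v v‖ : ℝ) : ℂ)⁻¹) • (conj v.2, -conj v.1) := by
    intro e v he
    have hne : ((‖e‖ : ℝ) : ℂ) ≠ 0 := Complex.ofReal_ne_zero.2 (norm_ne_zero_iff.2 he)
    have h1 : e * conj e = ((‖e‖ : ℝ) : ℂ) ^ 2 := Complex.mul_conj' e
    have h2 : ((‖m k (e • v) (e • v)‖ : ℝ) : ℂ)⁻¹
        = (((‖e‖ : ℝ) : ℂ) ^ 2)⁻¹ * ((‖m k v v‖ : ℝ) : ℂ)⁻¹ := by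
      rw [m_smul, norm_mul, norm_mul, RCLike.norm_conj, ← mul_inv]
      push_cast; ring
    have h3 : (((‖e‖ : ℝ) : ℂ) ^ 2)⁻¹ * (e * conj e) = 1 := by rw [h1]; field_simp
    rw [h2]
    refine Prod.ext ?_ ?_
    · simp only [Prod.smul_mk, Prod.smul_fst, Prod.smul_snd, smul_eq_mul, map_mul]
      linear_combination ((‖m k v v‖ : ℝ) : ℂ)⁻¹ * conj v.2 * h3
    · simp only [Prod.smul_mk, Prod.smul_fst, Prod.smul_snd, smul_eq_mul, map_mul]
      linear_combination -((‖m k v v‖ : ℝ) : ℂ)⁻¹ * conj v.1 * h3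
  have hclim : ∀ v₀ : ℂ × ℂ, v₀ ≠ 0 → ContinuousAt (fun v : ℂ × ℂ =>
      (((‖m k v v‖ : ℝ) : ℂ)⁻¹) • (conj v.2, -conj v.1)) v₀ := by
    intro v₀ h0
    have hm := m_ne_zero hkr h0
    have h1 : ContinuousAt (fun v : ℂ × ℂ => ((‖m k v v‖ : ℝ) : ℂ)⁻¹) v₀ :=
      ContinuousAt.inv₀ (Complex.continuous_ofReal.comp cm.norm).continuousAt
        (Complex.ofReal_ne_zero.2 (norm_ne_zero_iff.2 hm))
    have h2 : Continuous (fun v : ℂ × ℂ => (conj v.2, -conj v.1)) :=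
      (cc.comp continuous_snd).prodMk (cc.comp continuous_fst).neg
    exact h1.smul h2.continuousAt
  -- Wronskian with the solution at `-∞`
  have W1 : ∀ x, wronskian (solMinus q₁ k) Y x = -((‖k‖ : ℝ) : ℂ)⁻¹ := by
    have hl1 : Tendsto (fun x => (((‖m k (jostMinus q k x) (jostMinus q k x)‖ : ℝ) : ℂ)⁻¹) •
        (conj (jostMinus q k x).2, -conj (jostMinus q k x).1)) atBot (𝓝 ((((‖k‖ : ℝ) : ℂ)⁻¹) •
        (0, -1))) := by
      have := (hclim (1, 0) (by simp)).tendsto.comp (tendsto_jostMinus hq hki.le)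
      simpa [m, Function.comp_def] using this
    have hl2 := tendsto_jostMinus hq₁ hki.le
    have hw : ∀ x, wronskian (solMinus q₁ k) Y x =
        (jostMinus q₁ k x).1 * ((((‖m k (jostMinus q k x) (jostMinus q k x)‖ : ℝ) : ℂ)⁻¹) •
        (conj (jostMinus q k x).2, -conj (jostMinus q k x).1)).2
        - (jostMinus q₁ k x).2 * ((((‖m k (jostMinus q k x) (jostMinus q k x)‖ : ℝ) : ℂ)⁻¹) •
        (conj (jostMinus q k x).2, -conj (jostMinus q k x).1)).1 := by
      intro x
      rw [← hsc (Complex.exp (-(Complex.I * k ^ 2) * (x : ℂ))) (jostMinus q k x)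
        (Complex.exp_ne_zero _), ← solMinus_eq]
      simp only [wronskian, hY, inverseVector, solMinus_eq q₁, Prod.smul_fst, Prod.smul_snd,
        smul_eq_mul]
      ring
    have hlim : Tendsto (wronskian (solMinus q₁ k) Y) atBot (𝓝 (-((‖k‖ : ℝ) : ℂ)⁻¹)) := by
      have a1 := (continuous_fst.tendsto _).comp hl1
      have a2 := (continuous_snd.tendsto _).comp hl1
      have b1 := (continuous_fst.tendsto _).comp hl2
      have b2 := (continuous_snd.tendsto _).comp hl2
      have := (b1.mul a2).sub (b2.mul a1)
      have e : ((1, 0) : ℂ × ℂ).1 * ((((‖k‖ : ℝ) : ℂ)⁻¹) • ((0, -1) : ℂ × ℂ)).2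
          - ((1, 0) : ℂ × ℂ).2 * ((((‖k‖ : ℝ) : ℂ)⁻¹) • ((0, -1) : ℂ × ℂ)).1
          = -((‖k‖ : ℝ) : ℂ)⁻¹ := by simp
      rw [e] at this
      exact this.congr fun x => (hw x).symm
    intro x
    refine tendsto_nhds_unique (tendsto_const_nhds (f := (atBot : Filter ℝ))) (hlim.congr fun y => ?_)
    exact sm.wronskian_eq sY y x
  -- Near +∞ the vector is rewritten through the Jost function there, with scalar c e^{ik²x}.
  -- Scaling the argument by e scales the inverse vector by e⁻¹, which produces the factor c⁻¹.
  have W2 : ∀ x, wronskian Y (solPlus q₁ k) x = c⁻¹ * ((‖k‖ : ℝ) : ℂ)⁻¹ := by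
    have hl1 : Tendsto (fun x => (((‖m k (jostPlus q k x) (jostPlus q k x)‖ : ℝ) : ℂ)⁻¹) •
        (conj (jostPlus q k x).2, -conj (jostPlus q k x).1)) atTop (𝓝 ((((‖k‖ : ℝ) : ℂ)⁻¹) •
        (1, 0))) := by
      have := (hclim (0, 1) (by simp)).tendsto.comp (tendsto_jostPlus hq hki.le)
      simpa [m, Function.comp_def] using this
    have hl2 := tendsto_jostPlus hq₁ hki.le
    have hw : ∀ x, wronskian Y (solPlus q₁ k) x = c⁻¹ *
        (((((‖m k (jostPlus q k x) (jostPlus q k x)‖ : ℝ) : ℂ)⁻¹) •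
        (conj (jostPlus q k x).2, -conj (jostPlus q k x).1)).1 * (jostPlus q₁ k x).2
        - ((((‖m k (jostPlus q k x) (jostPlus q k x)‖ : ℝ) : ℂ)⁻¹) •
        (conj (jostPlus q k x).2, -conj (jostPlus q k x).1)).2 * (jostPlus q₁ k x).1) := by
      intro x
      have hx : solMinus q k x = (c * Complex.exp (Complex.I * k ^ 2 * (x : ℂ))) • jostPlus q k x := by
        rw [hcx, solPlus, smul_smul]
      rw [← hsc (c * Complex.exp (Complex.I * k ^ 2 * (x : ℂ))) (jostPlus q k x)
        (mul_ne_zero hc (Complex.exp_ne_zero _)), ← hx]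
      simp only [wronskian, hY, inverseVector, solPlus, Prod.smul_fst, Prod.smul_snd,
        smul_eq_mul]
      field_simp
    have hlim : Tendsto (wronskian Y (solPlus q₁ k)) atTop (𝓝 (c⁻¹ * ((‖k‖ : ℝ) : ℂ)⁻¹)) := by
      have a1 := (continuous_fst.tendsto _).comp hl1
      have a2 := (continuous_snd.tendsto _).comp hl1
      have b1 := (continuous_fst.tendsto _).comp hl2
      have b2 := (continuous_snd.tendsto _).comp hl2
      have := ((a1.mul b2).sub (a2.mul b1)).const_mul c⁻¹
      have e : c⁻¹ * (((((‖k‖ : ℝ) : ℂ)⁻¹) • ((1, 0) : ℂ × ℂ)).1 * ((0, 1) : ℂ × ℂ).2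
          - ((((‖k‖ : ℝ) : ℂ)⁻¹) • ((1, 0) : ℂ × ℂ)).2 * ((0, 1) : ℂ × ℂ).1)
          = c⁻¹ * ((‖k‖ : ℝ) : ℂ)⁻¹ := by simp
      rw [e] at this
      exact this.congr fun x => (hw x).symm
    intro x
    refine tendsto_nhds_unique (tendsto_const_nhds (f := (atTop : Filter ℝ))) (hlim.congr fun y => ?_)
    exact sY.wronskian_eq sp y x
  -- Cramer's rule: with ψ± the Jost solutions of q₁, a₁ Y = W(Y, ψ₊) ψ₋ + W(ψ₋, Y) ψ₊. The two
  -- Wronskians c⁻¹/|k| and -1/|k| have ratio -c.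
  refine ⟨(scatA q₁ k)⁻¹ * (c⁻¹ * ((‖k‖ : ℝ) : ℂ)⁻¹), by
    refine mul_ne_zero (inv_ne_zero ha₁) (mul_ne_zero (inv_ne_zero hc) (inv_ne_zero hn)), fun x => ?_⟩
  have w1 := W1 x
  have w2 := W2 x
  have w3 := scatA_eq_wronskian hq₁ hki.le x
  have hw3 : (solMinus q₁ k x).1 * (solPlus q₁ k x).2 - (solMinus q₁ k x).2 * (solPlus q₁ k x).1
      = scatA q₁ k := w3.symm
  unfold wronskian at w1 w2
  apply smul_right_injective _ ha₁
  simp only [smul_smul, mul_inv_cancel_left₀ ha₁]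
  refine Prod.ext ?_ ?_
  · simp only [jostCombination, Prod.smul_fst, Prod.fst_add, smul_eq_mul]
    have hcc : c⁻¹ * c = 1 := inv_mul_cancel₀ hc
    linear_combination (solPlus q₁ k x).1 * w1 + (solMinus q₁ k x).1 * w2 - (Y x).1 * hw3
      + ((‖k‖ : ℝ) : ℂ)⁻¹ * (solPlus q₁ k x).1 * hcc
  · simp only [jostCombination, Prod.smul_snd, Prod.snd_add, smul_eq_mul]
    have hcc : c⁻¹ * c = 1 := inv_mul_cancel₀ hc
    linear_combination (solPlus q₁ k x).2 * w1 + (solMinus q₁ k x).2 * w2 - (Y x).2 * hw3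
      + ((‖k‖ : ℝ) : ℂ)⁻¹ * (solPlus q₁ k x).2 * hcc

end Scattering


/-! ### Uniform bounds for the scattering data on bounded sets -/

section Uniform

variable {u v w : ℝ → ℂ} {M : ℝ} {l : ℂ}

theorem XRep.pot (h : XRep u v w M) : Pot u where
  cont := h.continuous_u
  bdd := ⟨_, h.norm_le⟩
  i1 := XRep.integrable_norm h.continuous_u.aestronglyMeasurable h.iu
  i2 := XRep.integrable_sq h.continuous_u.aestronglyMeasurable h.iu

/-- A bound for `expBound` which is uniform on bounded sets. -/
noncomputable def uniformExpBound (M L : ℝ) : ℝ :=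
  Real.exp (2 * (M ^ 2 / 4 + L * (Real.pi + M ^ 2)))

theorem XRep.expBound_le (h : XRep u v w M) (l : ℂ) : expBound u l ≤ uniformExpBound M ‖l‖ := by
  refine Real.exp_le_exp.2 (mul_le_mul_of_nonneg_left ?_ (by norm_num))
  have h1 : ∫ y, wt u l y = (∫ y, ‖u y‖ ^ 2) / 4 + ‖l‖ * ∫ y, ‖u y‖ := by
    rw [← integral_div, ← integral_const_mul, ← integral_add (h.pot.i2.div_const 4)
      (h.pot.i1.const_mul ‖l‖)]
    rfl
  have h2 : ∫ y, ‖u y‖ ^ 2 ≤ M ^ 2 := (integral_mono h.pot.i2 h.iu fun x => by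
    nlinarith [sq_nonneg (x * ‖u x‖)]).trans h.bu
  have h3 := (XRep.integral_norm_le h.continuous_u.aestronglyMeasurable h.iu).trans
    (add_le_add_right h.bu _)
  rw [h1]
  exact add_le_add (by linarith) (mul_le_mul_of_nonneg_left h3 (norm_nonneg _))

/-- The scattering coefficient of a potential without zeros in the quadrant is bounded from below
on bounded sets of potentials. -/
theorem exists_le_norm_scatA (hl : l ∈ quadrantI) (M : ℝ) :
    ∃ d > 0, ∀ u v w, XRep u v w M → (∀ z ∈ quadrantI, scatA u z ≠ 0) → d ≤ ‖scatA u l‖ := by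
  have hE : ∀ L, 0 < uniformExpBound M L := fun L => Real.exp_pos _
  -- A comes from `norm_scatA_le` on the disc of radius 2‖l‖, and r₀ is the radius at which the
  -- smallness condition 8E⁴‖z‖ ≤ 1 becomes an equality for the uniform E.
  obtain ⟨d, hd, H⟩ := exists_lower_bound hl
    (A := 8 * uniformExpBound M (2 * ‖l‖) ^ 2) (r₀ := (8 * uniformExpBound M 1 ^ 4)⁻¹)
    (by have := hE (2 * ‖l‖); positivity) (by have := hE 1; positivity)
  refine ⟨d, hd, fun u v w h h0 => H _ ((differentiableOn_scatA h.pot).mono quadrantI_subset) h0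
    (fun z hz hzn => ?_) fun z hz hzn => ?_⟩
  · refine (norm_scatA_le h.pot (le_of_lt (quadrantI_subset hz))).trans ?_
    have h1 : expBound u z ≤ uniformExpBound M (2 * ‖l‖) := by
      refine (expBound_mono h.pot (l' := ((2 * ‖l‖ : ℝ) : ℂ)) ?_).trans ?_
      · rwa [Complex.norm_real, Real.norm_of_nonneg (by positivity)]
      · refine (h.expBound_le _).trans (le_of_eq ?_)
        rw [Complex.norm_real, Real.norm_of_nonneg (by positivity)]
    have := one_le_expBound u z
    gcongr
  · refine norm_scatA_ge_of_small h.pot (le_of_lt (quadrantI_subset hz)) ?_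
    have h1 : expBound u 1 ≤ uniformExpBound M 1 := by simpa using h.expBound_le 1
    have h2 := one_le_expBound u 1
    have h3 : 8 * expBound u 1 ^ 4 * ‖z‖ ≤ 8 * uniformExpBound M 1 ^ 4 * ‖z‖ := by gcongr
    refine h3.trans ?_
    have h4 : (0 : ℝ) < 8 * uniformExpBound M 1 ^ 4 := by have := hE 1; positivity
    refine (mul_le_mul_of_nonneg_left hzn h4.le).trans (le_of_eq (mul_inv_cancel₀ h4.ne'))

end Uniform


/-! ### Weighted estimates for the ratio of the components -/

/-- The scale invariant quantity `f ḡ / m_l(Φ, Φ)`. -/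
noncomputable def crossRatio (l : ℂ) (v : ℂ × ℂ) : ℂ := v.1 * conj v.2 / m l v v

theorem crossRatio_smul {c : ℂ} (hc : c ≠ 0) (l : ℂ) (v : ℂ × ℂ) :
    crossRatio l (c • v) = crossRatio l v := by
  have h : c * conj c ≠ 0 := mul_ne_zero hc ((map_ne_zero _).2 hc)
  unfold crossRatio
  rw [m_smul, Prod.smul_fst, Prod.smul_snd, smul_eq_mul, smul_eq_mul, map_mul,
    ← mul_div_mul_left (v.1 * conj v.2) _ h]
  congr 1; ring

theorem m_swap (l : ℂ) (v : ℂ × ℂ) : m l v.swap v.swap = conj (m l v v) := by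
  rw [← m_conj]; simp only [m, Prod.fst_swap, Prod.snd_swap, Complex.conj_conj]; ring

theorem norm_crossRatio_swap (l : ℂ) (v : ℂ × ℂ) :
    ‖crossRatio l v.swap‖ = ‖crossRatio l v‖ := by
  unfold crossRatio
  rw [m_swap]
  simp only [norm_div, norm_mul, RCLike.norm_conj, Prod.fst_swap, Prod.snd_swap, mul_comm]

theorem norm_sq_le_m {l : ℂ} (hl : 0 < l.re) (v : ℂ × ℂ) : l.re * ‖v‖ ^ 2 ≤ ‖m l v v‖ := by
  refine le_trans (mul_le_mul_of_nonneg_left ?_ hl.le) (norm_m_ge l v)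
  rcases le_total ‖v.1‖ ‖v.2‖ with h | h
  · rw [Prod.norm_def, max_eq_right h]; nlinarith [sq_nonneg ‖v.1‖]
  · rw [Prod.norm_def, max_eq_left h]; nlinarith [sq_nonneg ‖v.2‖]

/-- Once the vector is bounded below, the ratio is linearly controlled by the second component,
which is the component with an energy estimate. -/
theorem norm_crossRatio_le {l : ℂ} (hl : 0 < l.re) {v : ℂ × ℂ} {δ : ℝ} (hδ : 0 < δ)
    (hv : δ ≤ ‖v‖) : ‖crossRatio l v‖ ≤ ‖v.2‖ / (l.re * δ) := by
  have hv0 : 0 < ‖v‖ := hδ.trans_le hv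
  have h1 := norm_sq_le_m hl v
  have h2 : 0 < ‖m l v v‖ := lt_of_lt_of_le (by positivity) h1
  unfold crossRatio
  rw [norm_div, norm_mul, RCLike.norm_conj, div_le_div_iff₀ h2 (by positivity)]
  have h3 := norm_fst_le v
  calc ‖v.1‖ * ‖v.2‖ * (l.re * δ) ≤ ‖v‖ * ‖v.2‖ * (l.re * ‖v‖) := by gcongr
    _ = ‖v.2‖ * (l.re * ‖v‖ ^ 2) := by ring
    _ ≤ ‖v.2‖ * ‖m l v v‖ := by gcongr

/-! ### Weighted energy estimates on the half line -/

section Energy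

variable {u : ℝ → ℂ} {l : ℂ} {Φ : ℝ → ℂ × ℂ}

/-- After multiplication by e^{il²x} the damping rate is -2 Im l², because the |u|² term is purely
imaginary. The remaining term is a forcing proportional to ū. -/
theorem IsSol.hasDerivAt_exp_snd (h : IsSol u l Φ) (x : ℝ) :
    HasDerivAt (fun x : ℝ => Complex.exp (Complex.I * l ^ 2 * (x : ℂ)) * (Φ x).2)
      ((2 * Complex.I * l ^ 2 - Complex.I / 4 * (u x * conj (u x))) *
        (Complex.exp (Complex.I * l ^ 2 * (x : ℂ)) * (Φ x).2)
        - l * conj (u x) * (Complex.exp (Complex.I * l ^ 2 * (x : ℂ)) * (Φ x).1)) x :=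
  ((hasDerivAt_cexp_mul (Complex.I * l ^ 2) x).mul (h.2 x)).congr_deriv
    (by simp only [diagCoeff]; ring)

/-- Young's inequality spends one κ of the damping 4κ on the forcing. -/
theorem energy_inequality {κ ρ σ : ℝ} (hκ : 0 < κ) {c ψ s : ℂ} (hc : c.re = -2 * κ)
    (hψ : ‖ψ‖ = ρ) (hs : ‖s‖ ≤ σ) :
    2 * (conj ψ * (c * ψ - s)).re ≤ -3 * κ * ρ ^ 2 + σ ^ 2 / κ := by
  have h1 : (conj ψ * (c * ψ - s)).re = c.re * ρ ^ 2 - (conj ψ * s).re := by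
    have : conj ψ * (c * ψ - s) = c * ((ρ ^ 2 : ℝ) : ℂ) - conj ψ * s := by
      have h := Complex.conj_mul' ψ
      rw [hψ] at h
      push_cast
      linear_combination c * h
    rw [this, Complex.sub_re, Complex.re_mul_ofReal]
  have h2 : -(conj ψ * s).re ≤ ρ * σ := by
    refine (neg_le_abs _).trans ((Complex.abs_re_le_norm _).trans ?_)
    rw [norm_mul, RCLike.norm_conj, hψ]
    exact mul_le_mul_of_nonneg_left hs (hψ ▸ norm_nonneg ψ)
  have h3 : 2 * (ρ * σ) ≤ κ * ρ ^ 2 + σ ^ 2 / κ := by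
    have : κ * ρ ^ 2 + σ ^ 2 / κ - 2 * (ρ * σ) = (κ * ρ - σ) ^ 2 / κ := by field_simp; ring
    have h4 : 0 ≤ (κ * ρ - σ) ^ 2 / κ := by positivity
    linarith
  rw [h1, hc]
  nlinarith

/-- The weighted energy estimate for the decaying component of a solution on the half line. -/
theorem IsSol.energy (h : IsSol u l Φ) (hu : Continuous u) (hl : 0 < (l ^ 2).im) {K X : ℝ}
    (hX : 0 ≤ X)
    (hK : ∀ x : ℝ, 0 ≤ x → ‖Complex.exp (Complex.I * l ^ 2 * (x : ℂ)) • Φ x‖ ≤ K) :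
    2 * (l ^ 2).im * ∫ x in (0 : ℝ)..X, (1 + ((l ^ 2).im * x) ^ 2) *
        ‖Complex.exp (Complex.I * l ^ 2 * (x : ℂ)) * (Φ x).2‖ ^ 2
      ≤ K ^ 2 + (‖l‖ * K) ^ 2 / (l ^ 2).im *
        ∫ x in (0 : ℝ)..X, (1 + ((l ^ 2).im * x) ^ 2) * ‖u x‖ ^ 2 := by
  set κ := (l ^ 2).im with hκ
  set ψ : ℝ → ℂ := fun x => Complex.exp (Complex.I * l ^ 2 * (x : ℂ)) * (Φ x).2 with hψ
  have hK0 : 0 ≤ K := (norm_nonneg _).trans (hK 0 le_rfl)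
  have hΦc := h.continuous
  have hc := Complex.continuous_conj
  have hψc : Continuous ψ := by fun_prop
  set ψ' : ℝ → ℂ := fun x => ((2 * Complex.I * l ^ 2 - Complex.I / 4 * (u x * conj (u x))) * ψ x
        - l * conj (u x) * (Complex.exp (Complex.I * l ^ 2 * (x : ℂ)) * (Φ x).1)) with hψ'
  have hψ'c : Continuous ψ' := by fun_prop
  have hd : ∀ x, HasDerivAt ψ (ψ' x) x := h.hasDerivAt_exp_snd
  have hn : ∀ x, HasDerivAt (fun x => ‖ψ x‖ ^ 2) (2 * (conj (ψ x) * ψ' x).re) x := fun x => by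
    refine (hd x).norm_sq.congr_deriv ?_
    rw [Complex.inner, mul_comm (ψ' x)]
  have hw : ∀ x : ℝ, HasDerivAt (fun x : ℝ => 1 + (κ * x) ^ 2) (2 * κ ^ 2 * x) x := fun x => by
    refine ((((hasDerivAt_id x).const_mul κ).pow 2).const_add 1).congr_deriv ?_
    simp; ring
  have hG := fun x => (hw x).mul (hn x)
  have hre : ∀ x, (2 * Complex.I * l ^ 2 - Complex.I / 4 * (u x * conj (u x))).re = -2 * κ := by
    intro x
    rw [Complex.mul_conj']
    have e : (2 * Complex.I * l ^ 2 - Complex.I / 4 * ((‖u x‖ : ℝ) : ℂ) ^ 2)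
        = Complex.I * (2 * l ^ 2 - ((‖u x‖ ^ 2 / 4 : ℝ) : ℂ)) := by push_cast; ring
    rw [e, Complex.I_mul_re, Complex.sub_im, Complex.ofReal_im, hκ]
    simp
  -- The weight is 1 + (κx)² so that its derivative is at most κ times itself. One κ of the
  -- remaining damping 3κ pays for it, and 2κ is left.
  have key : ∀ x ∈ Icc 0 X, 2 * κ * ((1 + (κ * x) ^ 2) * ‖ψ x‖ ^ 2)
      + (2 * κ ^ 2 * x * ‖ψ x‖ ^ 2 + (1 + (κ * x) ^ 2) * (2 * (conj (ψ x) * ψ' x).re))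
      ≤ (‖l‖ * K) ^ 2 / κ * ((1 + (κ * x) ^ 2) * ‖u x‖ ^ 2) := by
    intro x hx
    have hs : ‖l * conj (u x) * (Complex.exp (Complex.I * l ^ 2 * (x : ℂ)) * (Φ x).1)‖
        ≤ ‖l‖ * ‖u x‖ * K := by
      rw [norm_mul, norm_mul, RCLike.norm_conj]
      exact mul_le_mul_of_nonneg_left ((norm_fst_le _).trans (hK x hx.1)) (by positivity)
    have e1 := energy_inequality hl (hre x) (rfl : ‖ψ x‖ = _) hs
    have e2 : 2 * κ ^ 2 * x ≤ κ * (1 + (κ * x) ^ 2) := by nlinarith [sq_nonneg (1 - κ * x)]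
    have hw0 : 0 < 1 + (κ * x) ^ 2 := by positivity
    have e3 := mul_le_mul_of_nonneg_left e1 hw0.le
    have e4 := mul_le_mul_of_nonneg_right e2 (sq_nonneg ‖ψ x‖)
    have e5 : (‖l‖ * K) ^ 2 / κ * ((1 + (κ * x) ^ 2) * ‖u x‖ ^ 2)
        = (1 + (κ * x) ^ 2) * ((‖l‖ * ‖u x‖ * K) ^ 2 / κ) := by ring
    rw [e5]
    change (1 + (κ * x) ^ 2) * (2 * (conj (ψ x) * ψ' x).re) ≤ _ at e3
    nlinarith
  have hcc : Continuous fun x => 2 * (conj (ψ x) * ψ' x).re := by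
    have := Complex.continuous_re
    fun_prop
  have c1 : Continuous fun x => 2 * κ * ((1 + (κ * x) ^ 2) * ‖ψ x‖ ^ 2) := by fun_prop
  have c2 : Continuous fun x => 2 * κ ^ 2 * x * ‖ψ x‖ ^ 2
      + (1 + (κ * x) ^ 2) * (2 * (conj (ψ x) * ψ' x).re) := by fun_prop
  have c3 : Continuous fun x => (‖l‖ * K) ^ 2 / κ * ((1 + (κ * x) ^ 2) * ‖u x‖ ^ 2) := by fun_prop
  have hle := intervalIntegral.integral_mono_on (μ := volume) hX ((c1.add c2).intervalIntegrable 0 X)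
    (c3.intervalIntegrable 0 X) key
  simp only [Pi.add_apply] at hle
  rw [intervalIntegral.integral_add (c1.intervalIntegrable 0 X) (c2.intervalIntegrable 0 X),
    intervalIntegral.integral_const_mul, intervalIntegral.integral_const_mul,
    intervalIntegral.integral_eq_sub_of_hasDerivAt (fun x _ => hG x) (c2.intervalIntegrable 0 X)]
    at hle
  simp only [Pi.mul_apply, mul_zero] at hle
  have h0 : ‖ψ 0‖ ^ 2 ≤ K ^ 2 :=
    pow_le_pow_left₀ (norm_nonneg _) ((norm_snd_le _).trans (hK 0 le_rfl)) 2
  have hX' : 0 ≤ (1 + (κ * X) ^ 2) * ‖ψ X‖ ^ 2 := by positivity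
  linarith

/-- The weighted estimate for `crossRatio` on the half line. -/
theorem IsSol.integral_crossRatio_le (h : IsSol u l Φ) (hu : Continuous u) (hl : l ∈ quadrantI)
    {K δ B X : ℝ} (hδ : 0 < δ) (hX : 0 ≤ X)
    (hi : Integrable fun x => (1 + x ^ 2) * ‖u x‖ ^ 2) (hB : ∫ x, (1 + x ^ 2) * ‖u x‖ ^ 2 ≤ B)
    (hK : ∀ x : ℝ, 0 ≤ x → ‖Complex.exp (Complex.I * l ^ 2 * (x : ℂ)) • Φ x‖ ≤ K)
    (hΦ : ∀ x : ℝ, 0 ≤ x → δ ≤ ‖Complex.exp (Complex.I * l ^ 2 * (x : ℂ)) • Φ x‖)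
    (hN : Continuous fun x => crossRatio l (Φ x)) :
    ∫ x in (0 : ℝ)..X, (1 + x ^ 2) * ‖crossRatio l (Φ x)‖ ^ 2
      ≤ (1 + ((l ^ 2).im ^ 2)⁻¹) * ((l.re * δ) ^ 2)⁻¹ * (2 * (l ^ 2).im)⁻¹ *
        (K ^ 2 + (‖l‖ * K) ^ 2 / (l ^ 2).im * ((1 + (l ^ 2).im ^ 2) * B)) := by
  have hκ : 0 < (l ^ 2).im := quadrantI_subset hl
  have hr : 0 < l.re := hl.1
  have he := h.energy hu hκ hX hK
  set κ := (l ^ 2).im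
  have hΦc := h.continuous
  have cψ : Continuous fun x : ℝ => Complex.exp (Complex.I * l ^ 2 * (x : ℂ)) * (Φ x).2 := by
    fun_prop
  -- Return from the weight adapted to κ to the weight 1 + x².
  have hw : ∀ x : ℝ, 1 + x ^ 2 ≤ (1 + (κ ^ 2)⁻¹) * (1 + (κ * x) ^ 2) := fun x => by
    have : (1 + (κ ^ 2)⁻¹) * (1 + (κ * x) ^ 2) = 1 + x ^ 2 + ((κ ^ 2)⁻¹ + (κ * x) ^ 2) := by
      field_simp; ring
    have h2 : 0 ≤ (κ ^ 2)⁻¹ + (κ * x) ^ 2 := by positivity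
    linarith
  have h1 : ∫ x in (0 : ℝ)..X, (1 + x ^ 2) * ‖crossRatio l (Φ x)‖ ^ 2
      ≤ ∫ x in (0 : ℝ)..X, (1 + (κ ^ 2)⁻¹) * ((l.re * δ) ^ 2)⁻¹ * ((1 + (κ * x) ^ 2) *
        ‖Complex.exp (Complex.I * l ^ 2 * (x : ℂ)) * (Φ x).2‖ ^ 2) := by
    refine intervalIntegral.integral_mono_on hX
      (Continuous.intervalIntegrable (by fun_prop) _ _)
      (Continuous.intervalIntegrable (by fun_prop) _ _) fun x hx => ?_
    have e1 := norm_crossRatio_le hr hδ (hΦ x hx.1)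
    rw [crossRatio_smul (Complex.exp_ne_zero _), Prod.smul_snd, smul_eq_mul] at e1
    have e2 := pow_le_pow_left₀ (norm_nonneg _) e1 2
    refine (mul_le_mul (hw x) e2 (by positivity) (by positivity)).trans (le_of_eq ?_)
    rw [div_pow]; ring
  rw [intervalIntegral.integral_const_mul] at h1
  have h2 : ∫ x in (0 : ℝ)..X, (1 + (κ * x) ^ 2) * ‖u x‖ ^ 2 ≤ (1 + κ ^ 2) * B := by
    have a1 : ∫ x in (0 : ℝ)..X, (1 + (κ * x) ^ 2) * ‖u x‖ ^ 2
        ≤ ∫ x in (0 : ℝ)..X, (1 + κ ^ 2) * ((1 + x ^ 2) * ‖u x‖ ^ 2) := by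
      refine intervalIntegral.integral_mono_on hX
        (Continuous.intervalIntegrable (by fun_prop) _ _)
        (Continuous.intervalIntegrable (by fun_prop) _ _) fun x _ => ?_
      rw [← mul_assoc]
      refine mul_le_mul_of_nonneg_right ?_ (sq_nonneg _)
      nlinarith [sq_nonneg x, sq_nonneg κ]
    rw [intervalIntegral.integral_const_mul] at a1
    refine a1.trans (mul_le_mul_of_nonneg_left (le_trans ?_ hB) (by positivity))
    rw [intervalIntegral.integral_of_le hX]
    exact setIntegral_le_integral hi (Eventually.of_forall fun x => by positivity)
  refine h1.trans ?_
  rw [mul_assoc ((1 + (κ ^ 2)⁻¹) * ((l.re * δ) ^ 2)⁻¹)]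
  refine mul_le_mul_of_nonneg_left ?_ (by positivity)
  rw [le_inv_mul_iff₀ (by positivity)]
  refine he.trans (add_le_add le_rfl (mul_le_mul_of_nonneg_left h2 (by positivity)))

end Energy


/-! ### Combinations of Jost solutions -/

section Combination

variable {u : ℝ → ℂ} {l : ℂ}

/-- A linear combination of the two Jost solutions. -/
noncomputable def combination (u : ℝ → ℂ) (l α β : ℂ) (x : ℝ) : ℂ × ℂ :=
  α • solMinus u l x + β • solPlus u l x

theorem isSol_combination (hu : Pot u) (hl : 0 ≤ (l ^ 2).im) (α β : ℂ) :
    IsSol u l (combination u l α β) :=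
  ((isSol_solMinus hu hl).smul α).add ((isSol_solPlus hu hl).smul β)

theorem wronskian_combination (hu : Pot u) (hl : 0 ≤ (l ^ 2).im) (α β : ℂ) (x : ℝ) :
    wronskian (combination u l α β) (solPlus u l) x = α * scatA u l := by
  rw [scatA_eq_wronskian hu hl x]
  simp only [wronskian, combination, Prod.fst_add, Prod.snd_add, Prod.smul_fst, Prod.smul_snd,
    smul_eq_mul]
  ring

theorem combination_ne_zero (hu : Pot u) (hl : 0 ≤ (l ^ 2).im) {α : ℂ} (hα : α ≠ 0) (β : ℂ)
    (ha : scatA u l ≠ 0) (x : ℝ) : combination u l α β x ≠ 0 := by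
  intro h
  have := wronskian_combination hu hl α β x
  rw [wronskian, h] at this
  simp only [Prod.fst_zero, Prod.snd_zero, zero_mul, sub_zero] at this
  exact mul_ne_zero hα ha this.symm

theorem reflectVec_combination (hu : Pot u) (hl : 0 ≤ (l ^ 2).im) (α β : ℂ) :
    reflectVec (combination u l α β) = combination (reflect u) l β α := by
  have h1 := solPlus_eq hu hl
  have h2 := solPlus_eq hu.reflect hl
  rw [reflect_reflect] at h2
  funext x
  simp only [combination, h1, h2, reflectVec, neg_neg, Prod.swap_add, Prod.smul_swap,
    Prod.swap_swap]
  rw [add_comm]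

theorem scatA_reflect (hu : Pot u) (hl : 0 ≤ (l ^ 2).im) :
    scatA (reflect u) l = scatA u l := by
  rw [scatA_eq hu hl, scatA_eq hu.reflect hl, reflect_reflect]; ring

/-- For x ≥ 0 the factor e^{2il²x} in front of the Jost function at +∞ has modulus at most 1. -/
theorem norm_combination_le (hu : Pot u) (hl : 0 ≤ (l ^ 2).im) (α β : ℂ) {E : ℝ}
    (hE : expBound u l ≤ E) {x : ℝ} (hx : 0 ≤ x) :
    ‖Complex.exp (Complex.I * l ^ 2 * (x : ℂ)) • combination u l α β x‖
      ≤ 2 * E * (‖α‖ + ‖β‖) := by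
  have e : Complex.exp (Complex.I * l ^ 2 * (x : ℂ)) • combination u l α β x
      = α • jostMinus u l x + (β * (Complex.exp (Complex.I * l ^ 2 * (x : ℂ)) *
        Complex.exp (Complex.I * l ^ 2 * (x : ℂ)))) • jostPlus u l x := by
    rw [combination, smul_add, smul_comm, exp_mul_solMinus, solPlus, smul_smul, smul_smul]
    congr 2; ring
  have h1 := (norm_jostMinus_le hu hl x).trans (mul_le_mul_of_nonneg_left hE zero_le_two)
  have h2 := (norm_jostPlus_le hu hl x).trans (mul_le_mul_of_nonneg_left hE zero_le_two)
  have h3 : ‖Complex.exp (Complex.I * l ^ 2 * (x : ℂ))‖ ≤ 1 := by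
    rw [Complex.norm_exp, Real.exp_le_one_iff, Complex.re_mul_ofReal, Complex.I_mul_re]
    exact mul_nonpos_of_nonpos_of_nonneg (by linarith) hx
  have h4 : ‖β * (Complex.exp (Complex.I * l ^ 2 * (x : ℂ)) *
      Complex.exp (Complex.I * l ^ 2 * (x : ℂ)))‖ ≤ ‖β‖ := by
    rw [norm_mul, norm_mul]
    exact mul_le_of_le_one_right (norm_nonneg _) (mul_le_one₀ h3 (norm_nonneg _) h3)
  rw [e]
  refine (norm_add_le _ _).trans ?_
  rw [norm_smul, norm_smul]
  have a1 := mul_le_mul_of_nonneg_left h1 (norm_nonneg α)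
  have a2 := mul_le_mul h4 h2 (norm_nonneg _) (norm_nonneg _)
  linarith

/-- The lower bound on a enters here. The Wronskian with the solution at +∞ equals α a at every x,
and the Jost function in it is at most 2E, so the combination cannot be small. The exponentials of
the two factors cancel. -/
theorem le_norm_combination (hu : Pot u) (hl : 0 ≤ (l ^ 2).im) (α β : ℂ) {E d : ℝ}
    (hE : expBound u l ≤ E) (hd : d ≤ ‖scatA u l‖) (x : ℝ) :
    ‖α‖ * d / (4 * E)
      ≤ ‖Complex.exp (Complex.I * l ^ 2 * (x : ℂ)) • combination u l α β x‖ := by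
  have hE0 : 0 < E := lt_of_lt_of_le one_pos ((one_le_expBound u l).trans hE)
  set V := Complex.exp (Complex.I * l ^ 2 * (x : ℂ)) • combination u l α β x with hV
  have hw : V.1 * (jostPlus u l x).2 - V.2 * (jostPlus u l x).1 = α * scatA u l := by
    rw [← wronskian_combination hu hl α β x, ← exp_mul_solPlus, hV, wronskian]
    simp only [Prod.smul_fst, Prod.smul_snd, smul_eq_mul]
    have : Complex.exp (Complex.I * l ^ 2 * (x : ℂ)) * Complex.exp (-(Complex.I * l ^ 2 * (x : ℂ)))
        = 1 := by rw [← Complex.exp_add, add_neg_cancel, Complex.exp_zero]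
    linear_combination ((combination u l α β x).1 * (solPlus u l x).2
      - (combination u l α β x).2 * (solPlus u l x).1) * this
  have h2 := (norm_jostPlus_le hu hl x).trans (mul_le_mul_of_nonneg_left hE zero_le_two)
  have h3 : ‖α‖ * ‖scatA u l‖ ≤ ‖V‖ * (4 * E) := by
    rw [← norm_mul, ← hw]
    refine (norm_sub_le _ _).trans ?_
    rw [norm_mul, norm_mul]
    have a1 := mul_le_mul (norm_fst_le V) ((norm_snd_le _).trans h2) (norm_nonneg _) (norm_nonneg _)
    have a2 := mul_le_mul (norm_snd_le V) ((norm_fst_le _).trans h2) (norm_nonneg _) (norm_nonneg _)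
    linarith
  rw [div_le_iff₀ (by positivity)]
  exact (mul_le_mul_of_nonneg_left hd (norm_nonneg _)).trans h3

theorem IsSol.continuous_crossRatio {Φ : ℝ → ℂ × ℂ} (h : IsSol u l Φ) (hl : 0 < l.re)
    (h0 : ∀ x, Φ x ≠ 0) : Continuous fun x => crossRatio l (Φ x) := by
  have c1 := h.continuous
  have c2 := Complex.continuous_conj
  have c3 := (continuous_m l).comp c1
  exact Continuous.div (by fun_prop) c3 fun x => m_ne_zero hl (h0 x)

theorem integrable_of_halves {f : ℝ → ℝ} (hf : Continuous f) (h0 : ∀ x, 0 ≤ f x) {A : ℝ}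
    (h1 : ∀ X, 0 ≤ X → ∫ x in (0 : ℝ)..X, f x ≤ A)
    (h2 : ∀ X, 0 ≤ X → ∫ x in (0 : ℝ)..X, f (-x) ≤ A) :
    Integrable f ∧ ∫ x, f x ≤ 2 * A := by
  have hb : ∀ X, 0 ≤ X → ∫ x in (-X)..X, f x ≤ 2 * A := fun X hX => by
    rw [← intervalIntegral.integral_add_adjacent_intervals (hf.intervalIntegrable (-X) 0)
      (hf.intervalIntegrable 0 X)]
    have := h2 X hX
    rw [intervalIntegral.integral_comp_neg, neg_zero] at this
    linarith [h1 X hX]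
  have hi : Integrable f := by
    refine integrable_of_intervalIntegral_norm_bounded (l := (atTop : Filter ℝ)) (a := fun X => -X)
      (b := fun X => X) (2 * A) (fun X => hf.integrableOn_Ioc) tendsto_neg_atTop_atBot tendsto_id ?_
    filter_upwards [eventually_ge_atTop (0 : ℝ)] with X hX
    simp only [Real.norm_of_nonneg (h0 _)]
    exact hb X hX
  refine ⟨hi, le_of_tendsto (intervalIntegral_tendsto_integral hi tendsto_neg_atTop_atBot
    tendsto_id) ?_⟩
  filter_upwards [eventually_ge_atTop (0 : ℝ)] with X hX
  exact hb X hX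

/-- The weighted `L²` bound for the scale invariant quantity `f ḡ / m`, uniform in the potential. -/
theorem exists_crossRatio_bound (hl : l ∈ quadrantI) {α β : ℂ} (hα : α ≠ 0) (hβ : β ≠ 0)
    (B E : ℝ) {d : ℝ} (hd : 0 < d) :
    ∃ C, ∀ u, Pot u → Integrable (fun x => (1 + x ^ 2) * ‖u x‖ ^ 2) →
      ∫ x, (1 + x ^ 2) * ‖u x‖ ^ 2 ≤ B → expBound u l ≤ E → d ≤ ‖scatA u l‖ →
      Integrable (fun x => (1 + x ^ 2) * ‖crossRatio l (combination u l α β x)‖ ^ 2) ∧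
      ∫ x, (1 + x ^ 2) * ‖crossRatio l (combination u l α β x)‖ ^ 2 ≤ C := by
  have hi := quadrantI_subset hl
  have hi' : 0 ≤ (l ^ 2).im := le_of_lt hi
  have half : ∀ α β : ℂ, α ≠ 0 → ∃ C, ∀ u, Pot u →
      Integrable (fun x => (1 + x ^ 2) * ‖u x‖ ^ 2) →
      ∫ x, (1 + x ^ 2) * ‖u x‖ ^ 2 ≤ B → expBound u l ≤ E → d ≤ ‖scatA u l‖ → ∀ X, 0 ≤ X →
      ∫ x in (0 : ℝ)..X, (1 + x ^ 2) * ‖crossRatio l (combination u l α β x)‖ ^ 2 ≤ C := by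
    intro α β hα
    refine ⟨(1 + ((l ^ 2).im ^ 2)⁻¹) * ((l.re * (‖α‖ * d / (4 * E))) ^ 2)⁻¹ * (2 * (l ^ 2).im)⁻¹ *
      ((2 * E * (‖α‖ + ‖β‖)) ^ 2 + (‖l‖ * (2 * E * (‖α‖ + ‖β‖))) ^ 2 / (l ^ 2).im *
        ((1 + (l ^ 2).im ^ 2) * B)), fun u hu hui hub hE hda X hX => ?_⟩
    have hE0 : 0 < E := lt_of_lt_of_le one_pos ((one_le_expBound u l).trans hE)
    have ha : scatA u l ≠ 0 := norm_pos_iff.1 (hd.trans_le hda)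
    have hs := isSol_combination hu hi' α β
    exact hs.integral_crossRatio_le hu.cont hl
      (δ := ‖α‖ * d / (4 * E)) (by have := norm_pos_iff.2 hα; positivity) hX hui hub
      (fun x hx => norm_combination_le hu hi' α β hE hx)
      (fun x _ => le_norm_combination hu hi' α β hE hda x)
      (hs.continuous_crossRatio hl.1 (combination_ne_zero hu hi' hα β ha))
  -- The right half line uses α ≠ 0. Reflection exchanges the two Jost solutions, so the left half
  -- line is the same estimate with α and β interchanged and uses β ≠ 0.
  obtain ⟨C₁, h₁⟩ := half α β hα
  obtain ⟨C₂, h₂⟩ := half β α hβ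
  refine ⟨2 * max C₁ C₂, fun u hu hui hub hE hda => ?_⟩
  have ha : scatA u l ≠ 0 := norm_pos_iff.1 (hd.trans_le hda)
  have hs := isSol_combination hu hi' α β
  have hc := hs.continuous_crossRatio hl.1 (combination_ne_zero hu hi' hα β ha)
  refine integrable_of_halves (by fun_prop) (fun x => by positivity)
    (fun X hX => (h₁ u hu hui hub hE hda X hX).trans (le_max_left _ _)) fun X hX => ?_
  have hn : ∀ x, ‖(reflect u) x‖ = ‖u (-x)‖ := fun x => by simp [reflect]
  have e1 : (fun x => (1 + x ^ 2) * ‖(reflect u) x‖ ^ 2)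
      = fun x => (fun y => (1 + y ^ 2) * ‖u y‖ ^ 2) (-x) := by
    funext x; simp only [hn, neg_sq]
  have := h₂ (reflect u) hu.reflect (by rw [e1]; exact hui.comp_neg)
    (by rw [e1, integral_neg_eq_self (fun y => (1 + y ^ 2) * ‖u y‖ ^ 2)]; exact hub)
    (by rw [expBound_reflect]; exact hE) (by rw [scatA_reflect hu hi']; exact hda) X hX
  refine le_trans (le_of_eq ?_) (this.trans (le_max_right _ _))
  rw [← reflectVec_combination hu hi']
  simp only [reflectVec, norm_crossRatio_swap, neg_sq]

end Combination


/-! ### Families of functions with uniformly controlled derivatives -/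

section Tame

variable {ι : Type*} {g : ι → ℝ → ℝ} {F H : ι → ℝ → ℂ}

/-- The functions `F i` are bounded by a common multiple of `g i`. -/
def DomBy (g : ι → ℝ → ℝ) (F : ι → ℝ → ℂ) : Prop := ∃ K, ∀ i x, ‖F i x‖ ≤ K * g i x

/-- The functions `F i` are uniformly bounded and continuously differentiable, with derivatives
dominated by a common multiple of `g i`. -/
def Tame (g : ι → ℝ → ℝ) (F : ι → ℝ → ℂ) : Prop :=
  DomBy 1 F ∧ ∃ F' : ι → ℝ → ℂ, (∀ i x, HasDerivAt (F i) (F' i x) x) ∧ (∀ i, Continuous (F' i)) ∧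
    DomBy g F'

theorem DomBy.add (hF : DomBy g F) (hH : DomBy g H) : DomBy g (F + H) := by
  obtain ⟨K, hK⟩ := hF
  obtain ⟨L, hL⟩ := hH
  exact ⟨K + L, fun i x => (norm_add_le _ _).trans
    ((add_le_add (hK i x) (hL i x)).trans (le_of_eq (by ring)))⟩

theorem DomBy.mul_left (hF : DomBy 1 F) (hH : DomBy g H) : DomBy g (F * H) := by
  obtain ⟨K, hK⟩ := hF
  obtain ⟨L, hL⟩ := hH
  refine ⟨K * L, fun i x => ?_⟩
  simp only [Pi.mul_apply, norm_mul]
  have h1 : ‖F i x‖ ≤ K := by simpa using hK i x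
  calc ‖F i x‖ * ‖H i x‖ ≤ K * (L * g i x) :=
        mul_le_mul h1 (hL i x) (norm_nonneg _) ((norm_nonneg _).trans h1)
    _ = K * L * g i x := by ring

theorem DomBy.mul_right (hF : DomBy g F) (hH : DomBy 1 H) : DomBy g (F * H) := by
  rw [mul_comm]; exact hH.mul_left hF

theorem domBy_const (c : ℂ) : DomBy 1 (fun (_ : ι) (_ : ℝ) => c) := ⟨‖c‖, fun _ _ => by simp⟩

theorem Tame.continuous (hF : Tame g F) (i : ι) : Continuous (F i) := by
  obtain ⟨_, F', h, _⟩ := hF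
  exact continuous_iff_continuousAt.2 fun x => (h i x).continuousAt

theorem Tame.add (hF : Tame g F) (hH : Tame g H) : Tame g (F + H) := by
  obtain ⟨b, F', d, c, e⟩ := hF
  obtain ⟨b₂, H', d₂, c₂, e₂⟩ := hH
  exact ⟨b.add b₂, F' + H', fun i x => (d i x).add (d₂ i x), fun i => (c i).add (c₂ i), e.add e₂⟩

/-- Together with sums and constants this makes the controlled families an algebra, so polynomial
expressions inherit the bounds. The index keeps all constants common to the whole family. -/
theorem Tame.mul (hF : Tame g F) (hH : Tame g H) : Tame g (F * H) := by
  have hFc := hF.continuous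
  have hHc := hH.continuous
  obtain ⟨b, F', d, c, e⟩ := hF
  obtain ⟨b₂, H', d₂, c₂, e₂⟩ := hH
  exact ⟨b.mul_left b₂, F' * H + F * H', fun i x => (d i x).mul (d₂ i x),
    fun i => ((c i).mul (hHc i)).add ((hFc i).mul (c₂ i)), (e.mul_right b₂).add (b.mul_left e₂)⟩

theorem tame_const (g : ι → ℝ → ℝ) (c : ℂ) : Tame g (fun (_ : ι) (_ : ℝ) => c) :=
  ⟨domBy_const c, fun _ _ => 0, fun _ x => hasDerivAt_const x c, fun _ => continuous_const,
    0, fun _ _ => by simp⟩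

end Tame

/-! ### The scale invariant quantities of a solution -/

section Ratios

variable {u v : ℝ → ℂ} {l : ℂ} {Φ : ℝ → ℂ × ℂ}

/-- The scale invariant quantity `|f|² / m_l(Φ, Φ)`. -/
noncomputable def fstRatio (l : ℂ) (v : ℂ × ℂ) : ℂ := v.1 * conj v.1 / m l v v

/-- The scale invariant quantity `f̄ g / m_l(Φ, Φ)`. -/
noncomputable def crossRatio' (l : ℂ) (v : ℂ × ℂ) : ℂ := v.2 * conj v.1 / m l v v

theorem norm_crossRatio' (l : ℂ) (v : ℂ × ℂ) : ‖crossRatio' l v‖ = ‖crossRatio l v‖ := by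
  unfold crossRatio' crossRatio
  simp only [norm_div, norm_mul, RCLike.norm_conj, mul_comm]

theorem norm_div_m_le (hl : 0 < l.re) {v : ℂ × ℂ} (hv : v ≠ 0) {z : ℂ} (hz : ‖z‖ ≤ ‖v‖ ^ 2) :
    ‖z / m l v v‖ ≤ l.re⁻¹ := by
  have h1 := norm_sq_le_m hl v
  have h2 : 0 < ‖m l v v‖ := norm_pos_iff.2 (m_ne_zero hl hv)
  rw [norm_div, inv_eq_one_div, div_le_div_iff₀ h2 hl, one_mul, mul_comm]
  exact (mul_le_mul_of_nonneg_left hz hl.le).trans h1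

theorem norm_fstRatio_le (hl : 0 < l.re) {v : ℂ × ℂ} (hv : v ≠ 0) :
    ‖fstRatio l v‖ ≤ l.re⁻¹ := by
  refine norm_div_m_le hl hv ?_
  rw [norm_mul, RCLike.norm_conj, sq]
  have := norm_fst_le v
  gcongr

theorem norm_crossRatio_le_inv (hl : 0 < l.re) {v : ℂ × ℂ} (hv : v ≠ 0) :
    ‖crossRatio l v‖ ≤ l.re⁻¹ := by
  refine norm_div_m_le hl hv ?_
  rw [norm_mul, RCLike.norm_conj, sq]
  have h1 := norm_fst_le v
  have h2 := norm_snd_le v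
  gcongr

/-- The identity l|f|² + l̄|g|² = m eliminates |g|²/m, so the coefficient is affine in |f|²/m alone.
-/
theorem coeffC_eq (hl : 0 < l.re) {v : ℂ × ℂ} (hv : v ≠ 0) :
    coeffC l v = l / conj l + -((l ^ 2 - conj l ^ 2) / conj l) * fstRatio l v := by
  have hm := m_ne_zero hl hv
  have h0 : conj l ≠ 0 := by rw [map_ne_zero]; rintro rfl; simp at hl
  unfold coeffC fstRatio
  field_simp
  simp only [m, Complex.conj_conj]
  ring

theorem ratio_identity {X X' M M' : ℂ} (hM : M ≠ 0) :
    (X' * M - X * M') / M ^ 2 = X' / M - X / M * (M' / M) := by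
  field_simp

/-- The diagonal terms J cancel in m', since α and its conjugate carry opposite multiples of J. -/
theorem m_deriv_identity {f fb g gb l lb u ub α αb J M μ I : ℂ}
    (hM : M = l * f * fb + lb * g * gb) (h0 : M ≠ 0)
    (hα : α = -(I * l ^ 2) + J) (hαb : αb = I * lb ^ 2 - J)
    (hμ : μ = (l * ((α * f + l * u * g) * fb + f * (αb * fb + lb * ub * gb)) +
      lb * ((-(l * ub) * f - α * g) * gb + g * (-(lb * u) * fb - αb * gb))) / M) :
    μ = -(I * (l ^ 2 - lb ^ 2)) * (2 * l * (f * fb / M) - 1)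
      + (l ^ 2 - lb ^ 2) * u * (g * fb / M) := by
  rw [hμ]
  field_simp
  rw [hM, hα, hαb]
  ring

theorem conj_fst_deriv (q : ℝ → ℂ) (l : ℂ) (x : ℝ) (v : ℂ × ℂ) :
    conj (diagCoeff q l x * v.1 + l * q x * v.2) =
      (Complex.I * conj l ^ 2 - Complex.I / 4 * (q x * conj (q x))) * conj v.1
        + conj l * conj (q x) * conj v.2 := by
  rw [← conj_diagCoeff]; simp only [map_add, map_mul]

theorem conj_snd_deriv (q : ℝ → ℂ) (l : ℂ) (x : ℝ) (v : ℂ × ℂ) :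
    conj (-(l * conj (q x)) * v.1 - diagCoeff q l x * v.2) =
      -(conj l * q x) * conj v.1
        - (Complex.I * conj l ^ 2 - Complex.I / 4 * (q x * conj (q x))) * conj v.2 := by
  rw [← conj_diagCoeff]; simp only [map_sub, map_neg, map_mul, Complex.conj_conj]

/-- The logarithmic derivative of `m_l(Φ, Φ)`. -/
noncomputable def logDerivM (l : ℂ) (u : ℂ) (v : ℂ × ℂ) : ℂ :=
  -(Complex.I * (l ^ 2 - conj l ^ 2)) * (2 * l * fstRatio l v - 1)
      + (l ^ 2 - conj l ^ 2) * u * crossRatio' l v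

theorem IsSol.hasDerivAt_div_m (h : IsSol u l Φ) (hl : 0 < l.re) (h0 : ∀ x, Φ x ≠ 0) {X : ℝ → ℂ}
    {X' : ℂ} {x : ℝ} (hX : HasDerivAt X X' x) :
    HasDerivAt (fun x => X x / m l (Φ x) (Φ x))
      (X' / m l (Φ x) (Φ x) - X x / m l (Φ x) (Φ x) * logDerivM l (u x) (Φ x)) x := by
  have hm := m_ne_zero hl (h0 x)
  refine (hX.div (hasDerivAt_m (h.1 x) (h.2 x) l) hm).congr_deriv ?_
  rw [ratio_identity hm]
  congr 2
  rw [conj_fst_deriv, conj_snd_deriv]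
  exact m_deriv_identity (I := Complex.I) (M := m l (Φ x) (Φ x)) (lb := conj l)
    (ub := conj (u x)) (fb := conj (Φ x).1) (gb := conj (Φ x).2)
    (J := Complex.I / 4 * (u x * conj (u x))) rfl hm rfl rfl rfl

/-- What matters is that every term on the right contains f ḡ/m or f̄ g/m. The terms free of u
combine to a multiple of |f|²|g|²/m², which is the product of these two ratios. -/
theorem fst_identity {f fb g gb l lb u ub α αb J M I k : ℂ}
    (hM : M = l * f * fb + lb * g * gb) (h0 : M ≠ 0) (hk : k = l ^ 2 - lb ^ 2)
    (hα : α = -(I * l ^ 2) + J) (hαb : αb = I * lb ^ 2 - J) :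
    ((α * f + l * u * g) * fb + f * (αb * fb + lb * ub * gb)) / M
      - f * fb / M * (-(I * k) * (2 * l * (f * fb / M) - 1) + k * u * (g * fb / M))
    = (-2 * I * k * lb) * (f * gb / M) * (g * fb / M) + l * u * (g * fb / M)
      + lb * ub * (f * gb / M) + (-k) * u * (f * fb / M) * (g * fb / M) := by
  field_simp
  rw [hα, hαb]
  rw [hM, hk]
  ring

/-- After |g|²/m is eliminated, every term carries either the ratio itself or a factor u, so the
derivative is weighted square integrable along with them. -/
theorem cross_identity {f fb g gb l lb u α αb J M I k : ℂ}
    (hM : M = l * f * fb + lb * g * gb) (h0 : M ≠ 0) (hlb : lb ≠ 0)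
    (hα : α = -(I * l ^ 2) + J) (hαb : αb = I * lb ^ 2 - J) :
    ((α * f + l * u * g) * gb + f * (-(lb * u) * fb - αb * gb)) / M
      - f * gb / M * (-(I * k) * (2 * l * (f * fb / M) - 1) + k * u * (g * fb / M))
    = (-(I * (l ^ 2 + lb ^ 2)) - I * k + 2 * J + (2 * I * k * l) * (f * fb / M)
        + (-k) * u * (g * fb / M)) * (f * gb / M)
      + u * (l / lb + (-(l ^ 2 / lb) - lb) * (f * fb / M)) := by
  have e : g * gb / M = (1 - l * (f * fb / M)) / lb := by
    field_simp; rw [hM]; ring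
  have e1 : ((α * f + l * u * g) * gb + f * (-(lb * u) * fb - αb * gb)) / M
      = (α - αb) * (f * gb / M) + l * u * (g * gb / M) - lb * u * (f * fb / M) := by
    field_simp; ring
  rw [e1, e, hα, hαb]
  field_simp
  ring

theorem cross_identity' {f fb g gb l lb u ub α αb J M I k : ℂ}
    (hM : M = l * f * fb + lb * g * gb) (h0 : M ≠ 0) (hlb : lb ≠ 0)
    (hα : α = -(I * l ^ 2) + J) (hαb : αb = I * lb ^ 2 - J) :
    ((-(l * ub) * f - α * g) * fb + g * (αb * fb + lb * ub * gb)) / M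
      - g * fb / M * (-(I * k) * (2 * l * (f * fb / M) - 1) + k * u * (g * fb / M))
    = (I * (l ^ 2 + lb ^ 2) - I * k + (-2) * J + (2 * I * k * l) * (f * fb / M)
        + (-k) * u * (g * fb / M)) * (g * fb / M)
      + ub * (1 + (-(2 * l)) * (f * fb / M)) := by
  have e : g * gb / M = (1 - l * (f * fb / M)) / lb := by
    field_simp; rw [hM]; ring
  have e1 : ((-(l * ub) * f - α * g) * fb + g * (αb * fb + lb * ub * gb)) / M
      = (αb - α) * (g * fb / M) + lb * ub * (g * gb / M) - l * ub * (f * fb / M) := by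
    field_simp; ring
  rw [e1, e, hα, hαb]
  field_simp
  ring

end Ratios


/-! ### Second derivatives of the scale invariant quantities -/

section Families

variable {ι : Type*} {l : ℂ} {u v : ι → ℝ → ℂ} {Φ : ι → ℝ → ℂ × ℂ} {B : ℝ}

/-- The function that dominates the derivatives of the scale invariant quantities. -/
noncomputable def control (l : ℂ) (u v : ℝ → ℂ) (Φ : ℝ → ℂ × ℂ) (x : ℝ) : ℝ :=
  ‖crossRatio l (Φ x)‖ + ‖u x‖ + ‖v x‖

/-- The three ratios form a closed polynomial system over u and ū, and every monomial has a factor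
that is a cross ratio, u or ū. Differentiating once more only adds v, so `control` dominates both
orders of derivatives, uniformly over the family. -/
theorem exists_ratio_derivs (hl : l ∈ quadrantI) (hu : ∀ i x, HasDerivAt (u i) (v i x) x)
    (hv : ∀ i, Continuous (v i)) (hB : ∀ i x, ‖u i x‖ ≤ B) (hs : ∀ i, IsSol (u i) l (Φ i))
    (h0 : ∀ i x, Φ i x ≠ 0) :
    ∃ P₁ N₁ : ι → ℝ → ℂ,
      (∀ i x, HasDerivAt (fun x => fstRatio l (Φ i x)) (P₁ i x) x) ∧
      (∀ i x, HasDerivAt (fun x => crossRatio l (Φ i x)) (N₁ i x) x) ∧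
      Tame (fun i => control l (u i) (v i) (Φ i)) P₁ ∧
      Tame (fun i => control l (u i) (v i) (Φ i)) N₁ ∧
      DomBy (fun i => control l (u i) (v i) (Φ i)) P₁ ∧
      DomBy (fun i => control l (u i) (v i) (Φ i)) N₁ := by
  have hr : 0 < l.re := hl.1
  have hl0 : conj l ≠ 0 := by rw [map_ne_zero]; rintro rfl; simp at hr
  set g : ι → ℝ → ℝ := fun i => control l (u i) (v i) (Φ i) with hg
  set k := l ^ 2 - conj l ^ 2 with hk
  let cst : ℂ → ι → ℝ → ℂ := fun c _ _ => c
  let ub : ι → ℝ → ℂ := fun i x => conj (u i x)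
  let P : ι → ℝ → ℂ := fun i x => fstRatio l (Φ i x)
  let N : ι → ℝ → ℂ := fun i x => crossRatio l (Φ i x)
  let R : ι → ℝ → ℂ := fun i x => crossRatio' l (Φ i x)
  have bc : ∀ c, DomBy 1 (cst c) := fun c => domBy_const c
  have tc : ∀ c, Tame g (cst c) := fun c => tame_const g c
  have bu : DomBy 1 u := ⟨B, fun i x => by simpa using hB i x⟩
  have bub : DomBy 1 ub := ⟨B, fun i x => by simpa [ub] using hB i x⟩
  have bP : DomBy 1 P := ⟨l.re⁻¹, fun i x => by simpa using norm_fstRatio_le hr (h0 i x)⟩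
  have bN : DomBy 1 N := ⟨l.re⁻¹, fun i x => by simpa using norm_crossRatio_le_inv hr (h0 i x)⟩
  have bR : DomBy 1 R := ⟨l.re⁻¹, fun i x => by
    simpa [R, norm_crossRatio'] using norm_crossRatio_le_inv hr (h0 i x)⟩
  have du : DomBy g u := ⟨1, fun i x => by
    rw [one_mul]; exact (le_add_of_nonneg_left (norm_nonneg _)).trans
      (le_add_of_nonneg_right (norm_nonneg _))⟩
  have dub : DomBy g ub := ⟨1, fun i x => by
    rw [one_mul]; simp only [ub, RCLike.norm_conj]
    exact (le_add_of_nonneg_left (norm_nonneg _)).trans (le_add_of_nonneg_right (norm_nonneg _))⟩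
  have dN : DomBy g N := ⟨1, fun i x => by
    rw [one_mul]; exact (le_add_of_nonneg_right (norm_nonneg _)).trans
      (le_add_of_nonneg_right (norm_nonneg _))⟩
  have dR : DomBy g R := ⟨1, fun i x => by
    rw [one_mul]; simp only [R, norm_crossRatio']
    exact (le_add_of_nonneg_right (norm_nonneg _)).trans
      (le_add_of_nonneg_right (norm_nonneg _))⟩
  have tu : Tame g u := ⟨bu, v, hu, hv, 1, fun i x => by
    rw [one_mul]; exact le_add_of_nonneg_left (by positivity)⟩
  have tub : Tame g ub := ⟨bub, fun i x => conj (v i x), fun i x => hasDerivAt_conj (hu i x),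
    fun i => Complex.continuous_conj.comp (hv i), 1, fun i x => by
    rw [one_mul, RCLike.norm_conj]; exact le_add_of_nonneg_left (by positivity)⟩
  -- P₁, N₁ and R₁ are the right-hand sides of the system. R is carried along because the
  -- derivatives of P and N involve it.
  let P₁ : ι → ℝ → ℂ := cst (-2 * Complex.I * k * conj l) * N * R + cst l * u * R
    + cst (conj l) * ub * N + cst (-k) * u * P * R
  let N₁ : ι → ℝ → ℂ := (cst (-(Complex.I * (l ^ 2 + conj l ^ 2)) - Complex.I * k)
    + cst 2 * (cst (Complex.I / 4) * (u * ub)) + cst (2 * Complex.I * k * l) * P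
    + cst (-k) * u * R) * N + u * (cst (l / conj l) + cst (-(l ^ 2 / conj l) - conj l) * P)
  let R₁ : ι → ℝ → ℂ := (cst (Complex.I * (l ^ 2 + conj l ^ 2) - Complex.I * k)
    + cst (-2) * (cst (Complex.I / 4) * (u * ub)) + cst (2 * Complex.I * k * l) * P
    + cst (-k) * u * R) * R + ub * (cst 1 + cst (-(2 * l)) * P)
  have eP : ∀ i x, HasDerivAt (P i) (P₁ i x) x := fun i x => by
    refine ((hs i).hasDerivAt_div_m hr (h0 i)
      (((hs i).1 x).mul (hasDerivAt_conj ((hs i).1 x)))).congr_deriv ?_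
    rw [conj_fst_deriv]
    exact fst_identity (I := Complex.I) (M := m l (Φ i x) (Φ i x)) (lb := conj l)
      (ub := conj (u i x)) (fb := conj (Φ i x).1) (gb := conj (Φ i x).2)
      (J := Complex.I / 4 * (u i x * conj (u i x))) rfl (m_ne_zero hr (h0 i x)) hk rfl rfl
  have eN : ∀ i x, HasDerivAt (N i) (N₁ i x) x := fun i x => by
    refine ((hs i).hasDerivAt_div_m hr (h0 i)
      (((hs i).1 x).mul (hasDerivAt_conj ((hs i).2 x)))).congr_deriv ?_
    rw [conj_snd_deriv]
    exact cross_identity (I := Complex.I) (M := m l (Φ i x) (Φ i x)) (lb := conj l)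
      (fb := conj (Φ i x).1) (gb := conj (Φ i x).2)
      (J := Complex.I / 4 * (u i x * conj (u i x))) rfl (m_ne_zero hr (h0 i x)) hl0 rfl rfl
  have eR : ∀ i x, HasDerivAt (R i) (R₁ i x) x := fun i x => by
    refine ((hs i).hasDerivAt_div_m hr (h0 i)
      (((hs i).2 x).mul (hasDerivAt_conj ((hs i).1 x)))).congr_deriv ?_
    rw [conj_fst_deriv]
    exact cross_identity' (I := Complex.I) (M := m l (Φ i x) (Φ i x)) (lb := conj l)
      (ub := conj (u i x)) (fb := conj (Φ i x).1) (gb := conj (Φ i x).2)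
      (J := Complex.I / 4 * (u i x * conj (u i x))) rfl (m_ne_zero hr (h0 i x)) hl0 rfl rfl
  have cP : ∀ i, Continuous (P i) := fun i =>
    continuous_iff_continuousAt.2 fun x => (eP i x).continuousAt
  have cN : ∀ i, Continuous (N i) := fun i =>
    continuous_iff_continuousAt.2 fun x => (eN i x).continuousAt
  have cR : ∀ i, Continuous (R i) := fun i =>
    continuous_iff_continuousAt.2 fun x => (eR i x).continuousAt
  have cu := tu.continuous
  have cub := tub.continuous
  have cc : ∀ c i, Continuous (cst c i) := fun c i => continuous_const
  have cP₁ : ∀ i, Continuous (P₁ i) := fun i =>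
    ((((((cc _ i).mul (cN i)).mul (cR i)).add (((cc _ i).mul (cu i)).mul (cR i))).add
      (((cc _ i).mul (cub i)).mul (cN i))).add ((((cc _ i).mul (cu i)).mul (cP i)).mul (cR i)))
  have cA : ∀ c d e f i, Continuous ((cst c + cst d * (cst e * (u * ub)) + cst f * P
      + cst (-k) * u * R) i) := fun c d e f i =>
    ((((cc _ i).add ((cc _ i).mul ((cc _ i).mul ((cu i).mul (cub i))))).add
      ((cc _ i).mul (cP i))).add (((cc _ i).mul (cu i)).mul (cR i)))
  have cN₁ : ∀ i, Continuous (N₁ i) := fun i =>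
    ((cA _ _ _ _ i).mul (cN i)).add ((cu i).mul ((cc _ i).add ((cc _ i).mul (cP i))))
  have cR₁ : ∀ i, Continuous (R₁ i) := fun i =>
    ((cA _ _ _ _ i).mul (cR i)).add ((cub i).mul ((cc _ i).add ((cc _ i).mul (cP i))))
  have dP₁ : DomBy g P₁ := (((((bc _).mul_left bN).mul_left dR).add
    (((bc _).mul_left bu).mul_left dR)).add (((bc _).mul_left bub).mul_left dN)).add
    ((((bc _).mul_left bu).mul_left bP).mul_left dR)
  have bA : ∀ c d e f, DomBy 1 (cst c + cst d * (cst e * (u * ub)) + cst f * P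
      + cst (-k) * u * R) := fun c d e f =>
    ((((bc _).add ((bc _).mul_left ((bc _).mul_left (bu.mul_left bub)))).add
      ((bc _).mul_left bP)).add (((bc _).mul_left bu).mul_left bR))
  have dN₁ : DomBy g N₁ := ((bA _ _ _ _).mul_left dN).add
    (du.mul_right ((bc _).add ((bc _).mul_left bP)))
  have dR₁ : DomBy g R₁ := ((bA _ _ _ _).mul_left dR).add
    (dub.mul_right ((bc _).add ((bc _).mul_left bP)))
  have tP : Tame g P := ⟨bP, P₁, eP, cP₁, dP₁⟩
  have tN : Tame g N := ⟨bN, N₁, eN, cN₁, dN₁⟩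
  have tR : Tame g R := ⟨bR, R₁, eR, cR₁, dR₁⟩
  have tP₁ : Tame g P₁ := (((((tc _).mul tN).mul tR).add
    (((tc _).mul tu).mul tR)).add (((tc _).mul tub).mul tN)).add
    ((((tc _).mul tu).mul tP).mul tR)
  have tN₁ : Tame g N₁ := (((((tc _).add ((tc _).mul ((tc _).mul (tu.mul tub)))).add
    ((tc _).mul tP)).add (((tc _).mul tu).mul tR)).mul tN).add
    (tu.mul ((tc _).add ((tc _).mul tP)))
  exact ⟨P₁, N₁, eP, eN, tP₁, tN₁, dP₁, dN₁⟩

end Families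

/-! ### The transformed potential -/

section Transform

/-- A sum `S u + N` with controlled coefficients inherits the regularity of `u`. -/
theorem XRep.transform {u v w S S₁ S₂ N N₁ N₂ : ℝ → ℂ} {G : ℝ → ℝ} {M K C : ℝ}
    (h : XRep u v w M) (hS : ∀ x, HasDerivAt S (S₁ x) x) (hS₁ : ∀ x, HasDerivAt S₁ (S₂ x) x)
    (hN : ∀ x, HasDerivAt N (N₁ x) x) (hN₁ : ∀ x, HasDerivAt N₁ (N₂ x) x)
    (cS : Continuous S₂) (cN : Continuous N₂) (G0 : ∀ x, 0 ≤ G x)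
    (hG : Integrable fun x => (1 + x ^ 2) * G x ^ 2) (hC : ∫ x, (1 + x ^ 2) * G x ^ 2 ≤ C)
    (bu : ∀ x, ‖u x‖ ≤ G x) (bv : ∀ x, ‖v x‖ ≤ G x) (bu' : ∀ x, ‖u x‖ ≤ K)
    (bS : ∀ x, ‖S x‖ ≤ K) (bS₁ : ∀ x, ‖S₁ x‖ ≤ K) (bS₂ : ∀ x, ‖S₂ x‖ ≤ K * G x)
    (bN : ∀ x, ‖N x‖ ≤ K * G x) (bN₁ : ∀ x, ‖N₁ x‖ ≤ K * G x) (bN₂ : ∀ x, ‖N₂ x‖ ≤ K * G x) :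
    XRep (fun x => S x * u x + N x) (fun x => S₁ x * u x + S x * v x + N₁ x)
      (fun x => S₂ x * u x + 2 * S₁ x * v x + S x * w x + N₂ x)
      (1 + (9 * K ^ 2 * C + 2 * (K ^ 2 + 3 * K) ^ 2 * C + 2 * K ^ 2 * M ^ 2)) := by
  have hK : 0 ≤ K := (norm_nonneg _).trans (bS 0)
  have hC0 : 0 ≤ C := (integral_nonneg fun x => by positivity).trans hC
  have ccS₁ : Continuous S₁ := continuous_iff_continuousAt.2 fun x => (hS₁ x).continuousAt
  have ccS : Continuous S := continuous_iff_continuousAt.2 fun x => (hS x).continuousAt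
  have ccN₁ : Continuous N₁ := continuous_iff_continuousAt.2 fun x => (hN₁ x).continuousAt
  have ccN : Continuous N := continuous_iff_continuousAt.2 fun x => (hN x).continuousAt
  have cu := h.continuous_u
  have cv := h.continuous_v
  have mw : AEStronglyMeasurable w volume := h.hw.aestronglyMeasurable
  -- D adds the bound for the squares of functions at most 3KG and the bound for the square of (K² +
  -- 3K)G + K|w|. The radius 1 + D avoids a square root, as D ≤ (1 + D)².
  set D := 9 * K ^ 2 * C + 2 * (K ^ 2 + 3 * K) ^ 2 * C + 2 * K ^ 2 * M ^ 2 with hD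
  have hD0 : 0 ≤ D := by positivity
  have hDD : D ≤ (1 + D) ^ 2 := by nlinarith
  have p1 : ∀ x, ‖S x * u x + N x‖ ≤ 3 * K * G x := fun x => by
    refine (norm_add_le _ _).trans ?_
    rw [norm_mul]
    have := mul_le_mul (bS x) (bu x) (norm_nonneg _) hK
    have := bN x
    have := mul_nonneg hK (G0 x)
    linarith
  have p2 : ∀ x, ‖S₁ x * u x + S x * v x + N₁ x‖ ≤ 3 * K * G x := fun x => by
    refine (norm_add₃_le).trans ?_
    rw [norm_mul, norm_mul]
    have := mul_le_mul (bS₁ x) (bu x) (norm_nonneg _) hK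
    have := mul_le_mul (bS x) (bv x) (norm_nonneg _) hK
    have := bN₁ x
    linarith
  have p3 : ∀ x, ‖S₂ x * u x + 2 * S₁ x * v x + S x * w x + N₂ x‖
      ≤ (K ^ 2 + 3 * K) * G x + K * ‖w x‖ := fun x => by
    refine (norm_add_le _ _).trans ((add_le_add_left norm_add₃_le _).trans ?_)
    rw [norm_mul, norm_mul, norm_mul, norm_mul, Complex.norm_two]
    have := mul_le_mul (bS₂ x) (bu' x) (norm_nonneg _) (mul_nonneg hK (G0 x))
    have := mul_le_mul (bS₁ x) (bv x) (norm_nonneg _) hK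
    have := mul_le_mul_of_nonneg_right (bS x) (norm_nonneg (w x))
    have := bN₂ x
    linarith
  have main : ∀ f : ℝ → ℂ, Continuous f → (∀ x, ‖f x‖ ≤ 3 * K * G x) →
      Integrable (fun x => (1 + x ^ 2) * ‖f x‖ ^ 2) ∧
        ∫ x, (1 + x ^ 2) * ‖f x‖ ^ 2 ≤ (1 + D) ^ 2 := by
    intro f cf hf
    have pt : ∀ x, (1 + x ^ 2) * ‖f x‖ ^ 2 ≤ 9 * K ^ 2 * ((1 + x ^ 2) * G x ^ 2) := fun x => by
      have := mul_le_mul_of_nonneg_left (pow_le_pow_left₀ (norm_nonneg _) (hf x) 2)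
        (by positivity : 0 ≤ 1 + x ^ 2)
      refine this.trans (le_of_eq (by ring))
    have hi : Integrable (fun x => (1 + x ^ 2) * ‖f x‖ ^ 2) :=
      (hG.const_mul (9 * K ^ 2)).mono' (Continuous.aestronglyMeasurable (by fun_prop))
        (Eventually.of_forall fun x => by
          rw [Real.norm_of_nonneg (by positivity)]; exact pt x)
    refine ⟨hi, ?_⟩
    have := integral_mono hi (hG.const_mul (9 * K ^ 2)) pt
    rw [integral_const_mul] at this
    refine this.trans (le_trans ?_ hDD)
    have h1 := mul_le_mul_of_nonneg_left hC (by positivity : 0 ≤ 9 * K ^ 2)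
    have h2 : 0 ≤ 2 * (K ^ 2 + 3 * K) ^ 2 * C := by positivity
    have h3 : 0 ≤ 2 * K ^ 2 * M ^ 2 := by positivity
    linarith
  have m1 := main (fun x => S x * u x + N x) (by fun_prop) p1
  have m2 := main (fun x => S₁ x * u x + S x * v x + N₁ x) (by fun_prop) p2
  have mm : AEStronglyMeasurable
      (fun x => S₂ x * u x + 2 * S₁ x * v x + S x * w x + N₂ x) volume := by
    refine AEStronglyMeasurable.add (AEStronglyMeasurable.add ?_
      (ccS.aestronglyMeasurable.mul mw)) cN.aestronglyMeasurable
    exact Continuous.aestronglyMeasurable (by fun_prop)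
  have pt3 : ∀ x, ‖S₂ x * u x + 2 * S₁ x * v x + S x * w x + N₂ x‖ ^ 2
      ≤ 2 * (K ^ 2 + 3 * K) ^ 2 * ((1 + x ^ 2) * G x ^ 2) + 2 * K ^ 2 * ‖w x‖ ^ 2 := fun x => by
    have h1 := pow_le_pow_left₀ (norm_nonneg _) (p3 x) 2
    have h2 : 0 ≤ (K ^ 2 + 3 * K) ^ 2 * (x ^ 2 * G x ^ 2) := by positivity
    nlinarith [sq_nonneg ((K ^ 2 + 3 * K) * G x - K * ‖w x‖)]
  have i3 := (hG.const_mul (2 * (K ^ 2 + 3 * K) ^ 2)).add (h.iw.const_mul (2 * K ^ 2))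
  have m3 : Integrable (fun x => ‖S₂ x * u x + 2 * S₁ x * v x + S x * w x + N₂ x‖ ^ 2) :=
    i3.mono' (mm.norm.pow 2) (Eventually.of_forall fun x => by
      rw [Real.norm_of_nonneg (by positivity)]; exact pt3 x)
  have lw : LocallyIntegrable (fun x => S₂ x * u x + 2 * S₁ x * v x + S x * w x + N₂ x) volume :=
    ((memLp_two_iff_integrable_sq_norm mm).2 m3).locallyIntegrable one_le_two
  refine ⟨fun x => ((hS x).mul (h.hu x)).add (hN x), lw, fun x => ?_, m1.1, m1.2, m2.1, m2.2,
    m3, ?_⟩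
  -- Only S v needs the product rule for primitives, since w is merely locally integrable; S₁u + N₁
  -- is classically differentiable.
  · have e1 := integral_product_rule hS ccS₁ h.hw h.hv 0 x
    have c2 : Continuous fun t => S₂ t * u t + S₁ t * v t + N₂ t := by fun_prop
    have e2 := intervalIntegral.integral_eq_sub_of_hasDerivAt
      (fun t (_ : t ∈ uIcc 0 x) => ((hS₁ t).mul (h.hu t)).add (hN₁ t))
      (c2.intervalIntegrable 0 x)
    have hwi : IntervalIntegrable (fun t => S₁ t * v t + S t * w t) volume 0 x :=
      ((ccS₁.mul cv).intervalIntegrable 0 x).add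
        ((intervalIntegrable_of_locallyIntegrable h.hw 0 x).continuousOn_mul ccS.continuousOn)
    have e3 := intervalIntegral.integral_add (c2.intervalIntegrable 0 x) hwi (μ := volume)
    have e4 : (fun t => (S₂ t * u t + S₁ t * v t + N₂ t) + (S₁ t * v t + S t * w t))
        = fun t => S₂ t * u t + 2 * S₁ t * v t + S t * w t + N₂ t := by funext t; ring
    rw [e4] at e3
    rw [e3, e1, e2]
    simp only [Pi.add_apply, Pi.mul_apply]
    ring
  · refine (integral_mono m3 i3 pt3).trans (le_trans ?_ hDD)
    rw [integral_add' (hG.const_mul _) (h.iw.const_mul _), integral_const_mul, integral_const_mul]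
    have h1 := mul_le_mul_of_nonneg_left hC (by positivity : 0 ≤ 2 * (K ^ 2 + 3 * K) ^ 2)
    have h2 := mul_le_mul_of_nonneg_left h.bw (by positivity : 0 ≤ 2 * K ^ 2)
    have h3 : 0 ≤ 9 * K ^ 2 * C := by positivity
    linarith

end Transform


/-! ### Uniform bound for the Darboux transform -/

section Bound

variable {l : ℂ}

theorem combination_one (u : ℝ → ℂ) (l c : ℂ) :
    combination u l 1 c = jostCombination u l c := by
  funext x; simp only [combination, jostCombination, one_smul]

theorem darboux_eq (hl : 0 < l.re) {Φ : ℝ → ℂ × ℂ} (h0 : ∀ x, Φ x ≠ 0) (u : ℝ → ℂ) :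
    darboux Φ l u = fun x => (l / conj l + -((l ^ 2 - conj l ^ 2) / conj l) * fstRatio l (Φ x))
      * u x + -(2 * Complex.I * (l ^ 2 - conj l ^ 2)) * crossRatio l (Φ x) := by
  funext x
  rw [darboux, coeffC_eq hl (h0 x), coeffD, crossRatio]
  ring

section Control

variable {u v : ℝ → ℂ} {Φ : ℝ → ℂ × ℂ}

theorem control_nonneg (x : ℝ) : 0 ≤ control l u v Φ x := by
  unfold control; positivity

theorem norm_fst_le_control (x : ℝ) : ‖u x‖ ≤ control l u v Φ x :=
  (le_add_of_nonneg_left (norm_nonneg _)).trans (le_add_of_nonneg_right (norm_nonneg _))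

theorem norm_snd_le_control (x : ℝ) : ‖v x‖ ≤ control l u v Φ x :=
  le_add_of_nonneg_left (by positivity)

theorem norm_crossRatio_le_control (x : ℝ) : ‖crossRatio l (Φ x)‖ ≤ control l u v Φ x :=
  (le_add_of_nonneg_right (norm_nonneg _)).trans (le_add_of_nonneg_right (norm_nonneg _))

theorem control_bound (cN : Continuous fun x => crossRatio l (Φ x)) (cu : Continuous u)
    (cv : Continuous v) (iN : Integrable fun x => (1 + x ^ 2) * ‖crossRatio l (Φ x)‖ ^ 2)
    (iu : Integrable fun x => (1 + x ^ 2) * ‖u x‖ ^ 2)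
    (iv : Integrable fun x => (1 + x ^ 2) * ‖v x‖ ^ 2) :
    Continuous (control l u v Φ) ∧ Integrable (fun x => (1 + x ^ 2) * control l u v Φ x ^ 2) ∧
      ∫ x, (1 + x ^ 2) * control l u v Φ x ^ 2
        ≤ 3 * ((∫ x, (1 + x ^ 2) * ‖crossRatio l (Φ x)‖ ^ 2) + (∫ x, (1 + x ^ 2) * ‖u x‖ ^ 2)
          + ∫ x, (1 + x ^ 2) * ‖v x‖ ^ 2) := by
  have cG : Continuous (control l u v Φ) := (cN.norm.add cu.norm).add cv.norm
  have pt : ∀ x, (1 + x ^ 2) * control l u v Φ x ^ 2 ≤ 3 * ((1 + x ^ 2) *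
      ‖crossRatio l (Φ x)‖ ^ 2 + (1 + x ^ 2) * ‖u x‖ ^ 2 + (1 + x ^ 2) * ‖v x‖ ^ 2) := fun x => by
    unfold control
    generalize ‖crossRatio l (Φ x)‖ = a
    generalize ‖u x‖ = b
    generalize ‖v x‖ = c
    have : (a + b + c) ^ 2 ≤ 3 * (a ^ 2 + b ^ 2 + c ^ 2) := by
      nlinarith [sq_nonneg (a - b), sq_nonneg (a - c), sq_nonneg (b - c)]
    refine (mul_le_mul_of_nonneg_left this (by positivity : 0 ≤ 1 + x ^ 2)).trans
      (le_of_eq (by ring))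
  have iS : Integrable fun x => 3 * ((1 + x ^ 2) * ‖crossRatio l (Φ x)‖ ^ 2
      + (1 + x ^ 2) * ‖u x‖ ^ 2 + (1 + x ^ 2) * ‖v x‖ ^ 2) :=
    ((iN.add iu).add iv).const_mul 3
  have iG : Integrable fun x => (1 + x ^ 2) * control l u v Φ x ^ 2 :=
    iS.mono' (Continuous.aestronglyMeasurable (by fun_prop)) (Eventually.of_forall fun x => by
      rw [Real.norm_of_nonneg (by positivity)]; exact pt x)
  refine ⟨cG, iG, (integral_mono iG iS pt).trans (le_of_eq ?_)⟩
  have h3 := integral_add' (iN.add iu) iv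
  have h4 := integral_add' iN iu
  simp only [Pi.add_apply] at h3 h4
  rw [integral_const_mul, h3, h4]

end Control

/-- The Darboux transformation with a combination of the Jost solutions is bounded on bounded sets
of potentials for which the scattering coefficient is bounded away from zero. -/
theorem exists_darboux_bound (hl : l ∈ quadrantI) {c : ℂ} (hc : c ≠ 0) (M : ℝ) {d : ℝ}
    (hd : 0 < d) :
    ∃ C, 0 < C ∧ ∀ u v w, XRep u v w M → d ≤ ‖scatA u l‖ →
      MemX (darboux (jostCombination u l c) l u) ∧
        normX (darboux (jostCombination u l c) l u) ≤ C := by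
  have hr : 0 < l.re := hl.1
  have hi : 0 ≤ (l ^ 2).im := le_of_lt (quadrantI_subset hl)
  obtain ⟨C, hC⟩ := exists_crossRatio_bound hl one_ne_zero hc (M ^ 2) (uniformExpBound M ‖l‖) hd
  -- All admissible potentials form one family, so a single application of `exists_ratio_derivs`
  -- yields constants independent of the potential.
  let ι := {t : (ℝ → ℂ) × (ℝ → ℂ) × (ℝ → ℂ) // XRep t.1 t.2.1 t.2.2 M ∧ d ≤ ‖scatA t.1 l‖}
  have ha : ∀ i : ι, scatA i.1.1 l ≠ 0 := fun i => norm_pos_iff.1 (hd.trans_le i.2.2)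
  have h0 : ∀ (i : ι) x, combination i.1.1 l 1 c x ≠ 0 := fun i =>
    combination_ne_zero i.2.1.pot hi one_ne_zero c (ha i)
  obtain ⟨P₁, N₁, eP, eN, ⟨⟨K₁, bP₁⟩, P₂, eP₁, cP₂, K₂, bP₂⟩, ⟨_, N₂, eN₁, cN₂, K₃, bN₂⟩,
    _, ⟨K₄, bN₁⟩⟩ := exists_ratio_derivs (ι := ι) (l := l) (u := fun i => i.1.1)
      (v := fun i => i.1.2.1) (Φ := fun i => combination i.1.1 l 1 c) hl (fun i => i.2.1.hu)
      (fun i => i.2.1.continuous_v) (fun i => i.2.1.norm_le)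
      (fun i => isSol_combination i.2.1.pot hi 1 c) h0
  set s := l / conj l with hs
  set t := -((l ^ 2 - conj l ^ 2) / conj l) with ht
  set k := -(2 * Complex.I * (l ^ 2 - conj l ^ 2)) with hk
  -- K is the sum of all bounds needed below, so each of them follows from nonnegativity of the
  -- other summands.
  set K := 2 * (Real.pi + M ^ 2) + (‖s‖ + ‖t‖ * l.re⁻¹) + ‖t‖ * |K₁| + ‖t‖ * |K₂| + ‖k‖ * |K₃|
    + ‖k‖ * |K₄| + ‖k‖ with hK
  have q0 : 0 ≤ 2 * (Real.pi + M ^ 2) := by positivity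
  have q1 : 0 ≤ ‖s‖ + ‖t‖ * l.re⁻¹ := by positivity
  have q2 : 0 ≤ ‖t‖ * |K₁| := by positivity
  have q3 : 0 ≤ ‖t‖ * |K₂| := by positivity
  have q4 : 0 ≤ ‖k‖ * |K₃| := by positivity
  have q5 : 0 ≤ ‖k‖ * |K₄| := by positivity
  have q6 : 0 ≤ ‖k‖ := norm_nonneg k
  have hC0 : 0 ≤ max C 0 := le_max_right _ _
  set C' := 3 * (max C 0 + 2 * M ^ 2) with hC'
  set M' := 1 + (9 * K ^ 2 * C' + 2 * (K ^ 2 + 3 * K) ^ 2 * C' + 2 * K ^ 2 * M ^ 2) with hM'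
  have hM0 : 0 < M' := by positivity
  refine ⟨4 * M', by positivity, fun u v w h hda => ?_⟩
  obtain ⟨hN, hNC⟩ := hC u h.pot h.iu h.bu (h.expBound_le l) hda
  let i : ι := ⟨(u, v, w), h, hda⟩
  have cN : Continuous fun x => crossRatio l (combination u l 1 c x) :=
    continuous_iff_continuousAt.2 fun x => (eN i x).continuousAt
  obtain ⟨-, iG, bG'⟩ := control_bound cN h.continuous_u h.continuous_v hN h.iu h.iv
  have bG : ∫ x, (1 + x ^ 2) * control l u v (combination u l 1 c) x ^ 2 ≤ C' := by
    refine bG'.trans ?_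
    rw [hC']
    have := h.bu
    have := h.bv
    have := le_max_left C 0
    linarith
  set G := control l u v (combination u l 1 c) with hG
  have G0 : ∀ x, 0 ≤ G x := fun x => control_nonneg x
  have bt : ∀ {z : ℂ} {L x : ℝ} (r : ℂ), ‖z‖ ≤ L * G x → ‖r‖ * |L| ≤ K → ‖r * z‖ ≤ K * G x := by
    intro z L x r hz hr
    rw [norm_mul]
    calc ‖r‖ * ‖z‖ ≤ ‖r‖ * (|L| * G x) := mul_le_mul_of_nonneg_left
          (hz.trans (mul_le_mul_of_nonneg_right (le_abs_self L) (G0 x))) (norm_nonneg r)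
      _ = ‖r‖ * |L| * G x := by ring
      _ ≤ K * G x := mul_le_mul_of_nonneg_right hr (G0 x)
  have X := h.transform (S := fun x => s + t * fstRatio l (combination u l 1 c x))
    (S₁ := fun x => t * P₁ i x) (S₂ := fun x => t * P₂ i x)
    (N := fun x => k * crossRatio l (combination u l 1 c x))
    (N₁ := fun x => k * N₁ i x) (N₂ := fun x => k * N₂ i x) (G := G) (K := K) (C := C')
    (fun x => ((eP i x).const_mul t).const_add s) (fun x => (eP₁ i x).const_mul t)
    (fun x => (eN i x).const_mul k) (fun x => (eN₁ i x).const_mul k)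
    (continuous_const.mul (cP₂ i)) (continuous_const.mul (cN₂ i)) G0 iG bG
    (fun x => norm_fst_le_control x) (fun x => norm_snd_le_control x)
    (fun x => (h.norm_le x).trans (by linarith))
    (fun x => by
      refine (norm_add_le _ _).trans ?_
      rw [norm_mul]
      have := mul_le_mul_of_nonneg_left (norm_fstRatio_le hr (h0 i x)) (norm_nonneg t)
      change ‖t‖ * ‖fstRatio l (combination u l 1 c x)‖ ≤ _ at this
      linarith)
    (fun x => by
      rw [norm_mul]
      have h1 : ‖P₁ i x‖ ≤ |K₁| := le_trans (by simpa using bP₁ i x) (le_abs_self _)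
      have := mul_le_mul_of_nonneg_left h1 (norm_nonneg t)
      linarith)
    (fun x => bt t (bP₂ i x) (by linarith))
    (fun x => bt (L := 1) k (by
      rw [one_mul]
      exact norm_crossRatio_le_control x)
      (by rw [abs_one, mul_one]; linarith))
    (fun x => bt k (bN₁ i x) (by linarith))
    (fun x => bt k (bN₂ i x) (by linarith))
  rw [← combination_one, darboux_eq hr (h0 i)]
  exact ⟨X.memX, X.normX_le hM0.le⟩

end Bound

/-! ### Dependence on the almost everywhere class of the potential -/

section Congr

variable {p q : ℝ → ℂ} {l : ℂ}

theorem isJostMinus_congr (h : p =ᵐ[volume] q) (φ : ℝ → ℂ × ℂ) :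
    IsJostMinus p l φ ↔ IsJostMinus q l φ := by
  unfold IsJostMinus
  have e1 : ∀ x, ∫ y in Iic x, (Complex.I / 4 * (p y * conj (p y)) * (φ y).1 + l * p y * (φ y).2)
      = ∫ y in Iic x, (Complex.I / 4 * (q y * conj (q y)) * (φ y).1 + l * q y * (φ y).2) :=
    fun x => integral_congr_ae (ae_restrict_of_ae (by filter_upwards [h] with y hy; rw [hy]))
  have e2 : ∀ x : ℝ, ∫ y in Iic x, Complex.exp (2 * Complex.I * l ^ 2 * ((x : ℂ) - (y : ℂ))) *
          (-(l * conj (p y)) * (φ y).1 - Complex.I / 4 * (p y * conj (p y)) * (φ y).2)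
      = ∫ y in Iic x, Complex.exp (2 * Complex.I * l ^ 2 * ((x : ℂ) - (y : ℂ))) *
          (-(l * conj (q y)) * (φ y).1 - Complex.I / 4 * (q y * conj (q y)) * (φ y).2) :=
    fun x => integral_congr_ae (ae_restrict_of_ae (by filter_upwards [h] with y hy; rw [hy]))
  simp only [e1, e2]

theorem isJostPlus_congr (h : p =ᵐ[volume] q) (φ : ℝ → ℂ × ℂ) :
    IsJostPlus p l φ ↔ IsJostPlus q l φ := by
  unfold IsJostPlus
  have e1 : ∀ x : ℝ, ∫ y in Ioi x, Complex.exp (-(2 * Complex.I * l ^ 2 * ((x : ℂ) - (y : ℂ)))) *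
          (Complex.I / 4 * (p y * conj (p y)) * (φ y).1 + l * p y * (φ y).2)
      = ∫ y in Ioi x, Complex.exp (-(2 * Complex.I * l ^ 2 * ((x : ℂ) - (y : ℂ)))) *
          (Complex.I / 4 * (q y * conj (q y)) * (φ y).1 + l * q y * (φ y).2) :=
    fun x => integral_congr_ae (ae_restrict_of_ae (by filter_upwards [h] with y hy; rw [hy]))
  have e2 : ∀ x : ℝ, ∫ y in Ioi x,
          (-(l * conj (p y)) * (φ y).1 - Complex.I / 4 * (p y * conj (p y)) * (φ y).2)
      = ∫ y in Ioi x,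
          (-(l * conj (q y)) * (φ y).1 - Complex.I / 4 * (q y * conj (q y)) * (φ y).2) :=
    fun x => integral_congr_ae (ae_restrict_of_ae (by filter_upwards [h] with y hy; rw [hy]))
  simp only [e1, e2]

open Classical in
-- The Volterra integrals see only the class of the potential almost everywhere, so the defining
-- predicates coincide and the classical choices made from them are identical.
theorem solMinus_congr (h : p =ᵐ[volume] q) : solMinus p = solMinus q := by
  have e : ∀ l, IsJostMinus p l = IsJostMinus q l := fun l =>
    funext fun φ => propext (isJostMinus_congr h φ)
  have e' : ∀ l, jostMinus p l = jostMinus q l := fun l => congrArg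
    (fun X : (ℝ → ℂ × ℂ) → Prop => if h : ∃ φ, X φ then h.choose else 0) (e l)
  funext l x
  simp only [solMinus, e']

open Classical in
theorem solPlus_congr (h : p =ᵐ[volume] q) : solPlus p = solPlus q := by
  have e : ∀ l, IsJostPlus p l = IsJostPlus q l := fun l =>
    funext fun φ => propext (isJostPlus_congr h φ)
  have e' : ∀ l, jostPlus p l = jostPlus q l := fun l => congrArg
    (fun X : (ℝ → ℂ × ℂ) → Prop => if h : ∃ φ, X φ then h.choose else 0) (e l)
  funext l x
  simp only [solPlus, e']

theorem scatA_congr (h : p =ᵐ[volume] q) : scatA p = scatA q := by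
  funext l
  simp only [scatA, solMinus_congr h, solPlus_congr h]

theorem darboux_congr (h : p =ᵐ[volume] q) (Φ : ℝ → ℂ × ℂ) (l : ℂ) :
    darboux Φ l p =ᵐ[volume] darboux Φ l q := by
  filter_upwards [h] with x hx
  simp only [darboux, hx]

theorem jostCombination_congr (h : p =ᵐ[volume] q) (l c : ℂ) :
    jostCombination p l c = jostCombination q l c := by
  unfold jostCombination
  rw [solMinus_congr h, solPlus_congr h]

/-- Numerators and denominators all scale by |s|². -/
theorem darboux_smul {s : ℂ} (hs : s ≠ 0) {Φ Ψ : ℝ → ℂ × ℂ} (h : ∀ x, Ψ x = s • Φ x) (l : ℂ)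
    (q : ℝ → ℂ) : darboux Ψ l q = darboux Φ l q := by
  have hss : s * conj s ≠ 0 := mul_ne_zero hs ((map_ne_zero _).2 hs)
  funext x
  have e : (s • Φ x).1 * conj (s • Φ x).2 = s * conj s * ((Φ x).1 * conj (Φ x).2) := by
    simp only [Prod.smul_fst, Prod.smul_snd, smul_eq_mul, map_mul]; ring
  have e1 : coeffC l (Ψ x) = coeffC l (Φ x) := by
    rw [h]; unfold coeffC; rw [m_smul, m_smul, mul_div_mul_left _ _ hss]
  have e2 : coeffD l (Ψ x) = coeffD l (Φ x) := by
    rw [h]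
    unfold coeffD
    rw [m_smul, mul_assoc, e, mul_left_comm, mul_div_mul_left _ _ hss, mul_assoc]
  rw [darboux, darboux, e1, e2]

theorem continuous_darboux {u : ℝ → ℂ} {Φ : ℝ → ℂ × ℂ} (hl : 0 < l.re) (hu : Continuous u)
    (hΦ : Continuous Φ) (h0 : ∀ x, Φ x ≠ 0) : Continuous (darboux Φ l u) := by
  have c2 := Complex.continuous_conj
  have c3 := (continuous_m l).comp hΦ
  have c4 : Continuous fun x => crossRatio l (Φ x) :=
    Continuous.div (by fun_prop) c3 fun x => m_ne_zero hl (h0 x)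
  have c5 : Continuous fun x => fstRatio l (Φ x) :=
    Continuous.div (by fun_prop) c3 fun x => m_ne_zero hl (h0 x)
  rw [darboux_eq hl h0]
  fun_prop

end Congr

/-- The data of a potential with a single zero and of its Darboux transform, in terms of
continuous representatives. -/
theorem exists_continuous_rep {q : ℝ → ℂ} {l : ℂ} {M : ℝ} (hl : l ∈ quadrantI) (hq : q ∈ Z 1)
    (ha : scatA q l = 0) (hX : MemX (darboux (solMinus q l) l q))
    (hM : normX (darboux (solMinus q l) l q) ≤ M) :
    ∃ p v w, q =ᵐ[volume] p ∧ Pot p ∧ XRep (darboux (solMinus p l) l p) v w M ∧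
      ∀ z ∈ quadrantI, scatA (darboux (solMinus p l) l p) z ≠ 0 := by
  obtain ⟨hqX, hcard, hsimple⟩ := hq
  obtain ⟨p, v₀, w₀, hqp, hp⟩ := hqX.exists_rep le_rfl
  have hi : 0 ≤ (l ^ 2).im := le_of_lt (quadrantI_subset hl)
  have hsp := isSol_solMinus hp.pot hi
  have hae : darboux (solMinus q l) l q =ᵐ[volume] darboux (solMinus p l) l p := by
    rw [solMinus_congr hqp]; exact darboux_congr hqp _ l
  obtain ⟨u, v, w, hu, hrep⟩ := hX.exists_rep hM
  have hc := continuous_darboux (l := l) hl.1 hp.continuous_u hsp.continuous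
    (solMinus_ne_zero hp.pot hi)
  -- Both functions are continuous and agree almost everywhere, hence everywhere; the regularity of
  -- the representative thus passes to the transform of p.
  have he : u = darboux (solMinus p l) l p :=
    (Continuous.ae_eq_iff_eq volume hrep.continuous_u hc).1 (hu.symm.trans hae)
  subst he
  rw [scatA_congr hqp] at ha hcard hsimple
  obtain ⟨z₀, hz₀⟩ := Set.encard_eq_one.1 (by simpa using hcard)
  have huniq : ∀ z ∈ quadrantI, scatA p z = 0 → z = l := by
    have hmem : ∀ z, z ∈ quadrantI → scatA p z = 0 → z = z₀ := fun z h1 h2 => by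
      have : z ∈ {l | l ∈ quadrantI ∧ scatA p l = 0} := ⟨h1, h2⟩
      rw [hz₀] at this
      exact this
    intro z h1 h2
    rw [hmem z h1 h2, hmem l hl ha]
  exact ⟨p, v, w, hqp, hp.pot, hrep, fun z hz =>
    scatA_darboux_ne_zero hp.pot hl ha huniq (hsimple l hl ha) hrep.pot hz⟩

end DNLSII

/-- For `l` in the open first quadrant, a nonzero constant `c` and `M > 0` there is a bound `C`,
independent of the potentials, for the inverse Darboux transforms of `q₁ = B(Φ₁, l) q`, for `q ∈ Z_1`
with `a(l) = 0`, `Φ₁ = φ₋ e^{-i l² x}` and `‖q₁‖ ≤ M`: first with `Φ̃₁` the combination with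
constant `c` of the Jost functions of `q₁`, then with `Φ̃₁` the vector that inverts `B(Φ₁, l)`, when
`c` is the norming constant of `q`. -/
theorem proposition4p4 (l : ℂ) (hl : l ∈ DNLSII.quadrantI) (c : ℂ) (hc : c ≠ 0)
    (M : ℝ) (hM : 0 < M) :
    ∃ C : ℝ, 0 < C ∧ ∀ q : ℝ → ℂ, q ∈ DNLSII.Z 1 → DNLSII.scatA q l = 0 →
      ∀ q₁ : ℝ → ℂ, q₁ = DNLSII.darboux (DNLSII.solMinus q l) l q →
        DNLSII.MemX q₁ → DNLSII.normX q₁ ≤ M →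
          (DNLSII.MemX (DNLSII.darboux (DNLSII.jostCombination q₁ l c) l q₁) ∧
            DNLSII.normX (DNLSII.darboux (DNLSII.jostCombination q₁ l c) l q₁) ≤ C) ∧
          ((∀ x, DNLSII.solMinus q l x = c • DNLSII.solPlus q l x) →
            DNLSII.MemX (DNLSII.darboux (DNLSII.inverseVector (DNLSII.solMinus q l) l) l q₁) ∧
            DNLSII.normX
              (DNLSII.darboux (DNLSII.inverseVector (DNLSII.solMinus q l) l) l q₁) ≤ C) := by
  obtain ⟨d, hd, hlow⟩ := DNLSII.exists_le_norm_scatA hl M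
  obtain ⟨C₁, hC₁, h₁⟩ := DNLSII.exists_darboux_bound hl hc M hd
  -- The inverse vector is a multiple of the combination with constant -c, so the second case uses
  -- the bound for -c.
  obtain ⟨C₂, hC₂, h₂⟩ := DNLSII.exists_darboux_bound hl (neg_ne_zero.2 hc) M hd
  refine ⟨max C₁ C₂, lt_max_of_lt_left hC₁, ?_⟩
  rintro q hq ha q₁ rfl hX hle
  obtain ⟨p, v, w, hqp, hp, hrep, hne⟩ := DNLSII.exists_continuous_rep hl hq ha hX hle
  have hae : DNLSII.darboux (DNLSII.solMinus q l) l q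
      =ᵐ[MeasureTheory.volume] DNLSII.darboux (DNLSII.solMinus p l) l p := by
    rw [DNLSII.solMinus_congr hqp]; exact DNLSII.darboux_congr hqp _ l
  have hda := hlow _ v w hrep hne
  have b₁ := h₁ _ v w hrep hda
  have b₂ := h₂ _ v w hrep hda
  have htr : ∀ Φ, DNLSII.darboux Φ l (DNLSII.darboux (DNLSII.solMinus p l) l p)
      =ᵐ[MeasureTheory.volume] DNLSII.darboux Φ l (DNLSII.darboux (DNLSII.solMinus q l) l q) :=
    fun Φ => DNLSII.darboux_congr hae.symm Φ l
  refine ⟨?_, fun hcx => ?_⟩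
  · rw [DNLSII.jostCombination_congr hae]
    exact ⟨DNLSII.memX_congr (htr _) b₁.1, (DNLSII.normX_congr (htr _)).symm.trans_le
      (b₁.2.trans (le_max_left _ _))⟩
  · rw [DNLSII.solMinus_congr hqp, DNLSII.solPlus_congr hqp] at hcx
    obtain ⟨s, hs, hsx⟩ := DNLSII.inverseVector_eq hp hl hrep.pot hc hcx (hne l hl)
    rw [← DNLSII.darboux_smul hs hsx] at b₂
    rw [← DNLSII.solMinus_congr hqp] at b₂ htr
    exact ⟨DNLSII.memX_congr (htr _) b₂.1, (DNLSII.normX_congr (htr _)).symm.trans_le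
      (b₂.2.trans (le_max_right _ _))⟩
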